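/- Let $2\le n_1\le n_2$ be integers. For $1\le i\le n_1$ and $1\le j\le n_2$ put $\phi_{i,j}(x,y)=\big(n_1^{-1}(i-1+x),\,n_2^{-1}(j-1+y)\big)$ on $\mathbb R^2$ with the Euclidean metric. For a nonempty set $A\subset\{1,\dots,n_1\}\times\{1,\dots,n_2\}$ let $\mathcal F_A=\{\phi_{i,j}:(i,j)\in A\}$, and let the Bedford–McMullen carpet $\mathcal S_A$ be its attractor, i.e. the unique nonempty compact set with $\mathcal S_A=\bigcup_{(i,j)\in A}\phi_{i,j}(\mathcal S_A)$. Let $A_i=\{i\}\times\{1,\dots,n_2\}$ and $A_0=\bigcup_{i=1}^{n_1}A_i$. For $\beta>0$, a set $\Gamma\subset\mathbb R^2$ is a $\beta$-Hölder curve if $\Gamma=f([0,1])$ for a continuous map $f$ such that, for some $H<\infty$, $|f(x)-f(y)|\le H|x-y|^{\beta}$ for all $x,y\in[0,1]$. The exponent $\beta$ is sharp for $\Gamma$ if $\Gamma$ is a $\beta$-Hölder curve and is not a $\gamma$-Hölder curve for any $\gamma>\beta$. **Theorem.** For all such $n_1,n_2,A$, the similarity dimension of $\mathcal F_A$, i.e.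 the unique real number $s$ with $\sum_{(i,j)\in A}(\operatorname{Lip}\phi_{i,j})^s=1$, equals $s=\log_{n_1}(\operatorname{card}A)$. If $\operatorname{card}A=1$, then $\mathcal S_A$ is a point; if $A=A_i$ for some $1\le i\le n_1$, then $\mathcal S_A$ is the vertical segment $\{(i-1)/(n_1-1)\}\times[0,1]$; if $A=A_0$, then $\mathcal S_A=[0,1]^2$. Suppose now that $\mathcal S_A$ is connected. 1. If $\mathcal S_A$ is a point, then it is a $\beta$-Hölder curve for every $\beta>0$. 2. If $\mathcal S_A$ is a nondegenerate line segment (in particular a vertical one), then it is a $1$-Hölder curve, and the exponent $1$ is sharp. 3. If $\mathcal S_A=[0,1]^2$, then it is a $(1/2)$-Hölder curve, and the exponent $1/2$ is sharp. 4. If $\operatorname{card}A\neq1$ and $A\notin\{A_0,A_1,\dots,A_{n_1}\}$ (so, in particular, whenever $\mathcal S_A$ is neither a point, nor a vertical segment, nor $[0,1]^2$), then $\mathcal S_A$ is a $(1/s)$-Hölder curve with $s=\log_{n_1}(\operatorname{card}A)$, and the exponent $1/s$ is sharp. Moreover, there are $n_1,n_2$ and $A$ as in case 4, with $\mathcal S_A$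 connected, for which $s=\log_{n_1}(\operatorname{card}A)>2$. -/

import Mathlib

open scoped ENNReal

noncomputable section

namespace HolderCarpet

/-! ### Iterated function systems and their attractors -/

section IFS

variable {X : Type*} [MetricSpace X]

/-- The Lipschitz constant `Lip φ = sup_{x ≠ y} dist (φ x) (φ y) / dist x y ∈ [0, ∞]`. -/
def lipConst (φ : X → X) : ℝ≥0∞ :=
  ⨆ (x : X) (y : X) (_ : x ≠ y), edist (φ x) (φ y) / edist x y

/-- A contraction: a self-map with Lipschitz constant less than one. -/
def IsContraction (φ : X → X) : Prop := lipConst φ < 1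

variable {ι : Type*}

/-- `K` is an attractor of the family `φ`: a nonempty compact set with `K = ⋃ i, φ i (K)`. -/
def IsAttractor (φ : ι → X → X) (K : Set X) : Prop :=
  IsCompact K ∧ K.Nonempty ∧ K = ⋃ i, φ i '' K

/-- `s` is the similarity dimension of the finite family `φ`, i.e. `∑ i, (Lip (φ i)) ^ s = 1`,
with the convention that a trivial family (all Lipschitz constants zero) has dimension `0`. -/
def IsSimilarityDim [Fintype ι] (φ : ι → X → X) (s : ℝ) : Prop :=
  ((∀ i, lipConst (φ i) = 0) ∧ s = 0) ∨
    ((∃ i, lipConst (φ i) ≠ 0) ∧ ∑ i, (lipConst (φ i)).toReal ^ s = 1)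

theorem edist_le_lipConst_mul (φ : X → X) (x y : X) :
    edist (φ x) (φ y) ≤ lipConst φ * edist x y := by
  rcases eq_or_ne x y with rfl | h
  · simp
  · have h0 : edist x y ≠ 0 := by simpa using h
    have := le_iSup₂_of_le (f := fun (x y : X) => ⨆ (_ : x ≠ y), edist (φ x) (φ y) / edist x y)
      x y (le_iSup_of_le h le_rfl)
    exact (ENNReal.div_le_iff h0 (edist_ne_top x y)).1 this

theorem lipConst_le {φ : X → X} {c : ℝ≥0∞} (h : ∀ x y, edist (φ x) (φ y) ≤ c * edist x y) :
    lipConst φ ≤ c :=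
  iSup_le fun x => iSup_le fun y => iSup_le fun _ => ENNReal.div_le_of_le_mul (h x y)

/-- Hutchinson's theorem: a finite nonempty family of contractions of a nonempty complete metric
space has exactly one attractor. -/
theorem existsUnique_isAttractor [CompleteSpace X] [Nonempty X] [Fintype ι] [Nonempty ι]
    (φ : ι → X → X) (hφ : ∀ i, IsContraction (φ i)) : ∃! K : Set X, IsAttractor φ K := by
  classical
  have hlt : Finset.univ.sup (fun i => lipConst (φ i)) < 1 :=
    (Finset.sup_lt_iff (by simp)).2 fun i _ => hφ i
  obtain ⟨c, hc⟩ : ∃ c : NNReal, (c : ℝ≥0∞) = Finset.univ.sup (fun i => lipConst (φ i)) :=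
    ⟨_, ENNReal.coe_toNNReal hlt.ne_top⟩
  have hc1 : c < 1 := by
    rw [← hc] at hlt
    exact_mod_cast hlt
  have hlip : ∀ i, LipschitzWith c (φ i) := fun i x y =>
    (edist_le_lipConst_mul (φ i) x y).trans (by
      gcongr
      rw [hc]
      exact Finset.le_sup (f := fun i => lipConst (φ i)) (Finset.mem_univ i))
  let T : TopologicalSpace.NonemptyCompacts X → TopologicalSpace.NonemptyCompacts X := fun K =>
    ⟨⟨⋃ i, φ i '' (K : Set X),
      isCompact_iUnion fun i => K.isCompact.image (hlip i).continuous⟩,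
      Set.nonempty_iUnion.2 ⟨Classical.arbitrary ι, K.nonempty.image _⟩⟩
  have hTcoe : ∀ K, ((T K : TopologicalSpace.NonemptyCompacts X) : Set X)
      = ⋃ i, φ i '' (K : Set X) := fun K => rfl
  have hT : ContractingWith c T := by
    refine ⟨hc1, fun K L => ?_⟩
    change Metric.hausdorffEDist (⋃ i, φ i '' (K : Set X)) (⋃ i, φ i '' (L : Set X))
      ≤ c * Metric.hausdorffEDist (K : Set X) (L : Set X)
    refine Metric.hausdorffEDist_iUnion_le.trans (iSup_le fun i => ?_)
    have key : ∀ (K L : TopologicalSpace.NonemptyCompacts X), ∀ x ∈ φ i '' (K : Set X),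
        ∃ y ∈ φ i '' (L : Set X), edist x y ≤ c * Metric.hausdorffEDist (K : Set X) (L : Set X) := by
      rintro K L _ ⟨x, hx, rfl⟩
      obtain ⟨y, hy, hxy⟩ := L.isCompact.exists_infEDist_eq_edist L.nonempty x
      refine ⟨φ i y, ⟨y, hy, rfl⟩, (hlip i x y).trans ?_⟩
      gcongr
      rw [← hxy]
      exact Metric.infEDist_le_hausdorffEDist_of_mem hx
    refine Metric.hausdorffEDist_le_of_mem_edist (key K L) ?_
    rw [Metric.hausdorffEDist_comm (s := (K : Set X))]
    exact key L K
  refine ⟨(ContractingWith.fixedPoint T hT : TopologicalSpace.NonemptyCompacts X), ?_, ?_⟩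
  · refine ⟨TopologicalSpace.NonemptyCompacts.isCompact _,
      TopologicalSpace.NonemptyCompacts.nonempty _, ?_⟩
    rw [← hTcoe, hT.fixedPoint_isFixedPt]
  · rintro K ⟨hK, hne, hKeq⟩
    let K' : TopologicalSpace.NonemptyCompacts X := ⟨⟨K, hK⟩, hne⟩
    have hfix : Function.IsFixedPt T K' := TopologicalSpace.NonemptyCompacts.ext hKeq.symm
    have := hT.fixedPoint_unique hfix
    rw [← this]
    rfl

/-- The attractor of a finite nonempty family of contractions of a complete metric space. -/
def attractor [CompleteSpace X] [Nonempty X] [Fintype ι] [Nonempty ι]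
    (φ : ι → X → X) (hφ : ∀ i, IsContraction (φ i)) : Set X :=
  (existsUnique_isAttractor φ hφ).choose

theorem isAttractor_attractor [CompleteSpace X] [Nonempty X] [Fintype ι] [Nonempty ι]
    (φ : ι → X → X) (hφ : ∀ i, IsContraction (φ i)) : IsAttractor φ (attractor φ hφ) :=
  (existsUnique_isAttractor φ hφ).choose_spec.1

end IFS

/-! ### Hölder curves -/

/-- `Γ` is a `β`-Hölder curve: the image of a continuous map `f` on `[0, 1]` with
`dist (f x) (f y) ≤ H |x - y| ^ β` for some constant `H < ∞`. -/
def IsHolderCurve {X : Type*} [MetricSpace X] (β : ℝ) (Γ : Set X) : Prop :=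
  ∃ f : unitInterval → X, Continuous f ∧ Set.range f = Γ ∧
    ∃ H : ℝ, ∀ x y : unitInterval, dist (f x) (f y) ≤ H * |(x : ℝ) - y| ^ β

/-- `Γ` is a `β`-Hölder curve with `β > 0`, and the exponent `β` cannot be increased. -/
def IsSharpHolderExponent {X : Type*} [MetricSpace X] (β : ℝ) (Γ : Set X) : Prop :=
  IsGreatest {γ : ℝ | 0 < γ ∧ IsHolderCurve γ Γ} β

/-! ### Bedford–McMullen carpets -/

/-- The Euclidean plane. -/
abbrev Plane : Type := EuclideanSpace ℝ (Fin 2)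

/-- The affine map `(x, y) ↦ ((i + x) / n₁, (j + y) / n₂)`; indices start at `0`. -/
def carpetMap {n₁ n₂ : ℕ} (ij : Fin n₁ × Fin n₂) (p : Plane) : Plane :=
  !₂[(((ij.1 : ℕ) : ℝ) + p 0) / n₁, (((ij.2 : ℕ) : ℝ) + p 1) / n₂]

theorem isContraction_carpetMap {n₁ n₂ : ℕ} (h₁ : 2 ≤ n₁) (h₁₂ : n₁ ≤ n₂)
    (ij : Fin n₁ × Fin n₂) : IsContraction (carpetMap ij) := by
  have hn1 : (2 : ℝ) ≤ n₁ := by exact_mod_cast h₁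
  have hn2 : (2 : ℝ) ≤ n₂ := by exact_mod_cast h₁.trans h₁₂
  have hc : lipConst (carpetMap ij) ≤ ENNReal.ofReal (1 / 2) := by
    refine lipConst_le fun p q => ?_
    rw [edist_dist, edist_dist, ← ENNReal.ofReal_mul (by norm_num)]
    refine ENNReal.ofReal_le_ofReal ?_
    have aux : ∀ (n a u v : ℝ), 2 ≤ n →
        ((a + u) / n - (a + v) / n) ^ 2 ≤ (1 / 2) ^ 2 * (u - v) ^ 2 := by
      intro n a u v hn
      have h : (a + u) / n - (a + v) / n = (1 / n) * (u - v) := by ring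
      have h' : 1 / n ≤ 1 / 2 := one_div_le_one_div_of_le (by norm_num) hn
      have h0 : 0 ≤ 1 / n := by positivity
      rw [h, mul_pow]
      gcongr
    rw [EuclideanSpace.dist_eq, EuclideanSpace.dist_eq]
    simp only [Fin.sum_univ_two, Real.dist_eq, sq_abs]
    have e : (1 / 2 : ℝ) = √((1 / 2) ^ 2) := by rw [Real.sqrt_sq (by norm_num)]
    rw [e, ← Real.sqrt_mul (by positivity)]
    refine Real.sqrt_le_sqrt ?_
    rw [mul_add]
    refine add_le_add ?_ ?_
    · simpa [carpetMap] using aux n₁ _ (p 0) (q 0) hn1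
    · simpa [carpetMap] using aux n₂ _ (p 1) (q 1) hn2
  refine hc.trans_lt ?_
  rw [ENNReal.ofReal_lt_one]
  norm_num

/-- The iterated function system associated with a set `A` of indices. -/
def carpetIFS {n₁ n₂ : ℕ} (A : Finset (Fin n₁ × Fin n₂)) (a : A) : Plane → Plane :=
  carpetMap a.1

/-- The Bedford–McMullen carpet of a nonempty set `A` of indices: the attractor of its iterated
function system. -/
def carpet {n₁ n₂ : ℕ} (h₁ : 2 ≤ n₁) (h₁₂ : n₁ ≤ n₂) (A : Finset (Fin n₁ × Fin n₂))
    (hA : A.Nonempty) : Set Plane :=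
  haveI : Nonempty A := hA.to_subtype
  attractor (carpetIFS A) fun a => isContraction_carpetMap h₁ h₁₂ a.1

theorem isAttractor_carpet {n₁ n₂ : ℕ} (h₁ : 2 ≤ n₁) (h₁₂ : n₁ ≤ n₂)
    (A : Finset (Fin n₁ × Fin n₂)) (hA : A.Nonempty) :
    IsAttractor (carpetIFS A) (carpet h₁ h₁₂ A hA) :=
  haveI : Nonempty A := hA.to_subtype
  isAttractor_attractor _ _

/-- All the indices `(i, j)` with fixed `i`. -/
def column {n₁ : ℕ} (n₂ : ℕ) (i : Fin n₁) : Finset (Fin n₁ × Fin n₂) :=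
  {i} ×ˢ Finset.univ

/-- The unit square `[0, 1]²`. -/
def unitSquare : Set Plane :=
  {p | p 0 ∈ Set.Icc (0 : ℝ) 1 ∧ p 1 ∈ Set.Icc (0 : ℝ) 1}

/-- The vertical segment `{c} × [0, 1]`. -/
def verticalSegment (c : ℝ) : Set Plane :=
  {p | p 0 = c ∧ p 1 ∈ Set.Icc (0 : ℝ) 1}

/-- `A` is none of the exceptional index sets: neither one index, nor a full column, nor
everything. -/
def IsOrdinary {n₁ n₂ : ℕ} (A : Finset (Fin n₁ × Fin n₂)) : Prop :=
  A.card ≠ 1 ∧ (∀ i : Fin n₁, A ≠ column n₂ i) ∧ A ≠ Finset.univ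

end HolderCarpet

end

/-!
The main point is that a connected carpet made of `N ≥ 2` pieces of width `1 / p` and height
`1 / q`, where `p ≤ q`, is a `1 / s`-Hölder curve for `s = log N / log p`
(`IsSelfAffine.isHolderCurve`). It suffices to find for each `k` a list of all `N ^ k` cells of
level `k`, with repetitions but of length `O(N ^ k)`, such that two entries of the list less than
`N ^ (k - i) / (2 N)` positions apart lie in cells of level `i` at bounded distance: a limit of
these lists along an ultrafilter is the curve (`isHolderCurve_of_slow_sequences`). As cells of
level `i` have diameter `O(p ^ (-i))`, only the horizontal contraction ratio enters.

The cells of level `i`, with those pairs joined whose copies of the carpet meet, form a connected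
graph, and spanning trees of these graphs can be chosen so that collapsing the cells of level
`i + 1` inside each cell of level `i` turns the tree of level `i + 1` into the tree of level `i`
(`exists_trees`). The list of level `k` is a tour around the tree of level `k`. A tour passes
through a cell of level `i` in several passages, between two edges of the tree of level `i`, and a
priori a short passage could lead from one end of the cell to the other, through many cells of the
next level. This is avoided by choosing the order in which branches are visited. Tours around all
cells are constructed by downward induction on `i`, and inside a cell of level `i` from the leaves
of the tree towards its root. When a tour around a cell `c` of level `i + 1` is combined with the
tours of the branches at its children, the exits of the cell of level `i` are either spread over
several branches, or lie in one branch only. In the latter case the tour around `c`, of mass at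
least `N ^ (k - i - 1)`, is reversed if necessary, so that its heavier side comes where the branch
has a short way to the exits (`exists_balanced`). As a cell has at most nine children, this makes
short passages begin and end close to each other (`exists_tour`). It follows that a short part of
the tour makes a bounded number of steps at each level: a tree walk that never comes from a parent
and returns to it goes up and then down, and visits different cells in either part, but a bounded
neighbourhood contains few cells of a level (`Walk.length_le`).

For the upper bound of the exponent, a connected carpet which is not exceptional has a vertical
line `x = const` in the interior of the square which it meets and leaves
(`IsSelfAffine.exists_gap`), since it projects onto the horizontal unit interval. By self-affinity,
a curve in the carpet that moves between two cells of level `k` then travels a distance of at least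
`δ p ^ (-k)`. Hence `N ^ k = O(p ^ (k / γ))` for a `γ`-Hölder curve (`le_rpow_of_holder`). The same
count bounds the exponents of segments and of the square, and the square itself is a `1 / 2`-Hölder
curve since it is a carpet with `p = q = 2` and `N = 4`.
-/

namespace HolderCarpet

open Filter Topology

/-! ### Rooted trees of grid cells and walks along them -/

/-- A cell of a grid, named by its integer coordinates; `dist` is the sup distance. -/
abbrev Cell : Type := ℤ × ℤ

/-- A finite rooted tree of cells, given by its parent function. Edges join cells at sup distance
at most one, and `rank` strictly decreases towards the root. -/
structure CellTree where
  /-- the vertices -/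
  verts : Finset Cell
  /-- the root -/
  root : Cell
  /-- the parent of a vertex other than the root -/
  par : Cell → Cell
  /-- a height function -/
  rank : Cell → ℕ
  par_mem : ∀ v ∈ verts, v ≠ root → par v ∈ verts
  rank_par : ∀ v ∈ verts, v ≠ root → rank (par v) < rank v
  dist_par : ∀ v ∈ verts, v ≠ root → dist v (par v) ≤ 1

/-- The children of a vertex. -/
def CellTree.children (T : CellTree) (w : Cell) : Finset Cell :=
  T.verts.filter fun v => v ≠ T.root ∧ T.par v = w

/-- A half-edge at a vertex `w`: `(w, none)` leads to the parent of `w` and `(w, some v)` leads to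
the child `v` of `w`. -/
abbrev HalfEdge : Type := Cell × Option Cell

/-- Two half-edges are linked if they are the two halves of an edge. -/
def CellTree.Link (T : CellTree) (a b : HalfEdge) : Prop :=
  ∃ v ∈ T.verts, v ≠ T.root ∧
    ((a = (v, none) ∧ b = (T.par v, some v)) ∨ (b = (v, none) ∧ a = (T.par v, some v)))

theorem CellTree.Link.symm {T : CellTree} {a b : HalfEdge} (h : T.Link a b) : T.Link b a := by
  obtain ⟨v, hv, hr, h⟩ := h
  exact ⟨v, hv, hr, h.symm⟩

theorem card_le_nine {S : Finset Cell} {w : Cell} (h : ∀ v ∈ S, dist v w ≤ 1) : S.card ≤ 9 := by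
  have : S ⊆ Finset.Icc (w.1 - 1) (w.1 + 1) ×ˢ Finset.Icc (w.2 - 1) (w.2 + 1) := by
    intro v hv
    have h1 := h v hv
    rw [Prod.dist_eq, max_le_iff, Int.dist_eq, Int.dist_eq] at h1
    have h2 : |v.1 - w.1| ≤ 1 := by exact_mod_cast h1.1
    have h3 : |v.2 - w.2| ≤ 1 := by exact_mod_cast h1.2
    rw [abs_le] at h2 h3
    simp only [Finset.mem_product, Finset.mem_Icc]
    omega
  refine (Finset.card_le_card this).trans ?_
  rw [Finset.card_product, Int.card_Icc, Int.card_Icc]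
  have e1 : w.1 + 1 + 1 - (w.1 - 1) = 3 := by ring
  have e2 : w.2 + 1 + 1 - (w.2 - 1) = 3 := by ring
  rw [e1, e2]
  exact le_of_eq rfl

theorem CellTree.card_children_le (T : CellTree) (w : Cell) : (T.children w).card ≤ 9 := by
  refine card_le_nine (w := w) fun v hv => ?_
  simp only [CellTree.children, Finset.mem_filter] at hv
  obtain ⟨hv, hr, rfl⟩ := hv
  exact T.dist_par v hv hr

/-- One visit of a tour to a vertex: it enters by the half-edge `src` and leaves by `tgt`; `load`
lists the cells of the finest level that it runs through. A visit with `isExit` set has an empty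
load and stands for the tour of a whole branch of the tree, to be inserted in its place. -/
structure Visit where
  /-- the half-edge of arrival -/
  src : HalfEdge
  /-- the half-edge of departure -/
  tgt : HalfEdge
  /-- the cells of the finest level -/
  load : List Cell
  /-- whether this is a placeholder for a branch -/
  isExit : Bool

/-- The same visit, run backwards. -/
def Visit.flip (s : Visit) : Visit := ⟨s.tgt, s.src, s.load.reverse, s.isExit⟩

/-- All the cells of the finest level met by a list of visits. -/
def loads (L : List Visit) : List Cell := L.flatMap Visit.load

/-- The number of steps at the finest level: the time that a list of visits takes. -/
def mass (L : List Visit) : ℕ := (loads L).length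

/-- The list of visits, run backwards. -/
def mirror (L : List Visit) : List Visit := (L.map Visit.flip).reverse

/-- The vertices at which branches have to be inserted. -/
def exitCells (L : List Visit) : List Cell := (L.filter Visit.isExit).map fun s => s.src.1

/-- There is no branch to insert. -/
def ExitFree (L : List Visit) : Prop := ∀ s ∈ L, s.isExit = false

@[simp] theorem loads_nil : loads [] = [] := rfl
@[simp] theorem loads_cons (s : Visit) (L : List Visit) : loads (s :: L) = s.load ++ loads L := by
  simp [loads]
@[simp] theorem loads_append (L M : List Visit) : loads (L ++ M) = loads L ++ loads M := by
  simp [loads]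
@[simp] theorem mass_nil : mass [] = 0 := rfl
@[simp] theorem mass_cons (s : Visit) (L : List Visit) :
    mass (s :: L) = s.load.length + mass L := by simp [mass]
@[simp] theorem mass_append (L M : List Visit) : mass (L ++ M) = mass L + mass M := by simp [mass]
@[simp] theorem exitCells_nil : exitCells [] = [] := rfl
@[simp] theorem exitCells_append (L M : List Visit) :
    exitCells (L ++ M) = exitCells L ++ exitCells M := by simp [exitCells]
@[simp] theorem mirror_append (L M : List Visit) : mirror (L ++ M) = mirror M ++ mirror L := by
  simp [mirror]
theorem mirror_cons (s : Visit) (L : List Visit) : mirror (s :: L) = mirror L ++ [s.flip] := by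
  simp [mirror]
@[simp] theorem exitFree_nil : ExitFree [] := by simp [ExitFree]
@[simp] theorem exitFree_append {L M : List Visit} :
    ExitFree (L ++ M) ↔ ExitFree L ∧ ExitFree M := by
  simp only [ExitFree, List.mem_append]
  exact ⟨fun h => ⟨fun s hs => h s (.inl hs), fun s hs => h s (.inr hs)⟩,
    fun h s hs => hs.elim (h.1 s) (h.2 s)⟩
@[simp] theorem exitFree_cons {s : Visit} {L : List Visit} :
    ExitFree (s :: L) ↔ s.isExit = false ∧ ExitFree L := by simp [ExitFree]
@[simp] theorem exitFree_reverse {L : List Visit} : ExitFree L.reverse ↔ ExitFree L := by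
  simp [ExitFree]

theorem mass_reverse (L : List Visit) : mass L.reverse = mass L := by
  induction L with
  | nil => rfl
  | cons s L ih => simp [ih, add_comm]

theorem exitFree_iff {L : List Visit} : ExitFree L ↔ exitCells L = [] := by
  simp [ExitFree, exitCells]

theorem mem_mirror {L : List Visit} {s : Visit} : s ∈ mirror L ↔ ∃ t ∈ L, t.flip = s := by
  simp [mirror]

theorem loads_mirror (L : List Visit) : loads (mirror L) = (loads L).reverse := by
  induction L with
  | nil => rfl
  | cons s L ih => simp [mirror_cons, ih, Visit.flip]

/-- `Walk R a L b`: the list of visits `L` starts with the half-edge `a`, ends with `b`, and each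
departure is related by `R` to the next arrival. -/
inductive Walk (R : HalfEdge → HalfEdge → Prop) : HalfEdge → List Visit → HalfEdge → Prop
  | single (s : Visit) : Walk R s.src [s] s.tgt
  | cons (s : Visit) {a b : HalfEdge} {L : List Visit} :
      R s.tgt a → Walk R a L b → Walk R s.src (s :: L) b

namespace Walk

variable {R : HalfEdge → HalfEdge → Prop} {a b c d : HalfEdge} {L M : List Visit}

theorem ne_nil (h : Walk R a L b) : L ≠ [] := by cases h <;> simp

theorem append (h : Walk R a L b) (hr : R b c) (h' : Walk R c M d) : Walk R a (L ++ M) d := by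
  induction h with
  | single s => exact .cons s hr h'
  | cons s hs _ ih => exact .cons s hs (ih hr)

theorem split (h : Walk R a (L ++ M) b) (hL : L ≠ []) (hM : M ≠ []) :
    ∃ c d, Walk R a L c ∧ R c d ∧ Walk R d M b := by
  induction L generalizing a with
  | nil => exact absurd rfl hL
  | cons s L ih =>
    rw [List.cons_append] at h
    rcases L with _ | ⟨t, L⟩
    · generalize hX : s :: ([] ++ M) = X at h
      cases h with
      | single s' => simp at hX; exact absurd hX.2 hM
      | cons s' hr hw =>
        simp only [List.nil_append, List.cons.injEq] at hX
        obtain ⟨rfl, rfl⟩ := hX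
        exact ⟨_, _, .single s, hr, hw⟩
    · generalize hX : s :: (t :: L ++ M) = X at h
      cases h with
      | single s' => simp at hX
      | cons s' hr hw =>
        simp only [List.cons.injEq] at hX
        obtain ⟨rfl, rfl⟩ := hX
        obtain ⟨c, d, h1, h2, h3⟩ := ih hw (by simp)
        exact ⟨c, d, .cons s hr h1, h2, h3⟩

theorem mirror (hR : ∀ x y, R x y → R y x) (h : Walk R a L b) :
    Walk R b (HolderCarpet.mirror L) a := by
  induction h with
  | single s => exact .single s.flip
  | cons s hs _ ih =>
    rw [mirror_cons]
    exact ih.append (hR _ _ hs) (.single s.flip)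

end Walk

/-! ### Passages through a cell, at all levels -/

/-- The rooted tree `T'` of cells refines the rooted tree `T` along the map `up`: collapsing each
fibre of `up`, a subtree with `N` vertices and top vertex `entry w`, turns `T'` into `T`. -/
structure Refines (T T' : CellTree) (up entry : Cell → Cell) (N : ℕ) : Prop where
  up_mem : ∀ c ∈ T'.verts, up c ∈ T.verts
  entry_mem : ∀ w ∈ T.verts, entry w ∈ T'.verts
  up_entry : ∀ w ∈ T.verts, up (entry w) = w
  entry_root : entry T.root = T'.root
  root_mem : T.root ∈ T.verts
  up_par_entry : ∀ w ∈ T.verts, w ≠ T.root → up (T'.par (entry w)) = T.par w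
  up_par : ∀ c ∈ T'.verts, c ≠ entry (up c) → up (T'.par c) = up c
  card_fiber : ∀ w ∈ T.verts, (T'.verts.filter fun c => up c = w).card = N

/-- The half-edge of the finer tree that lies on a given half-edge. Its first component is the
subcell of the cell `w` through which the tree leaves `w`, the port of the half-edge. -/
def refineHE (T' : CellTree) (entry : Cell → Cell) : HalfEdge → HalfEdge
  | (w, none) => (entry w, none)
  | (_, some v) => (T'.par (entry v), some (entry v))

theorem Refines.entry_ne_root {T T' : CellTree} {up entry : Cell → Cell} {N : ℕ}
    (h : Refines T T' up entry N) {w : Cell} (hw : w ∈ T.verts) (hr : w ≠ T.root) :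
    entry w ≠ T'.root := by
  intro h'
  rw [← h.entry_root] at h'
  exact hr (by rw [← h.up_entry w hw, h', h.up_entry _ h.root_mem])

theorem Refines.link {T T' : CellTree} {up entry : Cell → Cell} {N : ℕ}
    (h : Refines T T' up entry N) {a b : HalfEdge} (hab : T.Link a b) :
    T'.Link (refineHE T' entry a) (refineHE T' entry b) := by
  obtain ⟨v, hv, hr, h'⟩ := hab
  refine ⟨entry v, h.entry_mem v hv, h.entry_ne_root hv hr, ?_⟩
  rcases h' with ⟨rfl, rfl⟩ | ⟨rfl, rfl⟩
  · exact .inl ⟨rfl, rfl⟩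
  · exact .inr ⟨rfl, rfl⟩

section Pass

variable (T : ℕ → CellTree) (up : Cell → Cell) (entry : ℕ → Cell → Cell) (N : ℕ)

/-- `IsPass T up entry N h i a b l`: the list `l` of cells of level `i + h` is an admissible passage
through a cell of level `i` from its half-edge `a` to its half-edge `b`. It is made of admissible
passages through cells of level `i + 1` and stays in the cell; a passage that comes from the parent
and returns to it is at least as long as a passage through the whole cell; a passage much shorter
than that does not get far: the subcells where it begins and ends are close to each other. The
constant `18` is twice the largest number of children of a cell. -/
def IsPass : ℕ → ℕ → HalfEdge → HalfEdge → List Cell → Prop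
  | 0, _, a, b, l => a.1 = b.1 ∧ l = [a.1]
  | h + 1, i, a, b, l => a.1 = b.1 ∧
      (∃ S, Walk (T (i + 1)).Link (refineHE (T (i + 1)) (entry i) a) S
          (refineHE (T (i + 1)) (entry i) b) ∧
        (∀ s ∈ S, IsPass h (i + 1) s.src s.tgt s.load) ∧ loads S = l) ∧
      (a.2 = none → b.2 = none → N ^ (h + 1) ≤ l.length) ∧
      (2 * l.length < N ^ h → dist (refineHE (T (i + 1)) (entry i) a).1
        (refineHE (T (i + 1)) (entry i) b).1 ≤ 18) ∧
      ∀ v ∈ l, up^[h + 1] v = a.1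

variable {T up entry N}

theorem IsPass.reverse {h i : ℕ} {a b : HalfEdge} {l : List Cell}
    (hp : IsPass T up entry N h i a b l) : IsPass T up entry N h i b a l.reverse := by
  induction h generalizing i a b l with
  | zero =>
    obtain ⟨h1, rfl⟩ := hp
    exact ⟨h1.symm, by simp [h1]⟩
  | succ h ih =>
    obtain ⟨h1, ⟨S, hS, hp, hl⟩, h2, h3, h4⟩ := hp
    refine ⟨h1.symm, ⟨mirror S, hS.mirror fun _ _ => CellTree.Link.symm, ?_, ?_⟩, ?_, ?_, ?_⟩
    · intro s hs
      obtain ⟨t, ht, rfl⟩ := mem_mirror.1 hs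
      exact ih (hp t ht)
    · rw [loads_mirror, hl]
    · intro ha hb
      simpa using h2 hb ha
    · intro hlt
      rw [dist_comm]
      exact h3 (by simpa using hlt)
    · intro v hv
      rw [← h1]
      exact h4 v (by simpa using hv)

end Pass

/-! ### Balancing the two sides of a tour -/

section Balance

variable {port : Cell → Cell} {M : ℕ} {c : Cell} {n n₁ n₂ : ℝ} {X Y Z L A : List Visit}

/-- If the part of `L` before the first exit is short, then the port of that exit is near `c`. -/
def FirstNear (port : Cell → Cell) (M : ℕ) (c : Cell) (n : ℝ) (L : List Visit) : Prop :=
  ∀ S t R, L = S ++ t :: R → t.isExit = true → ExitFree S → 2 * mass S < M →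
    dist c (port t.src.1) ≤ n

/-- If the part of `L` between two consecutive exits is short, then the ports of these exits are
near each other. -/
def GapsNear (port : Cell → Cell) (M : ℕ) (n : ℝ) (L : List Visit) : Prop :=
  ∀ A s S t R, L = (A ++ s :: S) ++ t :: R → s.isExit = true → t.isExit = true → ExitFree S →
    2 * mass S < M → dist (port s.src.1) (port t.src.1) ≤ n

/-- The part of `L` before the first exit is short. -/
def ShortStart (M : ℕ) (L : List Visit) : Prop :=
  ∃ S t R, L = S ++ t :: R ∧ t.isExit = true ∧ ExitFree S ∧ 2 * mass S < M

theorem FirstNear.mono (h : FirstNear port M c n₁ L) (hn : n₁ ≤ n) : FirstNear port M c n L :=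
  fun S t R h1 h2 h3 h4 => (h S t R h1 h2 h3 h4).trans hn

theorem GapsNear.mono (h : GapsNear port M n₁ L) (hn : n₁ ≤ n) : GapsNear port M n L :=
  fun A s S t R h1 h2 h3 h4 h5 => (h A s S t R h1 h2 h3 h4 h5).trans hn

theorem not_exitFree_of_eq {S R : List Visit} {t : Visit} (h : L = S ++ t :: R)
    (ht : t.isExit = true) : ¬ ExitFree L := by
  intro hf
  have := hf t (by simp [h])
  simp [ht] at this

theorem FirstNear.of_exitFree (h : ExitFree L) : FirstNear port M c n L :=
  fun _ _ _ h1 h2 _ _ => absurd h (not_exitFree_of_eq h1 h2)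

theorem FirstNear.of_not_shortStart (h : ¬ ShortStart M L) : FirstNear port M c n L :=
  fun S t R h1 h2 h3 h4 => absurd ⟨S, t, R, h1, h2, h3, h4⟩ h

theorem GapsNear.of_exitFree (h : ExitFree L) : GapsNear port M n L :=
  fun _ _ _ _ _ h1 _ h3 _ _ => absurd h (not_exitFree_of_eq h1 h3)

theorem FirstNear.of_dist {d : Cell} (h : FirstNear port M d n₁ L) (hd : dist c d + n₁ ≤ n) :
    FirstNear port M c n L := fun S t R h1 h2 h3 h4 =>
  (dist_triangle c d _).trans ((add_le_add_right (h S t R h1 h2 h3 h4) _).trans hd)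

theorem FirstNear.append (hX : FirstNear port M c n X)
    (hZ : ExitFree X → FirstNear port M c n Z) : FirstNear port M c n (X ++ Z) := by
  intro S t R h ht hS hm
  rcases List.append_eq_append_iff.1 h with ⟨S', rfl, h2⟩ | ⟨R', h1, h2⟩
  · rw [exitFree_append] at hS
    rw [mass_append] at hm
    exact hZ hS.1 S' t R h2 ht hS.2 (by omega)
  · rcases R' with _ | ⟨r, R'⟩
    · simp only [List.append_nil] at h1
      subst h1
      exact hZ hS [] t R (by simpa using h2.symm) ht (by simp) (by simp; omega)
    · simp only [List.cons_append, List.cons.injEq] at h2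
      obtain ⟨rfl, -⟩ := h2
      exact hX S t R' h1 ht hS hm

theorem GapsNear.append (hX : GapsNear port M n X) (hZ : GapsNear port M n Z)
    (hl : FirstNear port M c n₁ X.reverse) (hf : FirstNear port M c n₂ Z) (hn : n₁ + n₂ ≤ n) :
    GapsNear port M n (X ++ Z) := by
  intro A s S t R h hs ht hS hm
  -- the case in which the two exits lie on both sides of the junction
  have key : ∀ S₁ S₂, X = A ++ s :: S₁ → Z = S₂ ++ t :: R → S = S₁ ++ S₂ →
      dist (port s.src.1) (port t.src.1) ≤ n := by
    rintro S₁ S₂ h1 h2 rfl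
    rw [exitFree_append] at hS
    rw [mass_append] at hm
    have k1 := hl S₁.reverse s A.reverse (by simp [h1]) hs (by simpa using hS.1)
      (by rw [mass_reverse]; omega)
    have k2 := hf S₂ t R h2 ht hS.2 (by omega)
    rw [dist_comm] at k1
    exact (dist_triangle _ c _).trans ((add_le_add k1 k2).trans hn)
  rcases List.append_eq_append_iff.1 h with ⟨S', h1, h2⟩ | ⟨R', h1, h2⟩
  · rcases List.append_eq_append_iff.1 h1.symm with ⟨S'', h3, h4⟩ | ⟨A', h3, h4⟩
    · exact hZ S'' s S t R (by rw [h2, h4]) hs ht hS hm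
    · rcases A' with _ | ⟨r, A'⟩
      · simp only [List.nil_append] at h4
        exact hZ [] s S t R (by rw [h2, ← h4]; rfl) hs ht hS hm
      · simp only [List.cons_append, List.cons.injEq] at h4
        obtain ⟨rfl, h4⟩ := h4
        exact key A' S' h3 h2 h4
  · rcases R' with _ | ⟨r, R'⟩
    · exact key S [] (by simpa using h1) (by simpa using h2.symm) (by simp)
    · simp only [List.cons_append, List.cons.injEq] at h2
      obtain ⟨rfl, -⟩ := h2
      exact hX A s S t R' h1 hs ht hS hm

theorem ShortStart.of_append_left (h : ShortStart M (A ++ L)) (hA : ExitFree A) :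
    ShortStart M L ∧ 2 * mass A < M := by
  obtain ⟨S, t, R, h, ht, hS, hm⟩ := h
  rcases List.append_eq_append_iff.1 h with ⟨S', rfl, h2⟩ | ⟨R', h1, h2⟩
  · rw [exitFree_append] at hS
    rw [mass_append] at hm
    exact ⟨⟨S', t, R, h2, ht, hS.2, by omega⟩, by omega⟩
  · rcases R' with _ | ⟨r, R'⟩
    · simp only [List.append_nil] at h1
      subst h1
      exact ⟨⟨[], t, R, by simpa using h2.symm, ht, by simp, by simp; omega⟩, hm⟩
    · simp only [List.cons_append, List.cons.injEq] at h2
      obtain ⟨rfl, -⟩ := h2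
      exact absurd hA (not_exitFree_of_eq h1 ht)

theorem ShortStart.of_append_right (h : ShortStart M (L ++ A)) (hA : ExitFree A) :
    ShortStart M L := by
  obtain ⟨S, t, R, h, ht, hS, hm⟩ := h
  rcases List.append_eq_append_iff.1 h with ⟨S', rfl, h2⟩ | ⟨R', h1, h2⟩
  · exact absurd hA (not_exitFree_of_eq h2 ht)
  · rcases R' with _ | ⟨r, R'⟩
    · simp only [List.nil_append] at h2
      exact absurd hA (not_exitFree_of_eq (S := []) h2.symm ht)
    · simp only [List.cons_append, List.cons.injEq] at h2
      obtain ⟨rfl, -⟩ := h2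
      exact ⟨S, t, R', h1, ht, hS, hm⟩

/-- The number of exits. -/
def exitCount (L : List Visit) : ℝ := (exitCells L).length

theorem exitCount_append (L M : List Visit) :
    exitCount (L ++ M) = exitCount L + exitCount M := by simp [exitCount]

theorem exitCount_nonneg (L : List Visit) : 0 ≤ exitCount L := Nat.cast_nonneg _

theorem exitCount_of_exitFree (h : ExitFree L) : exitCount L = 0 := by
  simp [exitCount, exitFree_iff.1 h]

theorem one_le_exitCount (h : ¬ ExitFree L) : 1 ≤ exitCount L := by
  rw [exitFree_iff, ← List.length_eq_zero_iff] at h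
  have : 1 ≤ (exitCells L).length := by omega
  unfold exitCount
  exact_mod_cast this

/-- A rough bound on the distance travelled during short parts of `L`, seen from the subcell `c`
that `L` starts from. -/
structure RoughlyNear (port : Cell → Cell) (M : ℕ) (c : Cell) (L : List Visit) : Prop where
  first : FirstNear port M c (2 * exitCount L) L
  last : FirstNear port M c (2 * exitCount L) L.reverse
  gaps : GapsNear port M (2 * exitCount L) L

/-- The invariant of the construction of balanced tours: the distance travelled during short parts
of `L` is bounded in terms of the number of exits. Passing from a branch to its parent costs one
unit of distance. This unit is compensated either by another exit, or by the fact that the tour has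
stopped being short on one of its two sides, which is why the bound is better while both sides are
short. -/
structure Balanced (port : Cell → Cell) (M : ℕ) (c : Cell) (L : List Visit) : Prop where
  first : FirstNear port M c (2 * exitCount L - 1) L
  last : FirstNear port M c (2 * exitCount L - 1) L.reverse
  gaps : GapsNear port M (2 * exitCount L) L
  both : ShortStart M L → ShortStart M L.reverse →
    FirstNear port M c (2 * exitCount L - 2) L ∧ FirstNear port M c (2 * exitCount L - 2) L.reverse

theorem RoughlyNear.of_exitFree (h : ExitFree L) : RoughlyNear port M c L :=
  ⟨.of_exitFree h, .of_exitFree (by simpa using h), .of_exitFree h⟩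

theorem Balanced.of_exitFree (h : ExitFree L) : Balanced port M c L :=
  ⟨.of_exitFree h, .of_exitFree (by simpa using h), .of_exitFree h,
    fun _ _ => ⟨.of_exitFree h, .of_exitFree (by simpa using h)⟩⟩

theorem Balanced.roughlyNear {d : Cell} (h : Balanced port M d L) (hd : dist c d ≤ 1) :
    RoughlyNear port M c L :=
  ⟨h.first.of_dist (by linarith), h.last.of_dist (by linarith), h.gaps⟩

theorem RoughlyNear.append (hX : RoughlyNear port M c X) (hZ : RoughlyNear port M c Z) :
    RoughlyNear port M c (X ++ Z) := by
  have h1 := exitCount_nonneg X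
  have h2 := exitCount_nonneg Z
  refine ⟨?_, ?_, ?_⟩
  all_goals rw [exitCount_append]
  · exact (hX.first.mono (by linarith)).append fun _ => hZ.first.mono (by linarith)
  · rw [List.reverse_append]
    exact (hZ.last.mono (by linarith)).append fun _ => hX.last.mono (by linarith)
  · exact (hX.gaps.mono (by linarith)).append (hZ.gaps.mono (by linarith)) hX.last hZ.first
      (by linarith)

theorem RoughlyNear.balanced_append (hX : RoughlyNear port M c X) (hZ : RoughlyNear port M c Z)
    (heX : ¬ ExitFree X) (heZ : ¬ ExitFree Z) : Balanced port M c (X ++ Z) := by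
  have h1 := one_le_exitCount heX
  have h2 := one_le_exitCount heZ
  have hf : FirstNear port M c (2 * exitCount (X ++ Z) - 2) (X ++ Z) := by
    rw [exitCount_append]
    exact (hX.first.mono (by linarith)).append fun h => absurd h heX
  have hl : FirstNear port M c (2 * exitCount (X ++ Z) - 2) (X ++ Z).reverse := by
    rw [exitCount_append, List.reverse_append]
    exact (hZ.last.mono (by linarith)).append fun h => absurd h (by simpa using heZ)
  exact ⟨hf.mono (by linarith), hl.mono (by linarith), (hX.append hZ).gaps, fun _ _ => ⟨hf, hl⟩⟩

/-- If a single branch carries all the exits, the tour stays balanced when the heavier of its two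
sides is put where the branch is short. -/
theorem Balanced.surround {d : Cell} (hY : Balanced port M d Y) (hd : dist c d ≤ 1)
    (hA : ExitFree A) (hZ : ExitFree Z) (h1 : ShortStart M Y → M ≤ 2 * mass A)
    (h2 : ¬ ShortStart M Y → M ≤ 2 * mass Z) : Balanced port M c (A ++ Y ++ Z) := by
  have hr : (A ++ Y ++ Z).reverse = Z.reverse ++ (Y.reverse ++ A.reverse) := by simp
  have hns : ¬ ShortStart M (A ++ Y ++ Z) := by
    intro h
    rw [List.append_assoc] at h
    obtain ⟨h3, h4⟩ := h.of_append_left hA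
    have := h1 (h3.of_append_right hZ)
    omega
  have he : exitCount (A ++ Y ++ Z) = exitCount Y := by
    rw [exitCount_append, exitCount_append, exitCount_of_exitFree hA, exitCount_of_exitFree hZ]
    ring
  have hlast : FirstNear port M c (2 * exitCount Y - 1) (A ++ Y ++ Z).reverse := by
    by_cases hs : ShortStart M Y
    · by_cases hs' : ShortStart M Y.reverse
      · rw [hr]
        refine (FirstNear.of_exitFree (by simpa using hZ)).append fun _ => FirstNear.append ?_
          fun _ => .of_exitFree (by simpa using hA)
        exact (hY.both hs hs').2.of_dist (by linarith)
      · refine .of_not_shortStart fun h => hs' ?_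
        rw [hr] at h
        exact (h.of_append_left (by simpa using hZ)).1.of_append_right (by simpa using hA)
    · refine .of_not_shortStart fun h => ?_
      rw [hr] at h
      have h3 := (h.of_append_left (by simpa using hZ)).2
      have h4 := h2 hs
      rw [mass_reverse] at h3
      omega
  refine ⟨.of_not_shortStart hns, by rwa [he], ?_, fun h => absurd h hns⟩
  rw [he]
  refine GapsNear.append (c := c) (n₁ := 2 * exitCount Y) (n₂ := 0) ?_ (.of_exitFree hZ) ?_
    (.of_exitFree hZ) (by linarith)
  · exact GapsNear.append (c := c) (n₁ := 0) (n₂ := 2 * exitCount Y) (.of_exitFree hA) hY.gaps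
      (.of_exitFree (by simpa using hA)) (hY.first.of_dist (by linarith)) (by linarith)
  · rw [List.reverse_append]
    exact (hY.last.of_dist (by linarith)).append fun _ => .of_exitFree (by simpa using hA)

/-! ### Inserting branches -/

section Subst

variable (inner : Cell → Prop) [DecidablePred inner] (e : Cell → List Visit)

/-- The tour `e v` of the branch at `v` if `s` stands for such a branch and `v` satisfies `inner`;
otherwise `s` itself. -/
def piece (s : Visit) : List Visit :=
  if s.isExit = true ∧ inner s.src.1 then e s.src.1 else [s]

/-- Inserts the tours `e v` of the branches whose top vertex `v` satisfies `inner`. -/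
def insertBranches (u : List Visit) : List Visit := u.flatMap (piece inner e)

@[simp] theorem insertBranches_nil : insertBranches inner e [] = [] := rfl
@[simp] theorem insertBranches_cons (s : Visit) (u : List Visit) :
    insertBranches inner e (s :: u) = piece inner e s ++ insertBranches inner e u := by
  simp [insertBranches]
@[simp] theorem insertBranches_append (u v : List Visit) :
    insertBranches inner e (u ++ v) = insertBranches inner e u ++ insertBranches inner e v := by
  simp [insertBranches]

/-- A placeholder of a branch stands at the top vertex of that branch, arrives from its parent and
returns to it, and has no load. -/
def WellFormed (u : List Visit) : Prop :=
  ∀ s ∈ u, s.isExit = true → s.src = s.tgt ∧ s.src.2 = none ∧ s.load = []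

variable {inner e} {u : List Visit}

theorem WellFormed.mirror (h : WellFormed u) : WellFormed (mirror u) := by
  intro s hs hx
  obtain ⟨t, ht, rfl⟩ := mem_mirror.1 hs
  obtain ⟨h1, h2, h3⟩ := h t ht hx
  exact ⟨h1.symm, by simpa [Visit.flip, h1] using h2, by simp [Visit.flip, h3]⟩

theorem WellFormed.of_cons {s : Visit} (h : WellFormed (s :: u)) : WellFormed u :=
  fun t ht => h t (by simp [ht])

theorem loads_insertBranches (hu : WellFormed u) :
    (loads (insertBranches inner e u) : Multiset Cell) = loads u +
      (((exitCells u : Multiset Cell).filter inner).map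
        fun v => (loads (e v) : Multiset Cell)).sum := by
  induction u with
  | nil => simp
  | cons s u ih =>
    have hs := hu s (by simp)
    rw [insertBranches_cons, loads_append, ← Multiset.coe_add, ih hu.of_cons, loads_cons,
      ← Multiset.coe_add]
    rcases hx : s.isExit with _ | _
    · simp [piece, exitCells, hx]
      rw [← Multiset.coe_add, add_assoc]
    · obtain ⟨-, -, h0⟩ := hs hx
      by_cases hi : inner s.src.1
      · simp [piece, exitCells, hx, hi, h0]
        abel
      · simp [piece, exitCells, hx, hi, h0]

theorem exitCells_insertBranches (u : List Visit) :
    (exitCells (insertBranches inner e u) : Multiset Cell) =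
      (exitCells u : Multiset Cell).filter (fun v => ¬ inner v) +
      (((exitCells u : Multiset Cell).filter inner).map
        fun v => (exitCells (e v) : Multiset Cell)).sum := by
  induction u with
  | nil => simp
  | cons s u ih =>
    rw [insertBranches_cons, exitCells_append, ← Multiset.coe_add, ih]
    rcases hx : s.isExit with _ | _
    · simp [piece, exitCells, hx]
    · by_cases hi : inner s.src.1
      · simp [piece, exitCells, hx, hi]
        rw [← add_assoc, ← add_assoc]
        congr 1
        exact add_comm _ _
      · simp [piece, exitCells, hx, hi]
        rw [← Multiset.cons_coe, Multiset.cons_add]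

theorem exitCells_mirror (hu : WellFormed u) : (exitCells (mirror u)).Perm (exitCells u) := by
  induction u with
  | nil => rfl
  | cons s u ih =>
    rw [mirror_cons, exitCells_append]
    have e1 : exitCells [s.flip] = exitCells [s] := by
      rcases hx : s.isExit with _ | _
      · simp [exitCells, Visit.flip, hx]
      · obtain ⟨h1, -, -⟩ := hu s (by simp) hx
        simp [exitCells, Visit.flip, hx, h1]
    have e2 : exitCells (s :: u) = exitCells [s] ++ exitCells u := by
      rw [← exitCells_append]; rfl
    rw [e1, e2]
    exact List.perm_append_comm.trans (List.Perm.append_left _ (ih hu.of_cons))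

theorem insertBranches_mirror_exitFree (hu : WellFormed u)
    (h : ExitFree (insertBranches inner e u)) : ExitFree (insertBranches inner e (mirror u)) := by
  rw [exitFree_iff, ← Multiset.coe_eq_zero, exitCells_insertBranches] at h ⊢
  rwa [Multiset.coe_eq_coe.2 (exitCells_mirror hu)]

theorem mass_insertBranches_mirror (hu : WellFormed u) :
    mass (insertBranches inner e (mirror u)) = mass (insertBranches inner e u) := by
  have := congrArg Multiset.card (loads_insertBranches (inner := inner) (e := e) hu.mirror)
  rw [loads_mirror, Multiset.coe_reverse, Multiset.coe_eq_coe.2 (exitCells_mirror hu),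
    ← loads_insertBranches hu] at this
  simpa [mass] using this

theorem mass_le_insertBranches (hu : WellFormed u) :
    mass u ≤ mass (insertBranches inner e u) := by
  have := congrArg Multiset.card (loads_insertBranches (inner := inner) (e := e) hu)
  rw [Multiset.card_add] at this
  simp only [Multiset.coe_card] at this
  unfold mass
  omega

/-- What is needed of the branches at a vertex with tour `u` seen from the subcell `c`. -/
def BranchesGood (port : Cell → Cell) (M : ℕ) (c : Cell) (inner : Cell → Prop)
    (e : Cell → List Visit) (u : List Visit) : Prop :=
  ∀ s ∈ u, s.isExit = true →
    (inner s.src.1 → Balanced port M s.src.1 (e s.src.1) ∧ dist c s.src.1 ≤ 1) ∧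
    (¬ inner s.src.1 → port s.src.1 = c)

theorem roughlyNear_piece {s : Visit}
    (h : s.isExit = true → (inner s.src.1 → Balanced port M s.src.1 (e s.src.1) ∧
      dist c s.src.1 ≤ 1) ∧ (¬ inner s.src.1 → port s.src.1 = c)) :
    RoughlyNear port M c (piece inner e s) := by
  by_cases hx : s.isExit = true
  · by_cases hi : inner s.src.1
    · rw [piece, if_pos ⟨hx, hi⟩]
      exact ((h hx).1 hi).1.roughlyNear ((h hx).1 hi).2
    · rw [piece, if_neg (by tauto)]
      have hp := (h hx).2 hi
      have hf : FirstNear port M c (2 * exitCount [s]) [s] := by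
        intro S t R h1 _ _ _
        have ht : t ∈ [s] := by rw [h1]; simp
        rw [List.mem_singleton] at ht
        subst ht
        rw [hp, dist_self]
        exact mul_nonneg zero_le_two (exitCount_nonneg _)
      refine ⟨hf, by simpa using hf, ?_⟩
      intro A r S t R h1
      have := congrArg List.length h1
      simp at this
      omega
  · rw [piece, if_neg (by tauto)]
    exact .of_exitFree (by simpa using hx)

theorem roughlyNear_insertBranches (h : BranchesGood port M c inner e u) :
    RoughlyNear port M c (insertBranches inner e u) := by
  induction u with
  | nil => exact .of_exitFree (by simp)
  | cons s u ih =>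
    rw [insertBranches_cons]
    exact (roughlyNear_piece (h s (by simp))).append (ih fun t ht => h t (by simp [ht]))

theorem exists_first_not_exitFree (h : ¬ ExitFree (insertBranches inner e u)) :
    ∃ u₁ s u₂, u = u₁ ++ s :: u₂ ∧ ExitFree (insertBranches inner e u₁) ∧
      ¬ ExitFree (piece inner e s) := by
  induction u with
  | nil => simp at h
  | cons s u ih =>
    by_cases hs : ExitFree (piece inner e s)
    · rw [insertBranches_cons, exitFree_append] at h
      obtain ⟨u₁, t, u₂, rfl, h1, h2⟩ := ih (by tauto)
      exact ⟨s :: u₁, t, u₂, rfl, by simp [hs, h1], h2⟩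
    · exact ⟨[], s, u, rfl, by simp, hs⟩

/-- Inserting balanced branches into a tour or into its mirror image gives a balanced tour. If the
exits are not all in one piece, the first and the last piece with exits each contribute at least one
exit, which leaves room in both bounds. Otherwise, the mirror image is used if the heavier side of
the tour is on the wrong side of that piece. -/
theorem exists_balanced (hu : WellFormed u) (h : BranchesGood port M c inner e u)
    (hM : M ≤ mass u) :
    Balanced port M c (insertBranches inner e u) ∨
      Balanced port M c (insertBranches inner e (mirror u)) := by
  by_cases hL : ExitFree (insertBranches inner e u)
  · exact .inl (.of_exitFree hL)
  obtain ⟨u₁, s, u₂, rfl, h1, h2⟩ := exists_first_not_exitFree hL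
  by_cases h3 : ExitFree (insertBranches inner e u₂)
  swap
  -- there are exits before and after the cut behind `s`
  · left
    have e1 : u₁ ++ s :: u₂ = (u₁ ++ [s]) ++ u₂ := by simp
    rw [e1, insertBranches_append]
    refine RoughlyNear.balanced_append (roughlyNear_insertBranches fun t ht => h t ?_)
      (roughlyNear_insertBranches fun t ht => h t ?_) ?_ h3
    · rw [e1]; exact List.mem_append_left _ ht
    · rw [e1]; exact List.mem_append_right _ ht
    · simp [h2]
  have hw1 : WellFormed u₁ := fun t ht => hu t (by simp [ht])
  have hw2 : WellFormed u₂ := fun t ht => hu t (by simp [ht])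
  have hx : s.isExit = true := by
    by_contra hx
    exact h2 (by rw [piece, if_neg (by tauto)]; simpa using hx)
  obtain ⟨hst, -, hload⟩ := hu s (by simp) hx
  by_cases hi : inner s.src.1
  · have hp : piece inner e s = e s.src.1 := if_pos ⟨hx, hi⟩
    have hp' : piece inner e s.flip = e s.src.1 := by
      simp [piece, Visit.flip, hx, ← hst, hi]
    obtain ⟨hb, hd⟩ := (h s (by simp) hx).1 hi
    have hm : M ≤ mass (insertBranches inner e u₁) + mass (insertBranches inner e u₂) := by
      have k1 := mass_le_insertBranches (inner := inner) (e := e) hw1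
      have k2 := mass_le_insertBranches (inner := inner) (e := e) hw2
      simp [hload] at hM
      omega
    have hY : insertBranches inner e (u₁ ++ s :: u₂) =
        insertBranches inner e u₁ ++ e s.src.1 ++ insertBranches inner e u₂ := by
      simp [hp]
    have hY' : insertBranches inner e (mirror (u₁ ++ s :: u₂)) =
        insertBranches inner e (mirror u₂) ++ e s.src.1 ++
          insertBranches inner e (mirror u₁) := by
      simp [hp', mirror_cons]
    have g1 := insertBranches_mirror_exitFree hw1 h1
    have g2 := insertBranches_mirror_exitFree hw2 h3
    have m1 := mass_insertBranches_mirror (inner := inner) (e := e) hw1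
    have m2 := mass_insertBranches_mirror (inner := inner) (e := e) hw2
    rw [hY, hY']
    by_cases hs : ShortStart M (e s.src.1)
    · by_cases hA : M ≤ 2 * mass (insertBranches inner e u₁)
      · exact .inl (hb.surround hd h1 h3 (fun _ => hA) fun h => absurd hs h)
      · exact .inr (hb.surround hd g2 g1 (fun _ => by omega) fun h => absurd hs h)
    · by_cases hA : M ≤ 2 * mass (insertBranches inner e u₁)
      · exact .inr (hb.surround hd g2 g1 (fun h => absurd h hs) fun _ => by omega)
      · exact .inl (hb.surround hd h1 h3 (fun h => absurd h hs) fun _ => by omega)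
  -- the only exit is at a child of `c` itself
  · left
    have hp : piece inner e s = [s] := if_neg (by tauto)
    have hport := (h s (by simp) hx).2 hi
    have hr := roughlyNear_insertBranches h
    have hY : insertBranches inner e (u₁ ++ s :: u₂) =
        insertBranches inner e u₁ ++ [s] ++ insertBranches inner e u₂ := by
      simp [hp]
    have he : exitCount (insertBranches inner e (u₁ ++ s :: u₂)) = 1 := by
      rw [hY, exitCount_append, exitCount_append, exitCount_of_exitFree h1,
        exitCount_of_exitFree h3]
      simp [exitCount, exitCells, hx]
    have hs : FirstNear port M c 0 [s] := by
      intro S t R h1 _ _ _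
      have ht : t ∈ [s] := by rw [h1]; simp
      rw [List.mem_singleton] at ht
      subst ht
      rw [hport, dist_self]
    have hf : FirstNear port M c 0 (insertBranches inner e (u₁ ++ s :: u₂)) := by
      rw [hY, List.append_assoc]
      exact (FirstNear.of_exitFree h1).append fun _ => hs.append fun _ => .of_exitFree h3
    have hl : FirstNear port M c 0 (insertBranches inner e (u₁ ++ s :: u₂)).reverse := by
      rw [hY, List.reverse_append, List.reverse_append]
      exact (FirstNear.of_exitFree (by simpa using h3)).append fun _ =>
        FirstNear.append (by simpa using hs) fun _ => .of_exitFree (by simpa using h1)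
    exact ⟨hf.mono (by rw [he]; norm_num), hl.mono (by rw [he]; norm_num), hr.gaps, fun _ _ =>
      ⟨hf.mono (by rw [he]; norm_num), hl.mono (by rw [he]; norm_num)⟩⟩

end Subst

end Balance

/-! ### Tours of all the cells of a level -/

/-- In a finite rooted tree, a quantity that obeys `f = g + (sum of f over the children)` has at the
root the sum of all the values of `g`. -/
theorem tree_sum {A : Type*} [AddCancelCommMonoid A] {S : Finset Cell} {r : Cell} (hr : r ∈ S)
    {par : Cell → Cell} (hpar : ∀ c ∈ S, c ≠ r → par c ∈ S) {f g : Cell → A}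
    (hf : ∀ c ∈ S, f c = g c + ∑ y ∈ S.filter (fun y => y ≠ r ∧ par y = c), f y) :
    f r = ∑ c ∈ S, g c := by
  have h1 : ∑ c ∈ S, f c = ∑ c ∈ S, g c + ∑ y ∈ S.erase r, f y := by
    rw [Finset.sum_congr rfl hf, Finset.sum_add_distrib]
    congr 1
    rw [← Finset.sum_fiberwise_of_maps_to (g := par) (t := S)
      (fun y hy => hpar y (Finset.mem_of_mem_erase hy) (Finset.ne_of_mem_erase hy))]
    refine Finset.sum_congr rfl fun c _ => Finset.sum_congr ?_ fun _ _ => rfl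
    ext y
    simp only [Finset.mem_filter, Finset.mem_erase]
    tauto
  rw [← Finset.add_sum_erase _ _ hr] at h1
  exact add_right_cancel h1

section Tours

variable (T : ℕ → CellTree) (up : Cell → Cell) (entry : ℕ → Cell → Cell) (N : ℕ)

/-- The cells of level `i + h` inside the cell `w` of level `i`, each counted once for each time
that a tour around the tree of level `i + h` visits it. -/
def content : ℕ → ℕ → Cell → Multiset Cell
  | 0, i, w => Multiset.replicate (((T i).children w).card + 1) w
  | h + 1, i, w => ∑ c ∈ (T (i + 1)).verts.filter (fun c => up c = w), content h (i + 1) c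

/-- `u` is a tour around the cell `w` of level `i`, which starts from the parent, returns to it, and
visits all children on its way; its visits to `w` are admissible passages. -/
structure IsTour (h i : ℕ) (w : Cell) (u : List Visit) : Prop where
  walk : Walk (T i).Link (w, none) u (w, none)
  pass : ∀ s ∈ u, s.isExit = false → IsPass T up entry N h i s.src s.tgt s.load
  exits : (exitCells u : Multiset Cell) = ((T i).children w).val
  wf : WellFormed u
  content : (loads u : Multiset Cell) = content T up h i w

variable {T up entry N}

theorem exists_tour_zero {i : ℕ} {w : Cell} : ∃ u, IsTour T up entry N 0 i w u := by
  have key : ∀ (ys : List Cell) (x : Option Cell), (∀ y ∈ ys, y ∈ (T i).children w) →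
      ∃ u, Walk (T i).Link (w, x) u (w, none) ∧
        (∀ s ∈ u, s.isExit = false → IsPass T up entry N 0 i s.src s.tgt s.load) ∧
        exitCells u = ys ∧ WellFormed u ∧
        (loads u : Multiset Cell) = Multiset.replicate (ys.length + 1) w := by
    intro ys
    induction ys with
    | nil =>
      intro x _
      refine ⟨[⟨(w, x), (w, none), [w], false⟩], .single ⟨(w, x), (w, none), [w], false⟩, ?_,
        by simp [exitCells], ?_, ?_⟩
      · simp [IsPass]
      · simp [WellFormed]
      · simp
    | cons y ys ih =>
      intro x hy
      have h0 := hy y (by simp)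
      simp only [CellTree.children, Finset.mem_filter] at h0
      obtain ⟨u, h1, h2, h3, h4, h5⟩ := ih (some y) fun z hz => hy z (by simp [hz])
      refine ⟨⟨(w, x), (w, some y), [w], false⟩ :: ⟨(y, none), (y, none), [], true⟩ :: u,
        .cons ⟨(w, x), (w, some y), [w], false⟩ ?_ (.cons ⟨(y, none), (y, none), [], true⟩ ?_ h1),
        ?_, ?_, ?_, ?_⟩
      · exact ⟨y, h0.1, h0.2.1, .inr ⟨rfl, by simp [h0.2.2]⟩⟩
      · exact ⟨y, h0.1, h0.2.1, .inl ⟨rfl, by simp [h0.2.2]⟩⟩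
      · intro s hs
        simp only [List.mem_cons] at hs
        rcases hs with rfl | rfl | hs
        · simp [IsPass]
        · simp
        · exact h2 s hs
      · rw [← h3]; simp [exitCells]
      · intro s hs
        simp only [List.mem_cons] at hs
        rcases hs with rfl | rfl | hs
        · simp
        · simp
        · exact h4 s hs
      · simp only [loads_cons, List.nil_append, List.length_cons]
        rw [← Multiset.coe_add, h5, Multiset.replicate_succ w (ys.length + 1)]
        simp
  obtain ⟨u, h1, h2, h3, h4, h5⟩ := key ((T i).children w).toList none (by simp)
  refine ⟨u, h1, h2, by rw [h3]; simp, h4, ?_⟩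
  rw [h5, content]
  simp

theorem Walk.insertBranches {R : HalfEdge → HalfEdge → Prop} {inner : Cell → Prop}
    [DecidablePred inner] {e : Cell → List Visit} {a b : HalfEdge} {u : List Visit}
    (h : Walk R a u b) (hu : WellFormed u)
    (he : ∀ s ∈ u, s.isExit = true → inner s.src.1 →
      Walk R (s.src.1, none) (e s.src.1) (s.src.1, none)) :
    Walk R a (insertBranches inner e u) b := by
  have piece_walk : ∀ s : Visit, (s.isExit = true → s.src = s.tgt ∧ s.src.2 = none ∧ s.load = []) →
      (s.isExit = true → inner s.src.1 → Walk R (s.src.1, none) (e s.src.1) (s.src.1, none)) →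
      Walk R s.src (piece inner e s) s.tgt := by
    intro s h1 h2
    by_cases hx : s.isExit = true ∧ inner s.src.1
    · rw [piece, if_pos hx]
      obtain ⟨h3, h4, -⟩ := h1 hx.1
      have h5 : s.src = (s.src.1, none) := by rw [← h4]
      rw [← h3, h5]
      exact h2 hx.1 hx.2
    · rw [piece, if_neg hx]
      exact .single s
  induction h with
  | single s =>
    simpa using piece_walk s (hu s (by simp)) (he s (by simp))
  | cons s hr _ ih =>
    rw [insertBranches_cons]
    exact (piece_walk s (hu s (by simp)) (he s (by simp))).append hr
      (ih hu.of_cons fun t ht => he t (by simp [ht]))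

theorem mem_insertBranches {inner : Cell → Prop} [DecidablePred inner] {e : Cell → List Visit}
    {u : List Visit} {s : Visit} (h : s ∈ insertBranches inner e u) :
    (s ∈ u ∧ ¬ (s.isExit = true ∧ inner s.src.1)) ∨
      ∃ t ∈ u, t.isExit = true ∧ inner t.src.1 ∧ s ∈ e t.src.1 := by
  rw [HolderCarpet.insertBranches, List.mem_flatMap] at h
  obtain ⟨t, ht, hs⟩ := h
  by_cases hx : t.isExit = true ∧ inner t.src.1
  · rw [piece, if_pos hx] at hs
    exact .inr ⟨t, ht, hx.1, hx.2, hs⟩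
  · rw [piece, if_neg hx, List.mem_singleton] at hs
    subst hs
    exact .inl ⟨ht, hx⟩

theorem insertBranches_congr {inner : Cell → Prop} [DecidablePred inner]
    {e e' : Cell → List Visit} {u : List Visit}
    (h : ∀ s ∈ u, s.isExit = true → inner s.src.1 → e s.src.1 = e' s.src.1) :
    insertBranches inner e u = insertBranches inner e' u := by
  induction u with
  | nil => rfl
  | cons s u ih =>
    rw [insertBranches_cons, insertBranches_cons, ih fun t ht => h t (by simp [ht])]
    congr 1
    by_cases hx : s.isExit = true ∧ inner s.src.1
    · rw [piece, piece, if_pos hx, if_pos hx, h s (by simp) hx.1 hx.2]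
    · rw [piece, piece, if_neg hx, if_neg hx]

theorem IsTour.mirror {h i : ℕ} {w : Cell} {u : List Visit} (hu : IsTour T up entry N h i w u) :
    IsTour T up entry N h i w (mirror u) where
  walk := hu.walk.mirror fun _ _ => CellTree.Link.symm
  pass := by
    intro s hs hx
    obtain ⟨t, ht, rfl⟩ := mem_mirror.1 hs
    exact (hu.pass t ht hx).reverse
  exits := by rw [Multiset.coe_eq_coe.2 (exitCells_mirror hu.wf), hu.exits]
  wf := hu.wf.mirror
  content := by rw [loads_mirror, Multiset.coe_reverse, hu.content]

theorem IsTour.mem_children {h i : ℕ} {w : Cell} {u : List Visit}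
    (hu : IsTour T up entry N h i w u) {s : Visit} (hs : s ∈ u) (hx : s.isExit = true) :
    s.src.1 ∈ (T i).children w := by
  have : s.src.1 ∈ (exitCells u : Multiset Cell) := by
    rw [Multiset.mem_coe, exitCells, List.mem_map]
    exact ⟨s, List.mem_filter.2 ⟨hs, hx⟩, rfl⟩
  rwa [hu.exits] at this

/-- `L` is a tour of the branch at `c` of the part of the tree of level `i + 1` inside the cell `w`
of level `i`; its exits lead out of `w`. -/
structure IsBranchTour (T : ℕ → CellTree) (up : Cell → Cell) (entry : ℕ → Cell → Cell) (N : ℕ)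
    (h i : ℕ) (w c : Cell) (L : List Visit) : Prop where
  walk : Walk (T (i + 1)).Link (c, none) L (c, none)
  pass : ∀ s ∈ L, s.isExit = false → IsPass T up entry N h (i + 1) s.src s.tgt s.load
  wf : WellFormed L
  out : ∀ s ∈ L, s.isExit = true → s.src.1 ∈ (T (i + 1)).verts ∧ s.src.1 ≠ (T (i + 1)).root ∧
    up s.src.1 ≠ w ∧ up ((T (i + 1)).par s.src.1) = w
  bal : Balanced (T (i + 1)).par (N ^ h) c L

/-- Given tours around the cells inside `w`, there are balanced tours of all branches of the tree
inside `w`. -/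
theorem exists_branchTours {h i : ℕ} {w : Cell} {u : Cell → List Visit}
    (hu : ∀ c ∈ (T (i + 1)).verts, up c = w → IsTour T up entry N h (i + 1) c (u c))
    (hN : ∀ c ∈ (T (i + 1)).verts, up c = w → N ^ h ≤ mass (u c)) :
    ∃ e : Cell → List Visit, ∀ c ∈ (T (i + 1)).verts, up c = w →
      (e c = insertBranches (fun v => up v = w) e (u c) ∨
        e c = insertBranches (fun v => up v = w) e (mirror (u c))) ∧
      IsBranchTour T up entry N h i w c (e c) := by
  classical
  set B := (T (i + 1)).verts.sup (T (i + 1)).rank with hB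
  -- the tours are built from the leaves of the tree towards its root
  have key : ∀ n : ℕ, ∃ e : Cell → List Visit, ∀ c ∈ (T (i + 1)).verts, up c = w →
      B < (T (i + 1)).rank c + n →
      (e c = insertBranches (fun v => up v = w) e (u c) ∨
        e c = insertBranches (fun v => up v = w) e (mirror (u c))) ∧
      IsBranchTour T up entry N h i w c (e c) := by
    intro n
    induction n with
    | zero =>
      refine ⟨fun _ => [], fun c hc _ hlt => ?_⟩
      have : (T (i + 1)).rank c ≤ B := Finset.le_sup hc
      omega
    | succ n ih =>
      obtain ⟨e, he⟩ := ih
      let e' : Cell → List Visit := fun c =>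
        if B < (T (i + 1)).rank c + n then e c
        else if Balanced (T (i + 1)).par (N ^ h) c (insertBranches (fun v => up v = w) e (u c))
          then insertBranches (fun v => up v = w) e (u c)
          else insertBranches (fun v => up v = w) e (mirror (u c))
      have rank_lt : ∀ c v, v ∈ (T (i + 1)).children c →
          v ∈ (T (i + 1)).verts ∧ (T (i + 1)).rank c < (T (i + 1)).rank v := by
        intro c v hv
        simp only [CellTree.children, Finset.mem_filter] at hv
        obtain ⟨h1, h2, rfl⟩ := hv
        exact ⟨h1, (T (i + 1)).rank_par v h1 h2⟩
      have congr' : ∀ c x, B < (T (i + 1)).rank c + (n + 1) →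
          IsTour T up entry N h (i + 1) c x →
          insertBranches (fun v => up v = w) e x = insertBranches (fun v => up v = w) e' x := by
        intro c x hc hx
        refine insertBranches_congr fun s hs hsx _ => ?_
        have := (rank_lt c _ (hx.mem_children hs hsx)).2
        simp only [e']
        rw [if_pos (by omega)]
      refine ⟨e', fun c hc hcw hlt => ?_⟩
      have hcu := hu c hc hcw
      rw [← congr' c _ hlt hcu, ← congr' c _ hlt hcu.mirror]
      by_cases hB' : B < (T (i + 1)).rank c + n
      · simp only [e', if_pos hB']
        exact he c hc hcw hB'
      -- the properties of the tours of the branches at the children of `c`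
      have child : ∀ x, IsTour T up entry N h (i + 1) c x → ∀ s ∈ x, s.isExit = true →
          up s.src.1 = w → IsBranchTour T up entry N h i w s.src.1 (e s.src.1) := by
        intro x hx s hs hsx hsw
        obtain ⟨h1, h2⟩ := rank_lt c _ (hx.mem_children hs hsx)
        exact (he _ h1 hsw (by omega)).2
      have build : ∀ x, IsTour T up entry N h (i + 1) c x →
          Balanced (T (i + 1)).par (N ^ h) c (insertBranches (fun v => up v = w) e x) →
          IsBranchTour T up entry N h i w c (insertBranches (fun v => up v = w) e x) := by
        intro x hx hbal
        refine ⟨hx.walk.insertBranches hx.wf fun s hs hsx hsw => (child x hx s hs hsx hsw).walk,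
          ?_, ?_, ?_, hbal⟩
        · intro s hs hsx
          rcases mem_insertBranches hs with ⟨h1, -⟩ | ⟨t, ht, htx, htw, hst⟩
          · exact hx.pass s h1 hsx
          · exact (child x hx t ht htx htw).pass s hst hsx
        · intro s hs hsx
          rcases mem_insertBranches hs with ⟨h1, -⟩ | ⟨t, ht, htx, htw, hst⟩
          · exact hx.wf s h1 hsx
          · exact (child x hx t ht htx htw).wf s hst hsx
        · intro s hs hsx
          rcases mem_insertBranches hs with ⟨h1, h2⟩ | ⟨t, ht, htx, htw, hst⟩
          · have h3 := hx.mem_children h1 hsx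
            simp only [CellTree.children, Finset.mem_filter] at h3
            exact ⟨h3.1, h3.2.1, fun h4 => h2 ⟨hsx, h4⟩, by rw [h3.2.2, hcw]⟩
          · exact (child x hx t ht htx htw).out s hst hsx
      have hgood : BranchesGood (T (i + 1)).par (N ^ h) c (fun v => up v = w) e (u c) := by
        intro s hs hsx
        have h3 := hcu.mem_children hs hsx
        simp only [CellTree.children, Finset.mem_filter] at h3
        refine ⟨fun hsw => ⟨(child _ hcu s hs hsx hsw).bal, ?_⟩, fun _ => h3.2.2⟩
        have := (T (i + 1)).dist_par _ h3.1 h3.2.1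
        rwa [h3.2.2, dist_comm] at this
      simp only [e', if_neg hB']
      split_ifs with hbal
      · exact ⟨.inl rfl, build _ hcu hbal⟩
      · have hbal' := (exists_balanced hcu.wf hgood (hN c hc hcw)).resolve_left hbal
        exact ⟨.inr rfl, build _ hcu.mirror hbal'⟩
  obtain ⟨e, he⟩ := key (B + 1)
  exact ⟨e, fun c hc hcw => he c hc hcw (by omega)⟩

end Tours

/-! ### Construction of tours, level by level -/

theorem exists_first_exit {L : List Visit} (h : ¬ ExitFree L) :
    ∃ S t R, L = S ++ t :: R ∧ t.isExit = true ∧ ExitFree S := by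
  induction L with
  | nil => simp at h
  | cons s L ih =>
    by_cases hs : s.isExit = true
    · exact ⟨[], s, L, rfl, hs, by simp⟩
    · have hs' : s.isExit = false := by simpa using hs
      obtain ⟨S, t, R, rfl, h1, h2⟩ := ih (by simpa [hs'] using h)
      exact ⟨s :: S, t, R, rfl, h1, by simp [hs', h2]⟩

theorem Walk.src_eq {R : HalfEdge → HalfEdge → Prop} {a b : HalfEdge} {t : Visit} {L : List Visit}
    (h : Walk R a (t :: L) b) : a = t.src := by
  cases h <;> rfl

theorem Walk.tgt_eq {R : HalfEdge → HalfEdge → Prop} {a b : HalfEdge} {t : Visit}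
    (h : Walk R a [t] b) : b = t.tgt := by
  cases h with
  | single => rfl
  | cons _ _ h => cases h

theorem exitCells_of_exitFree_append {S R : List Visit} {t : Visit} (hS : ExitFree S)
    (ht : t.isExit = true) : exitCells (S ++ t :: R) = t.src.1 :: exitCells R := by
  rw [exitCells_append, exitFree_iff.1 hS]
  simp [exitCells, ht]

section Main

variable {T : ℕ → CellTree} {up : Cell → Cell} {entry : ℕ → Cell → Cell} {N : ℕ}

/-- Cuts a tour of the tree of level `i + 1` inside `w` at its exits into passages through `w`. The
first passage starts from the half-edge `(w, x)`, which allows an induction on the number of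
exits. -/
theorem exists_passes (hR : ∀ i, Refines (T i) (T (i + 1)) up (entry i) N) {h i : ℕ} {w : Cell}
    (n : ℕ) (L : List Visit) (hn : L.length ≤ n) (x : Option Cell)
    (hL : Walk (T (i + 1)).Link (refineHE (T (i + 1)) (entry i) (w, x)) L (entry i w, none))
    (hw : w ∈ (T i).verts)
    (hpass : ∀ s ∈ L, s.isExit = false → IsPass T up entry N h (i + 1) s.src s.tgt s.load)
    (hwf : WellFormed L)
    (hout : ∀ s ∈ L, s.isExit = true → s.src.1 ∈ (T (i + 1)).verts ∧
      s.src.1 ≠ (T (i + 1)).root ∧ up s.src.1 ≠ w ∧ up ((T (i + 1)).par s.src.1) = w)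
    (hfirst : FirstNear (T (i + 1)).par (N ^ h) (refineHE (T (i + 1)) (entry i) (w, x)).1 18 L)
    (hgaps : GapsNear (T (i + 1)).par (N ^ h) 18 L)
    (hlast : FirstNear (T (i + 1)).par (N ^ h) (entry i w) 18 L.reverse)
    (hfree : ExitFree L → 2 * mass L < N ^ h →
      dist (refineHE (T (i + 1)) (entry i) (w, x)).1 (entry i w) ≤ 18)
    (hfull : ExitFree L → x = none → N ^ (h + 1) ≤ mass L)
    (hcell : ∀ v ∈ loads L, up^[h + 1] v = w) :
    ∃ u, Walk (T i).Link (w, x) u (w, none) ∧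
      (∀ s ∈ u, s.isExit = false → IsPass T up entry N (h + 1) i s.src s.tgt s.load) ∧
      WellFormed u ∧ exitCells u = (exitCells L).map up ∧ loads u = loads L := by
  induction n generalizing L x with
  | zero =>
    exact absurd (List.length_eq_zero_iff.1 (Nat.le_zero.1 hn)) hL.ne_nil
  | succ n ih =>
    by_cases hx : ExitFree L
    · refine ⟨[⟨(w, x), (w, none), loads L, false⟩], .single ⟨(w, x), (w, none), loads L, false⟩,
        ?_, ?_, ?_, ?_⟩
      · intro s hs _
        rw [List.mem_singleton] at hs
        subst hs
        exact ⟨rfl, ⟨L, hL, fun s hs => hpass s hs (hx s hs), rfl⟩, fun h1 _ => hfull hx h1,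
          fun h1 => hfree hx h1, hcell⟩
      · simp [WellFormed]
      · rw [exitFree_iff.1 hx]; simp [exitCells]
      · simp
    · obtain ⟨S, t, R, rfl, ht, hS⟩ := exists_first_exit hx
      obtain ⟨h1, h2, h3, h4⟩ := hout t (by simp) ht
      obtain ⟨h5, h6, h7⟩ := hwf t (by simp) ht
      have h6' : t.tgt.2 = none := h5 ▸ h6
      have hsrc : t.src = (t.src.1, none) := by rw [← h6]
      have htgt : t.tgt = (t.src.1, none) := by rw [← h5, ← h6]
      set v := t.src.1 with hv
      have hentry : entry i (up v) = v := by
        by_contra hne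
        have := (hR i).up_par v h1 (Ne.symm hne)
        exact h3 (this.symm.trans h4)
      -- the cell outside `w` to which the exit leads
      have hupv : up v ∈ (T i).verts := (hR i).up_mem v h1
      have hupr : up v ≠ (T i).root := by
        intro hr
        rw [hr, (hR i).entry_root] at hentry
        exact h2 hentry.symm
      have hparv : (T i).par (up v) = w := by
        rw [← (hR i).up_par_entry _ hupv hupr, hentry, h4]
      have hrefine : refineHE (T (i + 1)) (entry i) (w, some (up v)) =
          ((T (i + 1)).par v, some v) := by
        simp [refineHE, hentry]
      have hSne : S ≠ [] := by
        rintro rfl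
        have h8 := hL.src_eq
        rw [hsrc] at h8
        rcases x with _ | x
        · simp only [refineHE, Prod.mk.injEq, and_true] at h8
          exact h3 (by rw [← h8, (hR i).up_entry w hw])
        · simp [refineHE] at h8
      obtain ⟨c, d, hw1, hlink1, hw2⟩ := hL.split hSne (by simp)
      have hd := hw2.src_eq
      have hRne : R ≠ [] := by
        rintro rfl
        have h8 := hw2.tgt_eq
        rw [htgt] at h8
        simp only [Prod.mk.injEq, and_true] at h8
        exact h3 (by rw [← h8, (hR i).up_entry w hw])
      obtain ⟨c', d', hw3, hlink2, hw4⟩ := Walk.split (L := [t]) hw2 (by simp) hRne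
      have hc' := hw3.tgt_eq
      have hc : c = ((T (i + 1)).par v, some v) := by
        rw [hd, hsrc] at hlink1
        obtain ⟨y, -, -, ⟨rfl, h8⟩ | ⟨h8, rfl⟩⟩ := hlink1
        · simp at h8
        · simp only [Prod.mk.injEq, and_true] at h8
          rw [h8]
      have hd' : d' = ((T (i + 1)).par v, some v) := by
        rw [hc', htgt] at hlink2
        obtain ⟨y, -, -, ⟨h8, rfl⟩ | ⟨rfl, h8⟩⟩ := hlink2
        · simp only [Prod.mk.injEq, and_true] at h8
          rw [h8]
        · simp at h8
      rw [hc] at hw1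
      rw [hd'] at hw4
      have hport : (refineHE (T (i + 1)) (entry i) (w, some (up v))).1 = (T (i + 1)).par v := by
        rw [hrefine]
      obtain ⟨u, k1, k2, k3, k4, k5⟩ := ih R (by simp at hn; omega) (some (up v))
        (by rw [hrefine]; exact hw4) (fun s hs => hpass s (by simp [hs]))
        (fun s hs => hwf s (by simp [hs])) (fun s hs => hout s (by simp [hs]))
        (by
          rw [hport]
          intro S' t' R' e1 e2 e3 e4
          exact hgaps S t S' t' R' (by rw [e1]; simp) ht e2 e3 e4)
        (by
          intro A s S' t' R' e1 e2 e3 e4 e5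
          exact hgaps (S ++ t :: A) s S' t' R' (by rw [e1]; simp) e2 e3 e4 e5)
        (by
          intro S' t' R' e1 e2 e3 e4
          exact hlast S' t' (R' ++ (t :: S.reverse)) (by simp [e1]) e2 e3 e4)
        (by
          intro e1 e2
          rw [hport, dist_comm]
          exact hlast R.reverse t S.reverse (by simp) ht (by simpa using e1)
            (by rwa [mass_reverse]))
        (fun _ h8 => by simp at h8) (fun v hv => hcell v (by simp [hv]))
      refine ⟨⟨(w, x), (w, some (up v)), loads S, false⟩ ::
        ⟨(up v, none), (up v, none), [], true⟩ :: u,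
        .cons ⟨(w, x), (w, some (up v)), loads S, false⟩ ?_
          (.cons ⟨(up v, none), (up v, none), [], true⟩ ?_ k1), ?_, ?_, ?_, ?_⟩
      · exact ⟨up v, hupv, hupr, .inr ⟨rfl, by simp [hparv]⟩⟩
      · exact ⟨up v, hupv, hupr, .inl ⟨rfl, by simp [hparv]⟩⟩
      · intro s hs hsx
        simp only [List.mem_cons] at hs
        rcases hs with rfl | rfl | hs
        · refine ⟨rfl, ⟨S, ?_, fun s hs => hpass s (by simp [hs]) (hS s hs), rfl⟩, ?_, ?_,
            fun v hv => hcell v (by simp [show v ∈ loads S from hv])⟩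
          · rw [hrefine]; exact hw1
          · intro _ h8; simp at h8
          · intro h8
            rw [hport]
            exact hfirst S t R rfl ht hS h8
        · simp at hsx
        · exact k2 s hs hsx
      · intro s hs hsx
        simp only [List.mem_cons] at hs
        rcases hs with rfl | rfl | hs
        · simp at hsx
        · simp
        · exact k3 s hs hsx
      · rw [exitCells_of_exitFree_append hS ht, List.map_cons, ← k4]
        simp [exitCells]
        rfl
      · simp [k5, h7]

theorem card_content_ge (hR : ∀ i, Refines (T i) (T (i + 1)) up (entry i) N) (h i : ℕ) (w : Cell)
    (hw : w ∈ (T i).verts) : N ^ h ≤ Multiset.card (content T up h i w) := by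
  induction h generalizing i w with
  | zero => simp [content]
  | succ h ih =>
    rw [content, Multiset.card_sum, pow_succ']
    nth_rw 1 [← (hR i).card_fiber w hw]
    rw [← smul_eq_mul]
    exact Finset.card_nsmul_le_sum _ _ _ fun c hc => ih _ _ (Finset.mem_filter.1 hc).1

theorem card_content_le (hR : ∀ i, Refines (T i) (T (i + 1)) up (entry i) N) (h i : ℕ) (w : Cell)
    (hw : w ∈ (T i).verts) : Multiset.card (content T up h i w) ≤ 10 * N ^ h := by
  induction h generalizing i w with
  | zero =>
    have := (T i).card_children_le w
    simp [content]
    omega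
  | succ h ih =>
    have e : 10 * N ^ (h + 1) = N * (10 * N ^ h) := by ring
    rw [content, Multiset.card_sum, e]
    nth_rw 1 [← (hR i).card_fiber w hw]
    rw [← smul_eq_mul]
    exact Finset.sum_le_card_nsmul _ _ _ fun c hc => ih _ _ (Finset.mem_filter.1 hc).1

theorem iterate_up_mem (hR : ∀ i, Refines (T i) (T (i + 1)) up (entry i) N) (m j : ℕ) {v : Cell}
    (hv : v ∈ (T (j + m)).verts) : up^[m] v ∈ (T j).verts := by
  induction m generalizing v with
  | zero => exact hv
  | succ m ih => exact ih ((hR (j + m)).up_mem v hv)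

theorem mem_content (hR : ∀ i, Refines (T i) (T (i + 1)) up (entry i) N) (h i : ℕ) (w v : Cell)
    (hw : w ∈ (T i).verts) :
    v ∈ content T up h i w ↔ v ∈ (T (i + h)).verts ∧ up^[h] v = w := by
  induction h generalizing i w with
  | zero =>
    simp only [content, Multiset.mem_replicate, Function.iterate_zero, id_eq, add_zero]
    constructor
    · rintro ⟨-, rfl⟩; exact ⟨hw, rfl⟩
    · rintro ⟨-, rfl⟩; exact ⟨by simp, rfl⟩
  | succ h ih =>
    rw [content, Multiset.mem_sum]
    have e : i + 1 + h = i + (h + 1) := by ring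
    constructor
    · rintro ⟨c, hc, hv⟩
      rw [Finset.mem_filter] at hc
      obtain ⟨h1, h2⟩ := (ih _ _ hc.1).1 hv
      exact ⟨e ▸ h1, by rw [Function.iterate_succ_apply', h2, hc.2]⟩
    · rintro ⟨h1, h2⟩
      rw [Function.iterate_succ_apply'] at h2
      have h3 : up^[h] v ∈ (T (i + 1)).verts := iterate_up_mem hR h (i + 1) (e ▸ h1)
      exact ⟨up^[h] v, Finset.mem_filter.2 ⟨h3, h2⟩, (ih _ _ h3).2 ⟨e ▸ h1, rfl⟩⟩

/-- Every cell has a tour made of admissible passages, at all finer levels: the balanced tour of the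
whole tree inside the cell, cut at its exits. -/
theorem exists_tour (hR : ∀ i, Refines (T i) (T (i + 1)) up (entry i) N) (h i : ℕ) (w : Cell)
    (hw : w ∈ (T i).verts) : ∃ u, IsTour T up entry N h i w u := by
  classical
  induction h generalizing i w with
  | zero => exact exists_tour_zero
  | succ h ih =>
    choose! u hu using fun c (hc : c ∈ (T (i + 1)).verts) => ih (i + 1) c hc
    have hmass : ∀ c ∈ (T (i + 1)).verts, N ^ h ≤ mass (u c) := by
      intro c hc
      have h1 := card_content_ge hR h (i + 1) c hc
      rwa [← (hu c hc).content, Multiset.coe_card] at h1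
    obtain ⟨e, he⟩ := exists_branchTours (w := w) (fun c hc _ => hu c hc)
      (fun c hc _ => hmass c hc)
    set S := (T (i + 1)).verts.filter (fun c => up c = w) with hS
    have hc₀ : entry i w ∈ S :=
      Finset.mem_filter.2 ⟨(hR i).entry_mem w hw, (hR i).up_entry w hw⟩
    have hpar : ∀ c ∈ S, c ≠ entry i w → (T (i + 1)).par c ∈ S := by
      intro c hc hne
      obtain ⟨h1, h2⟩ := Finset.mem_filter.1 hc
      have hr : c ≠ (T (i + 1)).root := by
        intro hr
        apply hne
        rw [← (hR i).entry_root] at hr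
        have : w = (T i).root := by rw [← h2, hr, (hR i).up_entry _ (hR i).root_mem]
        rw [hr, this]
      refine Finset.mem_filter.2 ⟨(T (i + 1)).par_mem c h1 hr, ?_⟩
      rw [(hR i).up_par c h1 (by rwa [h2]), h2]
    -- the children of `c` inside `w`
    have hinner : ∀ c ∈ S, ((T (i + 1)).children c).filter (fun v => up v = w) =
        S.filter (fun y => y ≠ entry i w ∧ (T (i + 1)).par y = c) := by
      intro c hc
      ext y
      simp only [CellTree.children, Finset.mem_filter, hS]
      constructor
      · rintro ⟨⟨h1, h2, h3⟩, h4⟩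
        refine ⟨⟨h1, h4⟩, ?_, h3⟩
        rintro rfl
        have hwr : w ≠ (T i).root := fun hwr => h2 (by rw [hwr, (hR i).entry_root])
        have h5 := (hR i).up_par_entry w hw hwr
        rw [h3, (Finset.mem_filter.1 hc).2] at h5
        have := (T i).rank_par w hw hwr
        rw [← h5] at this
        exact lt_irrefl _ this
      · rintro ⟨⟨h1, h2⟩, h3, h4⟩
        refine ⟨⟨h1, ?_, h4⟩, h2⟩
        intro hr
        apply h3
        rw [← (hR i).entry_root] at hr
        have : w = (T i).root := by rw [← h2, hr, (hR i).up_entry _ (hR i).root_mem]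
        rw [hr, this]
    have hloads : (loads (e (entry i w)) : Multiset Cell) = content T up (h + 1) i w := by
      rw [tree_sum (f := fun c => (loads (e c) : Multiset Cell))
        (g := fun c => (loads (u c) : Multiset Cell)) hc₀ hpar]
      · rw [content]
        exact Finset.sum_congr rfl fun c hc => (hu c (Finset.mem_filter.1 hc).1).content
      · intro c hc
        obtain ⟨h1, h2⟩ := Finset.mem_filter.1 hc
        rw [← hinner c hc, Finset.sum, Finset.filter_val]
        rcases (he c h1 h2).1 with h3 | h3
        · conv_lhs => rw [h3]
          rw [loads_insertBranches (hu c h1).wf, (hu c h1).exits]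
        · conv_lhs => rw [h3]
          rw [loads_insertBranches (hu c h1).wf.mirror, (hu c h1).mirror.exits,
            loads_mirror, Multiset.coe_reverse]
    -- each child of `w` is left exactly once, since only one edge of the finer tree leads to it
    have hexits : ((exitCells (e (entry i w))).map up : Multiset Cell) =
        ((T i).children w).val := by
      set Z := (T (i + 1)).verts.filter
        (fun y => (y ≠ (T (i + 1)).root ∧ (T (i + 1)).par y ∈ S) ∧ ¬ up y = w) with hZ
      have h1 : (exitCells (e (entry i w)) : Multiset Cell) = Z.val := by
        rw [tree_sum (f := fun c => (exitCells (e c) : Multiset Cell))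
          (g := fun c => (((T (i + 1)).children c).filter (fun v => ¬ up v = w)).val) hc₀ hpar]
        · ext y
          rw [Multiset.count_sum', Multiset.count_eq_of_nodup Z.nodup]
          simp_rw [Multiset.count_eq_of_nodup (Finset.nodup _)]
          by_cases hy : y ∈ Z
          · have hy' := (Finset.mem_filter.1 hy).2
            have hyv := (Finset.mem_filter.1 hy).1
            rw [if_pos (by simpa using hy),
              Finset.sum_eq_single ((T (i + 1)).par y)]
            · rw [if_pos]
              simp only [CellTree.children, Finset.mem_val, Finset.mem_filter]
              tauto
            · intro c _ hne
              rw [if_neg]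
              simp only [CellTree.children, Finset.mem_val, Finset.mem_filter]
              tauto
            · intro h'; exact absurd hy'.1.2 h'
          · rw [if_neg (by simpa using hy)]
            refine Finset.sum_eq_zero fun c hc => if_neg fun h' => hy ?_
            simp only [CellTree.children, Finset.mem_val, Finset.mem_filter] at h'
            obtain ⟨⟨h2, h3, h4⟩, h5⟩ := h'
            exact Finset.mem_filter.2 ⟨h2, ⟨h3, by rwa [h4]⟩, h5⟩
        · intro c hc
          obtain ⟨h1, h2⟩ := Finset.mem_filter.1 hc
          rw [← hinner c hc, Finset.sum, Finset.filter_val, Finset.filter_val]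
          rcases (he c h1 h2).1 with h3 | h3
          · conv_lhs => rw [h3]
            rw [exitCells_insertBranches, (hu c h1).exits]
          · conv_lhs => rw [h3]
            rw [exitCells_insertBranches, (hu c h1).mirror.exits]
      have hentry : ∀ y ∈ Z, entry i (up y) = y := by
        intro y hy
        obtain ⟨h2, ⟨-, h3⟩, h4⟩ := Finset.mem_filter.1 hy
        by_contra hne
        have h5 := (hR i).up_par y h2 (Ne.symm hne)
        exact h4 (h5.symm.trans (Finset.mem_filter.1 h3).2)
      have h2 : Z.image up = (T i).children w := by
        ext y
        simp only [Finset.mem_image, CellTree.children, Finset.mem_filter]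
        constructor
        · rintro ⟨z, hz, rfl⟩
          have h3 := hentry z hz
          obtain ⟨h4, ⟨h5, h6⟩, h7⟩ := Finset.mem_filter.1 hz
          have h8 : up z ≠ (T i).root := by
            intro hr
            rw [hr, (hR i).entry_root] at h3
            exact h5 h3.symm
          refine ⟨(hR i).up_mem z h4, h8, ?_⟩
          rw [← (hR i).up_par_entry _ ((hR i).up_mem z h4) h8, h3]
          exact (Finset.mem_filter.1 h6).2
        · rintro ⟨h3, h4, h5⟩
          have h6 := (hR i).entry_ne_root h3 h4
          refine ⟨entry i y, Finset.mem_filter.2 ⟨(hR i).entry_mem y h3, ⟨h6, ?_⟩, ?_⟩,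
            (hR i).up_entry y h3⟩
          · refine Finset.mem_filter.2 ⟨(T (i + 1)).par_mem _ ((hR i).entry_mem y h3) h6, ?_⟩
            rw [(hR i).up_par_entry y h3 h4, h5]
          · rw [(hR i).up_entry y h3]
            intro hyw
            have := (T i).rank_par y h3 h4
            rw [h5, hyw] at this
            exact lt_irrefl _ this
      rw [← Multiset.map_coe, h1, ← Finset.image_val_of_injOn, h2]
      intro y hy z hz hyz
      rw [← hentry y hy, ← hentry z hz]
      exact congrArg _ hyz
    obtain ⟨h1, h2⟩ := Finset.mem_filter.1 hc₀
    have hb := (he _ h1 h2).2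
    have hcount : exitCount (e (entry i w)) ≤ 9 := by
      have h3 := congrArg Multiset.card hexits
      simp only [Multiset.coe_card, List.length_map, Finset.card_val] at h3
      have h4 := (T i).card_children_le w
      rw [exitCount, h3]
      exact_mod_cast h4
    have hcard : N ^ (h + 1) ≤ mass (e (entry i w)) := by
      have h3 := card_content_ge hR (h + 1) i w hw
      rwa [← hloads, Multiset.coe_card] at h3
    obtain ⟨v, k1, k2, k3, k4, k5⟩ := exists_passes hR _ (e (entry i w)) le_rfl none hb.walk hw
      hb.pass hb.wf hb.out (hb.bal.first.mono (by linarith)) (hb.bal.gaps.mono (by linarith))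
      (hb.bal.last.mono (by linarith)) (fun _ _ => by simp [refineHE]) (fun _ _ => hcard)
      (fun v hv => ((mem_content hR (h + 1) i w v hw).1 (hloads ▸ Multiset.mem_coe.2 hv)).2)
    exact ⟨v, k1, k2, by rw [k4, hexits], k3, by rw [k5, hloads]⟩

end Main

/-! ### Tours do not travel far in a short time -/

theorem length_load_le_mass {S : List Visit} {s : Visit} (h : s ∈ S) :
    s.load.length ≤ mass S := by
  induction S with
  | nil => simp at h
  | cons t S ih =>
    rw [mass_cons]
    rcases List.mem_cons.1 h with rfl | h
    · omega
    · have := ih h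
      omega

section Runs

variable {T : ℕ → CellTree} {up : Cell → Cell} {entry : ℕ → Cell → Cell} {N : ℕ}

theorem IsPass.fst_eq {h i : ℕ} {a b : HalfEdge} {l : List Cell}
    (hp : IsPass T up entry N h i a b l) : a.1 = b.1 := by
  cases h with
  | zero => exact hp.1
  | succ h => exact hp.1

theorem IsPass.iterate_up {h i : ℕ} {a b : HalfEdge} {l : List Cell}
    (hp : IsPass T up entry N h i a b l) {v : Cell} (hv : v ∈ l) : up^[h] v = a.1 := by
  cases h with
  | zero =>
    rw [hp.2, List.mem_singleton] at hv
    exact hv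
  | succ h => exact hp.2.2.2.2 v hv

theorem CellTree.Link.dist_le {T : CellTree} {a b : HalfEdge} (h : T.Link a b) :
    dist a.1 b.1 ≤ 1 := by
  obtain ⟨v, hv, hr, ⟨rfl, rfl⟩ | ⟨rfl, rfl⟩⟩ := h
  · exact T.dist_par v hv hr
  · rw [dist_comm]; exact T.dist_par v hv hr

theorem Walk.dist_le {T : CellTree} {a b : HalfEdge} {S : List Visit} (hS : Walk T.Link a S b)
    (h : ∀ s ∈ S, s.src.1 = s.tgt.1) : ∀ s ∈ S, dist a.1 s.src.1 ≤ S.length := by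
  induction hS with
  | single t =>
    intro s hs
    rw [List.mem_singleton] at hs
    simp [hs]
  | @cons t a' b' L hr _ ih =>
    intro s hs
    rcases List.mem_cons.1 hs with rfl | hs
    · rw [dist_self]; positivity
    · have h1 := ih (fun s hs => h s (by simp [hs])) s hs
      have h2 := hr.dist_le
      rw [← h t (by simp)] at h2
      push_cast [List.length_cons]
      linarith [dist_triangle t.src.1 a'.1 s.src.1]

/-- A walk at level `i` is also a walk at level `i + 1`. -/
theorem Walk.refine (hR : ∀ i, Refines (T i) (T (i + 1)) up (entry i) N) {h i : ℕ}
    {a b : HalfEdge} {S : List Visit} (hS : Walk (T i).Link a S b)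
    (hp : ∀ s ∈ S, IsPass T up entry N (h + 1) i s.src s.tgt s.load) :
    ∃ S', Walk (T (i + 1)).Link (refineHE (T (i + 1)) (entry i) a) S'
        (refineHE (T (i + 1)) (entry i) b) ∧
      (∀ s ∈ S', IsPass T up entry N h (i + 1) s.src s.tgt s.load) ∧ loads S' = loads S := by
  induction hS with
  | single s =>
    obtain ⟨-, ⟨S, h1, h2, h3⟩, -⟩ := hp s (by simp)
    exact ⟨S, h1, h2, by simp [h3]⟩
  | cons s hr _ ih =>
    obtain ⟨-, ⟨S, h1, h2, h3⟩, -⟩ := hp s (by simp)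
    obtain ⟨S', h4, h5, h6⟩ := ih fun t ht => hp t (by simp [ht])
    refine ⟨S ++ S', h1.append ((hR i).link hr) h4, ?_, by simp [h3, h6]⟩
    intro t ht
    exact (List.mem_append.1 ht).elim (h2 t) (h5 t)

/-- A run away from the root visits different cells, and if its passages are short, then these
cells are close to each other. -/
theorem Walk.exists_finset (hR : ∀ i, Refines (T i) (T (i + 1)) up (entry i) N) {h i : ℕ}
    {a b : HalfEdge} {S : List Visit} (hS : Walk (T i).Link a S b)
    (hp : ∀ s ∈ S, IsPass T up entry N (h + 1) i s.src s.tgt s.load)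
    (hdown : ∀ s ∈ S, s.tgt.2 ≠ none) (hshort : ∀ s ∈ S, 2 * s.load.length < N ^ h) :
    ∃ F : Finset Cell, F.card + 1 = S.length ∧ (∀ w ∈ F, (T i).rank a.1 ≤ (T i).rank w) ∧
      ∀ w ∈ F, ∃ P, up P = w ∧
        dist (refineHE (T (i + 1)) (entry i) a).1 P ≤ 19 * S.length := by
  induction hS with
  | single s => exact ⟨∅, by simp⟩
  | @cons s a' b' L hr _ ih =>
    obtain ⟨F, h1, h2, h3⟩ := ih (fun t ht => hp t (by simp [ht]))
      (fun t ht => hdown t (by simp [ht])) (fun t ht => hshort t (by simp [ht]))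
    obtain ⟨h4, -, -, h5, -⟩ := hp s (by simp)
    have h6 := h5 (hshort s (by simp))
    have h7 := ((hR i).link hr).dist_le
    obtain ⟨v, hv, hvr, ⟨h8, -⟩ | ⟨rfl, h8⟩⟩ := hr
    · exact absurd (by rw [h8]) (hdown s (by simp))
    have h9 : s.src.1 = (T i).par v := by rw [h4, h8]
    have h10 := (T i).rank_par v hv hvr
    refine ⟨insert s.src.1 F, ?_, ?_, ?_⟩
    · rw [Finset.card_insert_of_notMem, h1, List.length_cons]
      intro hmem
      have := h2 _ hmem
      rw [h9] at this
      simp only at this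
      omega
    · intro w hw
      rcases Finset.mem_insert.1 hw with rfl | hw
      · exact le_rfl
      · have := h2 w hw
        rw [h9]
        simp only at this
        omega
    · intro w hw
      push_cast [List.length_cons]
      have hn : (0 : ℝ) ≤ L.length := by positivity
      rcases Finset.mem_insert.1 hw with rfl | hw
      · refine ⟨(refineHE (T (i + 1)) (entry i) s.tgt).1, ?_, by linarith⟩
        rw [h9, h8]
        exact (hR i).up_par_entry v hv hvr
      · obtain ⟨P, rfl, h11⟩ := h3 w hw
        refine ⟨P, rfl, ?_⟩
        have e1 := dist_triangle (refineHE (T (i + 1)) (entry i) s.src).1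
          (refineHE (T (i + 1)) (entry i) s.tgt).1 P
        have e2 := dist_triangle (refineHE (T (i + 1)) (entry i) s.tgt).1
          (refineHE (T (i + 1)) (entry i) (v, none)).1 P
        linarith

/-- A run of eleven short visits away from the root would meet ten different cells with ports at
distance at most `11 * 19 = 209` from the first port. By the hypothesis on `up`, these cells would
all lie in a block of `3 × 3` cells. -/
theorem Walk.length_le_ten (hR : ∀ i, Refines (T i) (T (i + 1)) up (entry i) N)
    (hup : ∀ u v, dist u v ≤ 209 → dist (up u) (up v) ≤ 1) {h i : ℕ}
    {a b : HalfEdge} {S : List Visit} (hS : Walk (T i).Link a S b)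
    (hp : ∀ s ∈ S, IsPass T up entry N (h + 1) i s.src s.tgt s.load)
    (hdown : ∀ s ∈ S, s.tgt.2 ≠ none) (hshort : ∀ s ∈ S, 2 * s.load.length < N ^ h) :
    S.length ≤ 10 := by
  by_contra hlt
  have hlen : (S.take 11).length = 11 := by rw [List.length_take]; omega
  obtain ⟨b', hw⟩ : ∃ b', Walk (T i).Link a (S.take 11) b' := by
    rw [← List.take_append_drop 11 S] at hS
    by_cases hd : S.drop 11 = []
    · rw [hd, List.append_nil] at hS
      exact ⟨b, hS⟩
    · obtain ⟨c, d, h1, -, -⟩ := hS.split (by intro h0; rw [h0] at hlen; simp at hlen) hd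
      exact ⟨c, h1⟩
  obtain ⟨F, h1, -, h3⟩ := hw.exists_finset hR (fun s hs => hp s (List.mem_of_mem_take hs))
    (fun s hs => hdown s (List.mem_of_mem_take hs))
    (fun s hs => hshort s (List.mem_of_mem_take hs))
  have h4 : F.card ≤ 9 := by
    refine card_le_nine (w := up (refineHE (T (i + 1)) (entry i) a).1) fun w hw => ?_
    obtain ⟨P, rfl, h5⟩ := h3 w hw
    rw [hlen] at h5
    rw [dist_comm]
    exact hup _ _ (h5.trans (by norm_num))
  omega

/-- A walk that has come from a parent and meets no cell completely continues away from the root. -/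
theorem Walk.tgt_ne_none {h i : ℕ} {a b : HalfEdge} {S : List Visit} (hS : Walk (T i).Link a S b)
    (hp : ∀ s ∈ S, IsPass T up entry N (h + 1) i s.src s.tgt s.load)
    (hshort : ∀ s ∈ S, s.load.length < N ^ (h + 1)) (ha : a.2 = none) :
    ∀ s ∈ S, s.tgt.2 ≠ none := by
  have key : ∀ s ∈ S, s.src.2 = none → s.tgt.2 ≠ none := by
    intro s hs h1 h2
    obtain ⟨-, -, h3, -⟩ := hp s hs
    have := h3 h1 h2
    have := hshort s hs
    omega
  clear hp hshort
  induction hS with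
  | single s => simpa [ha] using key s (by simp)
  | cons s hr _ ih =>
    have h1 := key s (by simp) ha
    intro t ht
    rcases List.mem_cons.1 ht with rfl | ht
    · exact h1
    · refine ih ?_ (fun t ht => key t (by simp [ht])) t ht
      obtain ⟨v, -, -, ⟨h2, -⟩ | ⟨rfl, -⟩⟩ := hr
      · exact absurd (by rw [h2]) h1
      · rfl

/-- A walk made of few steps of the finest level makes few steps at every coarser level. While no
cell is met completely, the walk first goes towards the root and then away from it, and in either
direction it would visit too many different cells close to each other. -/
theorem Walk.length_le (hR : ∀ i, Refines (T i) (T (i + 1)) up (entry i) N) (hN : 1 ≤ N)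
    (hup : ∀ u v, dist u v ≤ 209 → dist (up u) (up v) ≤ 1) {h i : ℕ}
    {a b : HalfEdge} {S : List Visit} (hS : Walk (T i).Link a S b)
    (hp : ∀ s ∈ S, IsPass T up entry N (h + 1) i s.src s.tgt s.load)
    (hshort : 2 * mass S < N ^ h) : S.length ≤ 20 := by
  have hs : ∀ s ∈ S, 2 * s.load.length < N ^ h := fun s hs => by
    have := length_load_le_mass hs
    omega
  have hs' : ∀ s ∈ S, s.load.length < N ^ (h + 1) := fun s h1 => by
    have h2 := hs s h1
    have h3 : N ^ h ≤ N ^ (h + 1) := Nat.pow_le_pow_right hN (by omega)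
    omega
  -- `U` consists of the visits before the first arrival from a parent
  obtain ⟨U, D, rfl, hU, hD⟩ : ∃ U D, S = U ++ D ∧ (∀ s ∈ U, s.src.2 ≠ none) ∧
      ∀ s D', D = s :: D' → s.src.2 = none := by
    clear hS hp hshort hs hs'
    induction S with
    | nil => exact ⟨[], [], by simp⟩
    | cons s S ih =>
      by_cases h1 : s.src.2 = none
      · refine ⟨[], s :: S, rfl, by simp, ?_⟩
        intro t D' h2
        rw [List.cons.injEq] at h2
        rw [← h2.1, h1]
      · obtain ⟨U, D, rfl, h2, h3⟩ := ih
        refine ⟨s :: U, D, rfl, ?_, h3⟩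
        intro t ht
        rcases List.mem_cons.1 ht with rfl | ht
        · exact h1
        · exact h2 t ht
  have keyU : ∀ c, Walk (T i).Link a U c → U.length ≤ 10 := by
    intro c hw
    have e : (HolderCarpet.mirror U).length = U.length := by simp [HolderCarpet.mirror]
    rw [← e]
    refine (hw.mirror fun _ _ => CellTree.Link.symm).length_le_ten hR hup (h := h) ?_ ?_ ?_
    all_goals
      intro s h1
      obtain ⟨t, ht, rfl⟩ := mem_mirror.1 h1
    · exact (hp t (by simp [ht])).reverse
    · exact hU t ht
    · simpa [Visit.flip] using hs t (by simp [ht])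
  have keyD : ∀ c, Walk (T i).Link c D b → D.length ≤ 10 := by
    intro c hw
    refine hw.length_le_ten hR hup (h := h) (fun s h1 => hp s (by simp [h1])) ?_
      (fun s h1 => hs s (by simp [h1]))
    refine hw.tgt_ne_none (fun s h1 => hp s (by simp [h1])) (fun s h1 => hs' s (by simp [h1])) ?_
    obtain ⟨s, D', rfl⟩ := List.exists_cons_of_ne_nil hw.ne_nil
    rw [hw.src_eq]
    exact hD s D' rfl
  rw [List.length_append]
  by_cases hU0 : U = []
  · subst hU0
    have := keyD _ hS
    simp; omega
  by_cases hD0 : D = []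
  · subst hD0
    have := keyU _ (by simpa using hS)
    simp; omega
  obtain ⟨c, d, h1, -, h2⟩ := hS.split hU0 hD0
  have := keyU _ h1
  have := keyD _ h2
  omega

/-- The visit in which the step number `n` takes place. -/
theorem exists_mem_load {S : List Visit} {n : ℕ} (hn : n < (loads S).length) :
    ∃ S₁ s S₂, S = S₁ ++ s :: S₂ ∧ mass S₁ ≤ n ∧ n < mass S₁ + s.load.length ∧
      (loads S)[n] ∈ s.load := by
  induction S generalizing n with
  | nil => simp at hn
  | cons s S ih =>
    by_cases h : n < s.load.length
    · refine ⟨[], s, S, rfl, by simp, by simpa using h, ?_⟩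
      simp only [loads_cons]
      rw [List.getElem_append_left h]
      exact List.getElem_mem _
    · rw [not_lt] at h
      have hn' : n - s.load.length < (loads S).length := by
        rw [loads_cons, List.length_append] at hn
        omega
      obtain ⟨S₁, t, S₂, rfl, h1, h2, h3⟩ := ih hn'
      refine ⟨s :: S₁, t, S₂, rfl, ?_, ?_, ?_⟩
      · rw [mass_cons]; omega
      · rw [mass_cons]; omega
      · simp only [loads_cons _ (S₁ ++ _)]
        rw [List.getElem_append_right h]
        exact h3

/-- Between the two visits in which the steps `m` and `n` take place, there are at most twenty short
visits. -/
theorem Walk.dist_getElem_le (hR : ∀ i, Refines (T i) (T (i + 1)) up (entry i) N) (hN : 1 ≤ N)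
    (hup : ∀ u v, dist u v ≤ 209 → dist (up u) (up v) ≤ 1) {h i : ℕ}
    {a b : HalfEdge} {S : List Visit} (hS : Walk (T i).Link a S b)
    (hp : ∀ s ∈ S, IsPass T up entry N (h + 1) i s.src s.tgt s.load) {m n : ℕ} (hmn : m ≤ n)
    (hn : n < (loads S).length) (hlt : 2 * (n - m) < N ^ h) :
    dist (up^[h + 1] ((loads S)[m])) (up^[h + 1] (loads S)[n]) ≤ 22 := by
  obtain ⟨S₁, s, S₂, rfl, h1, h2, h3⟩ := exists_mem_load (hmn.trans_lt hn)
  rw [(hp s (by simp)).iterate_up h3]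
  by_cases hsame : n < mass S₁ + s.load.length
  · have h4 : (loads (S₁ ++ s :: S₂))[n] ∈ s.load := by
      simp only [loads_append, loads_cons]
      unfold mass at h1 hsame
      rw [List.getElem_append_right (by omega), List.getElem_append_left (by omega)]
      exact List.getElem_mem _
    rw [(hp s (by simp)).iterate_up h4, dist_self]
    norm_num
  rw [not_lt] at hsame
  have hn' : n - mass S₁ - s.load.length < (loads S₂).length := by
    simp only [loads_append, loads_cons, List.length_append] at hn
    unfold mass
    unfold mass at hsame
    omega
  obtain ⟨S₃, t, S₄, rfl, h5, h6, h7⟩ := exists_mem_load hn'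
  have h8 : (loads (S₁ ++ s :: (S₃ ++ t :: S₄)))[n] ∈ t.load := by
    simp only [loads_append _ (s :: _), loads_cons _ (S₃ ++ _)]
    rw [List.getElem_append_right (by unfold mass at h1; omega),
      List.getElem_append_right (by unfold mass at hsame; omega)]
    exact h7
  rw [(hp t (by simp)).iterate_up h8]
  -- the part of the walk from `s` to `t`
  obtain ⟨c, hw⟩ : ∃ c, Walk (T i).Link s.src (s :: S₃ ++ [t]) c := by
    have hw1 : ∃ c, Walk (T i).Link s.src (s :: (S₃ ++ t :: S₄)) c := by
      by_cases h0 : S₁ = []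
      · subst h0
        rw [List.nil_append] at hS
        have := hS.src_eq
        exact ⟨b, this ▸ hS⟩
      · obtain ⟨c, d, -, -, h9⟩ := hS.split h0 (by simp)
        exact ⟨b, h9.src_eq ▸ h9⟩
    obtain ⟨c, hw1⟩ := hw1
    have e : s :: (S₃ ++ t :: S₄) = (s :: S₃ ++ [t]) ++ S₄ := by simp
    rw [e] at hw1
    by_cases h0 : S₄ = []
    · subst h0
      exact ⟨c, by simpa using hw1⟩
    · obtain ⟨c, d, h9, -, -⟩ := hw1.split (by simp) h0
      exact ⟨c, h9⟩
  have hlen : S₃.length ≤ 20 := by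
    by_cases h0 : S₃ = []
    · simp [h0]
    obtain ⟨c', d, -, -, h9⟩ := Walk.split (L := [s]) (M := S₃ ++ [t]) hw (by simp) (by simp)
    obtain ⟨c', d, h10, -, -⟩ := h9.split h0 (by simp)
    exact h10.length_le hR hN hup (h := h) (fun r hr => hp r (by simp [hr])) (by omega)
  have h9 := hw.dist_le (fun r hr => (hp r (by
    simp only [List.mem_append, List.mem_cons, List.cons_append, List.not_mem_nil,
      or_false] at hr ⊢
    tauto)).fst_eq) t (by simp)
  refine h9.trans ?_
  simp only [List.cons_append, List.length_cons, List.length_append, List.length_nil]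
  have : S₃.length + (0 + 1) + 1 ≤ 22 := by omega
  exact_mod_cast this

/-- There are lists of all the cells of level `k`, of length comparable with their number, such that
positions in the list at distance less than `N ^ h / 2` belong to cells whose ancestors `h + 1`
levels higher are close to each other. -/
theorem exists_traversal (hR : ∀ i, Refines (T i) (T (i + 1)) up (entry i) N) (hN : 1 ≤ N)
    (hup : ∀ u v, dist u v ≤ 209 → dist (up u) (up v) ≤ 1)
    (h0 : (T 0).verts = {(T 0).root}) (k : ℕ) :
    ∃ l : List Cell, (∀ v, v ∈ l ↔ v ∈ (T k).verts) ∧ N ^ k ≤ l.length ∧ l.length ≤ 10 * N ^ k ∧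
      ∀ h, h + 1 ≤ k → ∀ m n (_ : m ≤ n) (_ : n < l.length), 2 * (n - m) < N ^ h →
        dist (up^[h + 1] l[m]) (up^[h + 1] l[n]) ≤ 22 := by
  have hr : (T 0).root ∈ (T 0).verts := by simp [h0]
  obtain ⟨u, hu⟩ := exists_tour hR k 0 _ hr
  have hch : (T 0).children (T 0).root = ∅ := by
    ext y
    simp only [CellTree.children, h0, Finset.mem_filter, Finset.mem_singleton]
    tauto
  have hfree : ExitFree u := by
    rw [exitFree_iff, ← Multiset.coe_eq_zero, hu.exits, hch]
    rfl
  have hwalk : ∀ i h, i + h = k → ∃ a b S, Walk (T i).Link a S b ∧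
      (∀ s ∈ S, IsPass T up entry N h i s.src s.tgt s.load) ∧ loads S = loads u := by
    intro i
    induction i with
    | zero =>
      intro h hh
      obtain rfl : h = k := by omega
      exact ⟨_, _, u, hu.walk, fun s hs => hu.pass s hs (hfree s hs), rfl⟩
    | succ i ih =>
      intro h hh
      obtain ⟨a, b, S, h1, h2, h3⟩ := ih (h + 1) (by omega)
      obtain ⟨S', h4, h5, h6⟩ := h1.refine hR h2
      exact ⟨_, _, S', h4, h5, h6.trans h3⟩
  refine ⟨loads u, fun v => ?_, ?_, ?_, ?_⟩
  · rw [← Multiset.mem_coe, hu.content, mem_content hR k 0 _ v hr, zero_add]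
    refine ⟨fun h => h.1, fun h => ⟨h, ?_⟩⟩
    have h1 := iterate_up_mem hR k 0 (by rwa [zero_add])
    rwa [h0, Finset.mem_singleton] at h1
  · have := card_content_ge hR k 0 _ hr
    rwa [← hu.content, Multiset.coe_card] at this
  · have := card_content_le hR k 0 _ hr
    rwa [← hu.content, Multiset.coe_card] at this
  · intro h hk m n hmn hn hlt
    obtain ⟨a, b, S, h1, h2, h3⟩ := hwalk (k - (h + 1)) (h + 1) (by omega)
    simp only [← h3]
    exact h1.dist_getElem_le hR hN hup h2 hmn (by rwa [h3]) hlt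

end Runs

/-! ### A refining sequence of trees -/

/-- The subcell with digit `d` of the cell `w`, when cells are cut into `p × q` subcells. -/
def subcell (p q : ℕ) (w d : Cell) : Cell := (p * w.1 + d.1, q * w.2 + d.2)

/-- The cell of the coarser level that contains a given cell. -/
def supercell (p q : ℕ) (c : Cell) : Cell := (c.1 / p, c.2 / q)

/-- The cells of level `k` selected by the set `D` of digits. -/
def cells (p q : ℕ) (D : Finset Cell) : ℕ → Finset Cell
  | 0 => {0}
  | k + 1 => (cells p q D k).biUnion fun w => D.image (subcell p q w)

/-- All the digits lie in the box `[0, p) × [0, q)`. -/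
def IsDigitSet (p q : ℕ) (D : Finset Cell) : Prop :=
  ∀ d ∈ D, 0 ≤ d.1 ∧ d.1 < p ∧ 0 ≤ d.2 ∧ d.2 < q

theorem IsDigitSet.supercell_subcell {p q : ℕ} {D : Finset Cell} (hD : IsDigitSet p q D)
    (w : Cell) {d : Cell} (hd : d ∈ D) : supercell p q (subcell p q w d) = w := by
  obtain ⟨h1, h2, h3, h4⟩ := hD d hd
  have hp : (p : ℤ) ≠ 0 := by omega
  have hq : (q : ℤ) ≠ 0 := by omega
  simp only [supercell, subcell]
  rw [Int.add_ediv_of_dvd_left (dvd_mul_right _ _), Int.add_ediv_of_dvd_left (dvd_mul_right _ _),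
    Int.mul_ediv_cancel_left _ hp, Int.mul_ediv_cancel_left _ hq, Int.ediv_eq_zero_of_lt h1 h2,
    Int.ediv_eq_zero_of_lt h3 h4]
  simp

theorem subcell_injective (p q : ℕ) (w : Cell) : Function.Injective (subcell p q w) := by
  intro d d' h
  simp only [subcell, Prod.mk.injEq, add_right_inj] at h
  exact Prod.ext h.1 h.2

theorem dist_ediv_le {p : ℕ} {n : ℤ} (hp : n ≤ p) (hp0 : 0 < p) {a b : ℤ} (h : |a - b| ≤ n) :
    |a / p - b / p| ≤ 1 := by
  have hp' : (0 : ℤ) < p := by exact_mod_cast hp0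
  rw [abs_le] at h ⊢
  have h1 : a / p ≤ b / p + 1 := by
    have := Int.ediv_le_ediv hp' (show a ≤ b + 1 * p by linarith)
    rwa [Int.add_mul_ediv_right _ _ hp'.ne'] at this
  have h2 : b / p ≤ a / p + 1 := by
    have := Int.ediv_le_ediv hp' (show b ≤ a + 1 * p by linarith)
    rwa [Int.add_mul_ediv_right _ _ hp'.ne'] at this
  constructor <;> linarith

theorem dist_supercell_le {p q : ℕ} {n : ℕ} (hn : 0 < n) (hp : n ≤ p) (hq : n ≤ q) {u v : Cell}
    (h : dist u v ≤ n) : dist (supercell p q u) (supercell p q v) ≤ 1 := by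
  rw [Prod.dist_eq, max_le_iff, Int.dist_eq, Int.dist_eq] at h ⊢
  have h1 : |u.1 - v.1| ≤ (n : ℤ) := by exact_mod_cast h.1
  have h2 : |u.2 - v.2| ≤ (n : ℤ) := by exact_mod_cast h.2
  have h3 := dist_ediv_le (by exact_mod_cast hp) (hn.trans_le hp) h1
  have h4 := dist_ediv_le (by exact_mod_cast hq) (hn.trans_le hq) h2
  simp only [supercell]
  exact ⟨by exact_mod_cast h3, by exact_mod_cast h4⟩

theorem mem_cells_succ {p q : ℕ} {D : Finset Cell} {k : ℕ} {c : Cell} :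
    c ∈ cells p q D (k + 1) ↔ ∃ w ∈ cells p q D k, ∃ d ∈ D, subcell p q w d = c := by
  simp [cells]

/-- The adjacency of cells within `D`. -/
def AdjIn (adj : Cell → Cell → Prop) (D : Finset Cell) (x y : Cell) : Prop :=
  x ∈ D ∧ y ∈ D ∧ adj x y

/-- A connected finite graph has a spanning tree with any prescribed root. -/
theorem exists_spanning_tree {adj : Cell → Cell → Prop} {S : Finset Cell} {r : Cell}
    (hsymm : ∀ x y, adj x y → adj y x)
    (hconn : ∀ c ∈ S, Relation.ReflTransGen (AdjIn adj S) r c) :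
    ∃ (f : Cell → Cell) (ρ : Cell → ℕ), ∀ c ∈ S, c ≠ r → f c ∈ S ∧ adj c (f c) ∧ ρ (f c) < ρ c := by
  classical
  let reach : ℕ → Cell → Prop := fun n => Nat.rec (fun c => c = r)
    (fun _ P c => ∃ b, P b ∧ AdjIn adj S b c) n
  have hreach : ∀ c ∈ S, ∃ n, reach n c := by
    intro c hc
    have := hconn c hc
    clear hc
    induction this with
    | refl => exact ⟨0, rfl⟩
    | tail _ h2 ih =>
      obtain ⟨n, hn⟩ := ih
      exact ⟨n + 1, _, hn, h2⟩
  let ρ : Cell → ℕ := fun c => sInf {n | reach n c}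
  have key : ∀ c ∈ S, c ≠ r → ∃ b, b ∈ S ∧ adj c b ∧ ρ b < ρ c := by
    intro c hc hne
    have hspec : reach (ρ c) c := Nat.sInf_mem (s := {n | reach n c}) (hreach c hc)
    rcases hm : ρ c with _ | m
    · rw [hm] at hspec
      exact absurd hspec hne
    · rw [hm] at hspec
      obtain ⟨b, hb, h1, -, h2⟩ := hspec
      refine ⟨b, h1, hsymm _ _ h2, ?_⟩
      exact Nat.lt_succ_of_le (Nat.sInf_le (show m ∈ {n | reach n b} from hb))
  choose! f hf using key
  exact ⟨f, ρ, hf⟩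

section Refinement

variable {p q : ℕ} {D : Finset Cell} {adj : Cell → Cell → Prop}

/-- Spanning trees of the sets of subcells are joined along the edges of the given tree. -/
theorem exists_refinement (hD : IsDigitSet p q D) (hDne : D.Nonempty)
    (hsymm : ∀ x y, adj x y → adj y x) (hdist : ∀ x y, adj x y → dist x y ≤ 1)
    (htrans : ∀ t x y, adj x y → adj (t + x) (t + y))
    (hconn : ∀ d ∈ D, ∀ d' ∈ D, Relation.ReflTransGen (AdjIn adj D) d d')
    (hsub : ∀ x y, adj x y → ∃ d ∈ D, ∃ d' ∈ D, adj (subcell p q x d) (subcell p q y d'))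
    (T : CellTree) (hroot : T.root ∈ T.verts)
    (hadj : ∀ v ∈ T.verts, v ≠ T.root → adj v (T.par v)) :
    ∃ (T' : CellTree) (entry : Cell → Cell), Refines T T' (supercell p q) entry D.card ∧
      T'.root ∈ T'.verts ∧ (∀ v ∈ T'.verts, v ≠ T'.root → adj v (T'.par v)) ∧
      T'.verts = T.verts.biUnion fun w => D.image (subcell p q w) := by
  classical
  set up := supercell p q with hup
  obtain ⟨d₀, hd₀⟩ := hDne
  -- the link between a cell and its parent
  have hlink : ∀ w ∈ T.verts, ∃ d ∈ D, ∃ d' ∈ D, w ≠ T.root →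
      adj (subcell p q w d) (subcell p q (T.par w) d') := by
    intro w hw
    by_cases hr : w = T.root
    · exact ⟨d₀, hd₀, d₀, hd₀, fun h => absurd hr h⟩
    · obtain ⟨d, hd, d', hd', h⟩ := hsub _ _ (hadj w hw hr)
      exact ⟨d, hd, d', hd', fun _ => h⟩
  choose! din hdin dout hdout hlink using hlink
  have hsupin : ∀ w ∈ T.verts, up (subcell p q w (din w)) = w := fun w hw =>
    hD.supercell_subcell w (hdin w hw)
  -- the spanning trees inside the cells
  have hspan : ∀ w ∈ T.verts, ∃ (f : Cell → Cell) (ρ : Cell → ℕ),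
      ∀ c ∈ D.image (subcell p q w), c ≠ subcell p q w (din w) →
        f c ∈ D.image (subcell p q w) ∧ adj c (f c) ∧ ρ (f c) < ρ c := by
    intro w hw
    refine exists_spanning_tree hsymm fun c hc => ?_
    obtain ⟨d, hd, rfl⟩ := Finset.mem_image.1 hc
    refine (hconn (din w) (hdin w hw) d hd).lift (subcell p q w) fun x y h => ?_
    refine ⟨Finset.mem_image_of_mem _ h.1, Finset.mem_image_of_mem _ h.2.1, ?_⟩
    exact htrans (p * w.1, q * w.2) x y h.2.2
  choose! f ρ hf using hspan
  set V := T.verts.biUnion fun w => D.image (subcell p q w) with hV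
  have hVmem : ∀ c, c ∈ V ↔ up c ∈ T.verts ∧ c ∈ D.image (subcell p q (up c)) := by
    intro c
    rw [hV, Finset.mem_biUnion]
    constructor
    · rintro ⟨w, hw, hc⟩
      obtain ⟨d, hd, rfl⟩ := Finset.mem_image.1 hc
      have : up (subcell p q w d) = w := hD.supercell_subcell w hd
      rw [this]
      exact ⟨hw, hc⟩
    · rintro ⟨h1, h2⟩
      exact ⟨up c, h1, h2⟩
  have hVsub : ∀ w ∈ T.verts, ∀ d ∈ D, subcell p q w d ∈ V := fun w hw d hd =>
    Finset.mem_biUnion.2 ⟨w, hw, Finset.mem_image_of_mem _ hd⟩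
  set M := V.sup (fun c => ρ (up c) c) + 1 with hM
  let par' : Cell → Cell := fun c =>
    if c = subcell p q (up c) (din (up c)) then subcell p q (T.par (up c)) (dout (up c))
    else f (up c) c
  -- lexicographic: first the height in `T`, then the height inside the cell
  let rank' : Cell → ℕ := fun c => T.rank (up c) * M + ρ (up c) c
  have hρ : ∀ c ∈ V, ρ (up c) c < M := fun c hc =>
    Nat.lt_succ_of_le (Finset.le_sup (f := fun c => ρ (up c) c) hc)
  set root' := subcell p q T.root (din T.root) with hroot'
  -- the two kinds of edges
  have edge : ∀ c ∈ V, c ≠ root' → par' c ∈ V ∧ adj c (par' c) ∧ rank' (par' c) < rank' c ∧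
      (c = subcell p q (up c) (din (up c)) → up (par' c) = T.par (up c)) ∧
      (c ≠ subcell p q (up c) (din (up c)) → up (par' c) = up c) := by
    intro c hc hne
    obtain ⟨h1, h2⟩ := (hVmem c).1 hc
    by_cases he : c = subcell p q (up c) (din (up c))
    · have hur : up c ≠ T.root := by
        intro h
        rw [h] at he
        exact hne he
      have hpar : par' c = subcell p q (T.par (up c)) (dout (up c)) := if_pos he
      have hupp : up (par' c) = T.par (up c) := by
        rw [hpar]
        exact hD.supercell_subcell _ (hdout _ h1)
      have hmem : par' c ∈ V := by
        rw [hpar]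
        exact hVsub _ (T.par_mem _ h1 hur) _ (hdout _ h1)
      refine ⟨hmem, ?_, ?_, fun _ => hupp, fun h => absurd he h⟩
      · have := hlink _ h1 hur
        rw [← he] at this
        rwa [hpar]
      · have h3 := T.rank_par _ h1 hur
        have h4 := hρ _ hmem
        simp only [rank']
        rw [hupp] at h4 ⊢
        calc T.rank (T.par (up c)) * M + ρ (T.par (up c)) (par' c)
            < T.rank (T.par (up c)) * M + M := by omega
          _ = (T.rank (T.par (up c)) + 1) * M := by ring
          _ ≤ T.rank (up c) * M := Nat.mul_le_mul_right _ h3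
          _ ≤ _ := Nat.le_add_right _ _
    · have hpar : par' c = f (up c) c := if_neg he
      obtain ⟨h3, h4, h5⟩ := hf _ h1 c h2 he
      have hupp : up (par' c) = up c := by
        obtain ⟨d, hd, h6⟩ := Finset.mem_image.1 h3
        rw [hpar, ← h6]
        exact hD.supercell_subcell _ hd
      refine ⟨?_, by rwa [hpar], ?_, fun h => absurd h he, fun _ => hupp⟩
      · rw [hVmem, hupp, hpar]
        exact ⟨h1, h3⟩
      · simp only [rank']
        rw [hupp, hpar]
        omega
  let T' : CellTree :=
    { verts := V
      root := root'
      par := par'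
      rank := rank'
      par_mem := fun c hc hr => (edge c hc hr).1
      rank_par := fun c hc hr => (edge c hc hr).2.2.1
      dist_par := fun c hc hr => hdist _ _ (edge c hc hr).2.1 }
  have hne_root : ∀ w ∈ T.verts, w ≠ T.root → subcell p q w (din w) ≠ root' := by
    intro w hw hr h
    apply hr
    rw [← hsupin w hw, h]
    exact hsupin _ hroot
  refine ⟨T', fun w => subcell p q w (din w), ⟨?_, ?_, ?_, rfl, hroot, ?_, ?_, ?_⟩, ?_, ?_, rfl⟩
  · exact fun c hc => ((hVmem c).1 hc).1
  · exact fun w hw => hVsub w hw _ (hdin w hw)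
  · exact hsupin
  · intro w hw hr
    have := (edge _ (hVsub w hw _ (hdin w hw)) (hne_root w hw hr)).2.2.2.1
    rw [hsupin w hw] at this
    exact this rfl
  · intro c hc hne
    refine (edge c hc ?_).2.2.2.2 hne
    rintro rfl
    apply hne
    rw [hsupin _ hroot]
  · intro w hw
    have : V.filter (fun c => up c = w) = D.image (subcell p q w) := by
      ext c
      rw [Finset.mem_filter, hVmem]
      constructor
      · rintro ⟨⟨-, h2⟩, rfl⟩; exact h2
      · intro h
        obtain ⟨d, hd, rfl⟩ := Finset.mem_image.1 h
        have : up (subcell p q w d) = w := hD.supercell_subcell w hd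
        rw [this]
        exact ⟨⟨hw, h⟩, rfl⟩
    change (V.filter fun c => up c = w).card = _
    rw [this, Finset.card_image_of_injective _ (subcell_injective p q w)]
  · exact hVsub _ hroot _ (hdin _ hroot)
  · exact fun c hc hr => (edge c hc hr).2.1

/-- If adjacency is invariant under translations and passes on to some subcells, and the digits are
connected, then the cells of all levels carry trees of adjacent cells, each refining the preceding
one. -/
theorem exists_trees (hD : IsDigitSet p q D) (hDne : D.Nonempty)
    (hsymm : ∀ x y, adj x y → adj y x) (hdist : ∀ x y, adj x y → dist x y ≤ 1)
    (htrans : ∀ t x y, adj x y → adj (t + x) (t + y))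
    (hconn : ∀ d ∈ D, ∀ d' ∈ D, Relation.ReflTransGen (AdjIn adj D) d d')
    (hsub : ∀ x y, adj x y → ∃ d ∈ D, ∃ d' ∈ D, adj (subcell p q x d) (subcell p q y d')) :
    ∃ (T : ℕ → CellTree) (entry : ℕ → Cell → Cell),
      (∀ i, Refines (T i) (T (i + 1)) (supercell p q) (entry i) D.card) ∧
      (T 0).root = 0 ∧ ∀ i, (T i).verts = cells p q D i := by
  let Good : CellTree → Prop := fun T => T.root ∈ T.verts ∧
    ∀ v ∈ T.verts, v ≠ T.root → adj v (T.par v)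
  have step : ∀ T : {T : CellTree // Good T}, ∃ T' : {T : CellTree // Good T},
      ∃ entry : Cell → Cell, Refines T.1 T'.1 (supercell p q) entry D.card ∧
      T'.1.verts = T.1.verts.biUnion fun w => D.image (subcell p q w) := by
    intro T
    obtain ⟨T', entry, h1, h2, h3, h4⟩ :=
      exists_refinement hD hDne hsymm hdist htrans hconn hsub T.1 T.2.1 T.2.2
    exact ⟨⟨T', h2, h3⟩, entry, h1, h4⟩
  choose next entry hnext hverts using step
  let T₀ : {T : CellTree // Good T} :=
    ⟨{ verts := {0}
       root := 0
       par := id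
       rank := fun _ => 0
       par_mem := fun v hv hr => absurd (Finset.mem_singleton.1 hv) hr
       rank_par := fun v hv hr => absurd (Finset.mem_singleton.1 hv) hr
       dist_par := fun v hv hr => absurd (Finset.mem_singleton.1 hv) hr },
      by simp, fun v hv hr => absurd (Finset.mem_singleton.1 hv) hr⟩
  let S : ℕ → {T : CellTree // Good T} := fun n => Nat.rec T₀ (fun _ T => next T) n
  refine ⟨fun i => (S i).1, fun i => entry (S i), fun i => hnext (S i), rfl, fun i => ?_⟩
  induction i with
  | zero => rfl
  | succ i ih =>
    have := hverts (S i)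
    rw [ih] at this
    exact this

end Refinement

/-! ### The cells of a carpet in the plane -/

/-- The affine map of the unit square onto the cell `w` of the grid of mesh `1 / P` by `1 / Q`. -/
noncomputable def cellMap (P Q : ℝ) (w : Cell) (z : Plane) : Plane :=
  !₂[(w.1 + z 0) / P, (w.2 + z 1) / Q]

@[simp] theorem cellMap_zero (P Q : ℝ) (w : Cell) (z : Plane) :
    cellMap P Q w z 0 = (w.1 + z 0) / P := rfl
@[simp] theorem cellMap_one (P Q : ℝ) (w : Cell) (z : Plane) :
    cellMap P Q w z 1 = (w.2 + z 1) / Q := rfl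

theorem Plane.ext {x y : Plane} (h0 : x 0 = y 0) (h1 : x 1 = y 1) : x = y := by
  ext i
  fin_cases i
  · exact h0
  · exact h1

theorem continuous_cellMap (P Q : ℝ) (w : Cell) : Continuous (cellMap P Q w) := by
  unfold cellMap
  fun_prop

theorem Plane.dist_le (x y : Plane) : dist x y ≤ |x 0 - y 0| + |x 1 - y 1| := by
  rw [EuclideanSpace.dist_eq, Fin.sum_univ_two, Real.dist_eq, Real.dist_eq]
  rw [Real.sqrt_le_left (by positivity)]
  nlinarith [mul_nonneg (abs_nonneg (x 0 - y 0)) (abs_nonneg (x 1 - y 1))]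

theorem Plane.abs_sub_le (x y : Plane) (i : Fin 2) : |x i - y i| ≤ dist x y := by
  rw [EuclideanSpace.dist_eq, ← Real.dist_eq]
  refine Real.le_sqrt_of_sq_le ?_
  exact Finset.single_le_sum (f := fun i => dist (x i) (y i) ^ 2) (fun _ _ => sq_nonneg _)
    (Finset.mem_univ i)

theorem cellMap_comp {p q : ℕ} (hp : 0 < p) (hq : 0 < q) (k : ℕ) (w d : Cell) (z : Plane) :
    cellMap (p ^ k) (q ^ k) w (cellMap p q d z) =
      cellMap (p ^ (k + 1)) (q ^ (k + 1)) (subcell p q w d) z := by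
  have hp' : (p : ℝ) ≠ 0 := by positivity
  have hq' : (q : ℝ) ≠ 0 := by positivity
  refine Plane.ext ?_ ?_
  · simp only [cellMap_zero, subcell]
    push_cast
    field_simp
    ring
  · simp only [cellMap_one, subcell]
    push_cast
    field_simp
    ring

/-- `K` is the union of its images in the cells with digit in `D`. -/
def IsSelfAffine (p q : ℕ) (D : Finset Cell) (K : Set Plane) : Prop :=
  K = ⋃ d ∈ D, cellMap p q d '' K

namespace IsSelfAffine

variable {p q : ℕ} {D : Finset Cell} {K : Set Plane}

theorem mem_iff (hK : IsSelfAffine p q D K) {x : Plane} :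
    x ∈ K ↔ ∃ d ∈ D, ∃ z ∈ K, cellMap p q d z = x := by
  conv_lhs => rw [hK]
  simp

theorem eq_iUnion_cells (hK : IsSelfAffine p q D K) (hp : 0 < p) (hq : 0 < q) (k : ℕ) :
    K = ⋃ w ∈ cells p q D k, cellMap (p ^ k) (q ^ k) w '' K := by
  induction k with
  | zero =>
    have : ∀ z, cellMap 1 1 0 z = z := fun z => Plane.ext (by simp) (by simp)
    simp [cells, this]
  | succ k ih =>
    ext x
    constructor
    · intro hx
      rw [ih] at hx
      simp only [Set.mem_iUnion, Set.mem_image, exists_prop] at hx ⊢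
      obtain ⟨w, hw, y, hy, rfl⟩ := hx
      obtain ⟨d, hd, z, hz, rfl⟩ := hK.mem_iff.1 hy
      exact ⟨subcell p q w d, mem_cells_succ.2 ⟨w, hw, d, hd, rfl⟩, z, hz,
        (cellMap_comp hp hq k w d z).symm⟩
    · intro hx
      rw [ih]
      simp only [Set.mem_iUnion, Set.mem_image, exists_prop] at hx ⊢
      obtain ⟨c, hc, z, hz, rfl⟩ := hx
      obtain ⟨w, hw, d, hd, rfl⟩ := mem_cells_succ.1 hc
      exact ⟨w, hw, cellMap p q d z, hK.mem_iff.2 ⟨d, hd, z, hz, rfl⟩, cellMap_comp hp hq k w d z⟩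

theorem cellMap_mem (hK : IsSelfAffine p q D K) (hp : 0 < p) (hq : 0 < q) {k : ℕ} {w : Cell}
    (hw : w ∈ cells p q D k) {z : Plane} (hz : z ∈ K) : cellMap (p ^ k) (q ^ k) w z ∈ K := by
  rw [hK.eq_iUnion_cells hp hq k]
  exact Set.mem_biUnion hw (Set.mem_image_of_mem _ hz)

theorem subset_unitSquare (hK : IsSelfAffine p q D K) (hD : IsDigitSet p q D) (hc : IsCompact K)
    (hp : 2 ≤ p) (hq : 2 ≤ q) : K ⊆ unitSquare := by
  intro x hx
  have hp' : (2 : ℝ) ≤ p := by exact_mod_cast hp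
  have hq' : (2 : ℝ) ≤ q := by exact_mod_cast hq
  have hne : K.Nonempty := ⟨x, hx⟩
  -- the extremal values of a coordinate are those of a point of the form `(d + z) / n`
  have key : ∀ (i : Fin 2) (n : ℝ), 2 ≤ n →
      (∀ y ∈ K, ∃ e : ℝ, 0 ≤ e ∧ e ≤ n - 1 ∧ ∃ z ∈ K, y i = (e + z i) / n) →
      x i ∈ Set.Icc (0 : ℝ) 1 := by
    intro i n hn h
    have hcont : ContinuousOn (fun y : Plane => y i) K := by fun_prop
    constructor
    · obtain ⟨y, hy, hmin⟩ := hc.exists_isMinOn hne hcont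
      obtain ⟨e, he0, -, z, hz, hyz⟩ := h y hy
      have h1 : y i ≤ z i := hmin hz
      have h2 : y i ≤ x i := hmin hx
      rw [eq_div_iff (by positivity)] at hyz
      nlinarith
    · obtain ⟨y, hy, hmax⟩ := hc.exists_isMaxOn hne hcont
      obtain ⟨e, -, he1, z, hz, hyz⟩ := h y hy
      have h1 : z i ≤ y i := hmax hz
      have h2 : x i ≤ y i := hmax hx
      rw [eq_div_iff (by positivity)] at hyz
      nlinarith
  constructor
  · refine key 0 p hp' fun y hy => ?_
    obtain ⟨d, hd, z, hz, rfl⟩ := hK.mem_iff.1 hy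
    obtain ⟨h1, h2, -, -⟩ := hD d hd
    refine ⟨d.1, by exact_mod_cast h1, ?_, z, hz, by simp⟩
    have : d.1 + 1 ≤ (p : ℤ) := h2
    have : (d.1 : ℝ) + 1 ≤ p := by exact_mod_cast this
    linarith
  · refine key 1 q hq' fun y hy => ?_
    obtain ⟨d, hd, z, hz, rfl⟩ := hK.mem_iff.1 hy
    obtain ⟨-, -, h1, h2⟩ := hD d hd
    refine ⟨d.2, by exact_mod_cast h1, ?_, z, hz, by simp⟩
    have : d.2 + 1 ≤ (q : ℤ) := h2
    have : (d.2 : ℝ) + 1 ≤ q := by exact_mod_cast this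
    linarith

end IsSelfAffine

/-- The copies of `K` in the cells `u` and `v` meet. This does not depend on the mesh of the
grid. -/
def Touch (K : Set Plane) (u v : Cell) : Prop :=
  ∃ z ∈ K, ∃ z' ∈ K, u.1 + z 0 = v.1 + z' 0 ∧ u.2 + z 1 = v.2 + z' 1

namespace Touch

variable {K : Set Plane}

theorem symm {u v : Cell} (h : Touch K u v) : Touch K v u := by
  obtain ⟨z, hz, z', hz', h1, h2⟩ := h
  exact ⟨z', hz', z, hz, h1.symm, h2.symm⟩

theorem translate (t : Cell) {u v : Cell} (h : Touch K u v) : Touch K (t + u) (t + v) := by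
  obtain ⟨z, hz, z', hz', h1, h2⟩ := h
  refine ⟨z, hz, z', hz', ?_, ?_⟩
  · push_cast [Prod.fst_add]; linarith
  · push_cast [Prod.snd_add]; linarith

theorem dist_le {u v : Cell} (hK : K ⊆ unitSquare) (h : Touch K u v) : dist u v ≤ 1 := by
  obtain ⟨z, hz, z', hz', h1, h2⟩ := h
  obtain ⟨⟨a1, a2⟩, a3, a4⟩ := hK hz
  obtain ⟨⟨b1, b2⟩, b3, b4⟩ := hK hz'
  rw [Prod.dist_eq, max_le_iff, Int.dist_eq, Int.dist_eq, abs_le, abs_le]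
  refine ⟨⟨?_, ?_⟩, ?_, ?_⟩ <;> linarith

theorem subcell {p q : ℕ} {D : Finset Cell} (hp : 0 < p) (hq : 0 < q) (hK : IsSelfAffine p q D K)
    {u v : Cell} (h : Touch K u v) :
    ∃ d ∈ D, ∃ d' ∈ D, Touch K (subcell p q u d) (subcell p q v d') := by
  obtain ⟨z, hz, z', hz', h1, h2⟩ := h
  obtain ⟨d, hd, y, hy, rfl⟩ := hK.mem_iff.1 hz
  obtain ⟨d', hd', y', hy', rfl⟩ := hK.mem_iff.1 hz'
  refine ⟨d, hd, d', hd', y, hy, y', hy', ?_, ?_⟩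
  · simp only [cellMap_zero] at h1
    simp only [HolderCarpet.subcell]
    push_cast
    have hp' : (p : ℝ) ≠ 0 := by positivity
    field_simp at h1
    linarith
  · simp only [cellMap_one] at h2
    simp only [HolderCarpet.subcell]
    push_cast
    have hq' : (q : ℝ) ≠ 0 := by positivity
    field_simp at h2
    linarith

/-- If `K` is connected, so is the graph of its cells of the first level. -/
theorem connected {p q : ℕ} {D : Finset Cell} (hp : 0 < p) (hq : 0 < q)
    (hK : IsSelfAffine p q D K) (hc : IsCompact K) (hconn : IsConnected K) :
    ∀ d ∈ D, ∀ d' ∈ D, Relation.ReflTransGen (AdjIn (Touch K) D) d d' := by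
  classical
  intro d hd d' hd'
  by_contra hnot
  set A := D.filter fun x => Relation.ReflTransGen (AdjIn (Touch K) D) d x with hA
  set B := D.filter fun x => ¬ Relation.ReflTransGen (AdjIn (Touch K) D) d x with hB
  have closed : ∀ S : Finset Cell, IsClosed (⋃ x ∈ S, cellMap p q x '' K) := fun S =>
    S.finite_toSet.isClosed_biUnion fun x _ => (hc.image (continuous_cellMap _ _ _)).isClosed
  have hsub : K ⊆ (⋃ x ∈ A, cellMap p q x '' K) ∪ ⋃ x ∈ B, cellMap p q x '' K := by
    intro x hx
    obtain ⟨y, hy, z, hz, rfl⟩ := hK.mem_iff.1 hx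
    by_cases h : Relation.ReflTransGen (AdjIn (Touch K) D) d y
    · exact .inl (Set.mem_biUnion (Finset.mem_filter.2 ⟨hy, h⟩) (Set.mem_image_of_mem _ hz))
    · exact .inr (Set.mem_biUnion (Finset.mem_filter.2 ⟨hy, h⟩) (Set.mem_image_of_mem _ hz))
  have inter : ∀ S : Finset Cell, S ⊆ D → S.Nonempty →
      (K ∩ ⋃ x ∈ S, cellMap p q x '' K).Nonempty := by
    rintro S hS ⟨x, hx⟩
    obtain ⟨z, hz⟩ := hconn.nonempty
    exact ⟨cellMap p q x z, hK.mem_iff.2 ⟨x, hS hx, z, hz, rfl⟩,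
      Set.mem_biUnion hx (Set.mem_image_of_mem _ hz)⟩
  obtain ⟨x, -, hxA, hxB⟩ := isPreconnected_closed_iff.1 hconn.isPreconnected _ _ (closed A)
    (closed B) hsub (inter A (Finset.filter_subset _ _) ⟨d, Finset.mem_filter.2 ⟨hd, .refl⟩⟩)
    (inter B (Finset.filter_subset _ _) ⟨d', Finset.mem_filter.2 ⟨hd', hnot⟩⟩)
  simp only [Set.mem_iUnion, Set.mem_image, exists_prop] at hxA hxB
  obtain ⟨a, ha, z, hz, rfl⟩ := hxA
  obtain ⟨b, hb, z', hz', h⟩ := hxB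
  obtain ⟨ha, ha'⟩ := Finset.mem_filter.1 ha
  obtain ⟨hb, hb'⟩ := Finset.mem_filter.1 hb
  refine hb' (ha'.tail ⟨ha, hb, z, hz, z', hz', ?_, ?_⟩)
  · have := congrFun (congrArg WithLp.ofLp h) 0
    have hp' : (p : ℝ) ≠ 0 := by positivity
    change cellMap p q b z' 0 = cellMap p q a z 0 at this
    simp only [cellMap_zero] at this
    field_simp at this
    exact this.symm
  · have := congrFun (congrArg WithLp.ofLp h) 1
    have hq' : (q : ℝ) ≠ 0 := by positivity
    change cellMap p q b z' 1 = cellMap p q a z 1 at this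
    simp only [cellMap_one] at this
    field_simp at this
    exact this.symm

end Touch

/-! ### Traversals of a carpet -/

section Traversal

variable {p q : ℕ} {D : Finset Cell} {K : Set Plane}

/-- A point of a cell of level `i + h` lies in the cell of level `i` that contains this cell. -/
theorem exists_cellMap_eq (hK : IsSelfAffine p q D K) (hD : IsDigitSet p q D) (hp : 0 < p)
    (hq : 0 < q) {i h : ℕ} {v : Cell} (hv : v ∈ cells p q D (i + h)) {z : Plane} (hz : z ∈ K) :
    ∃ y ∈ K, cellMap (p ^ i) (q ^ i) ((supercell p q)^[h] v) y =
      cellMap (p ^ (i + h)) (q ^ (i + h)) v z := by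
  induction h generalizing v z with
  | zero => exact ⟨z, hz, rfl⟩
  | succ h ih =>
    obtain ⟨w, hw, d, hd, rfl⟩ := mem_cells_succ.1 (show v ∈ cells p q D ((i + h) + 1) from hv)
    obtain ⟨y, hy, h1⟩ := ih hw (z := cellMap p q d z) (hK.mem_iff.2 ⟨d, hd, z, hz, rfl⟩)
    refine ⟨y, hy, ?_⟩
    rw [Function.iterate_succ_apply, hD.supercell_subcell w hd, h1, cellMap_comp hp hq]
    rfl

theorem dist_cellMap_le (hK : K ⊆ unitSquare) {P Q : ℝ} (hP : 0 < P) (hPQ : P ≤ Q) {u v : Cell}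
    {y z : Plane} (hy : y ∈ K) (hz : z ∈ K) {n : ℝ} (h : dist u v ≤ n) :
    dist (cellMap P Q u y) (cellMap P Q v z) ≤ 2 * (n + 1) / P := by
  obtain ⟨⟨a1, a2⟩, a3, a4⟩ := hK hy
  obtain ⟨⟨b1, b2⟩, b3, b4⟩ := hK hz
  rw [Prod.dist_eq, max_le_iff, Int.dist_eq, Int.dist_eq, abs_le, abs_le] at h
  obtain ⟨⟨h1, h2⟩, h3, h4⟩ := h
  have hQ : 0 < Q := hP.trans_le hPQ
  have hn : 0 ≤ n + 1 := by linarith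
  refine (Plane.dist_le _ _).trans ?_
  simp only [cellMap_zero, cellMap_one]
  rw [← sub_div, ← sub_div, abs_div, abs_div, abs_of_pos hP, abs_of_pos hQ]
  have e1 : |(u.1 : ℝ) + y 0 - (v.1 + z 0)| ≤ n + 1 := by
    rw [abs_le]; constructor <;> linarith
  have e2 : |(u.2 : ℝ) + y 1 - (v.2 + z 1)| ≤ n + 1 := by
    rw [abs_le]; constructor <;> linarith
  have e3 : |(u.2 : ℝ) + y 1 - (v.2 + z 1)| / Q ≤ (n + 1) / P :=
    div_le_div₀ hn e2 hP hPQ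
  have e4 : |(u.1 : ℝ) + y 0 - (v.1 + z 0)| / P ≤ (n + 1) / P :=
    div_le_div_of_nonneg_right e1 hP.le
  calc _ ≤ (n + 1) / P + (n + 1) / P := add_le_add e4 e3
    _ = 2 * (n + 1) / P := by ring

/-- For each `k`, a connected carpet has a finite sequence of points of length comparable with
`N ^ k`, that comes close to each point of the carpet and moves slowly at all scales. -/
theorem exists_slow_sequence (hK : IsSelfAffine p q D K) (hD : IsDigitSet p q D)
    (hc : IsCompact K) (hconn : IsConnected K) (hp : 209 ≤ p) (hpq : p ≤ q) (k : ℕ) :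
    ∃ (L : ℕ) (g : ℕ → Plane), D.card ^ k ≤ L ∧ L ≤ 10 * D.card ^ k ∧ (∀ n, g n ∈ K) ∧
      (∀ x ∈ K, ∃ n < L, dist (g n) x ≤ 2 / (p : ℝ) ^ k) ∧
      ∀ i h, i + (h + 1) = k → ∀ m n, m ≤ n → n < L → 2 * (n - m) < D.card ^ h →
        dist (g m) (g n) ≤ 46 / (p : ℝ) ^ i := by
  have hp0 : 0 < p := by omega
  have hq0 : 0 < q := by omega
  have hpR : (1 : ℝ) ≤ p := by exact_mod_cast hp0
  have hsq := hK.subset_unitSquare hD hc (by omega) (by omega)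
  obtain ⟨z₀, hz₀⟩ := hconn.nonempty
  have hDne : D.Nonempty := by
    obtain ⟨d, hd, -⟩ := hK.mem_iff.1 hz₀
    exact ⟨d, hd⟩
  obtain ⟨T, entry, hR, hroot, hverts⟩ := exists_trees (adj := Touch K) hD hDne
    (fun _ _ => Touch.symm) (fun _ _ h => h.dist_le hsq) (fun t _ _ h => h.translate t)
    (Touch.connected hp0 hq0 hK hc hconn) (fun _ _ h => h.subcell hp0 hq0 hK)
  obtain ⟨l, h1, h2, h3, h4⟩ := exists_traversal hR (Finset.card_pos.2 hDne)
    (fun u v h => dist_supercell_le (p := p) (q := q) (n := 209) (by norm_num) hp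
      (hp.trans hpq) (by exact_mod_cast h)) (by rw [hverts, hroot]; rfl) k
  have hmem : ∀ n (hn : n < l.length), l[n] ∈ cells p q D k := fun n hn => by
    rw [← hverts]
    exact (h1 _).1 (List.getElem_mem _)
  have hpow : ∀ j : ℕ, (p : ℝ) ^ j ≤ (q : ℝ) ^ j := fun j =>
    pow_le_pow_left₀ (by positivity) (by exact_mod_cast hpq) j
  let g : ℕ → Plane := fun n =>
    if hn : n < l.length then cellMap (p ^ k) (q ^ k) l[n] z₀ else z₀
  have hg : ∀ n (hn : n < l.length), g n = cellMap (p ^ k) (q ^ k) l[n] z₀ := fun n hn =>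
    dif_pos hn
  refine ⟨l.length, g, h2, h3, ?_, ?_, ?_⟩
  · intro n
    by_cases hn : n < l.length
    · rw [hg n hn]
      exact hK.cellMap_mem hp0 hq0 (hmem n hn) hz₀
    · simp only [g, dif_neg hn]
      exact hz₀
  · intro x hx
    rw [hK.eq_iUnion_cells hp0 hq0 k] at hx
    simp only [Set.mem_iUnion, Set.mem_image, exists_prop] at hx
    obtain ⟨w, hw, z, hz, rfl⟩ := hx
    rw [← hverts, ← h1] at hw
    obtain ⟨n, hn, rfl⟩ := List.getElem_of_mem hw
    refine ⟨n, hn, ?_⟩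
    rw [hg n hn]
    have := dist_cellMap_le hsq (pow_pos (by positivity) k) (hpow k) hz₀ hz
      (dist_self l[n]).le
    simpa using this
  · rintro i h rfl m n hmn hn hlt
    have hm : m < l.length := hmn.trans_lt hn
    rw [hg m hm, hg n hn]
    obtain ⟨y, hy, hy'⟩ := exists_cellMap_eq hK hD hp0 hq0 (hmem m hm) hz₀
    obtain ⟨z, hz, hz'⟩ := exists_cellMap_eq hK hD hp0 hq0 (hmem n hn) hz₀
    rw [← hy', ← hz']
    have := dist_cellMap_le hsq (pow_pos (by positivity) i) (hpow i) hy hz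
      (h4 h (by omega) m n hmn hn hlt)
    exact this.trans (le_of_eq (by norm_num))

end Traversal

/-! ### Hölder curves from slow sequences -/

theorem continuous_of_holder {X : Type*} [MetricSpace X] {f : unitInterval → X} {H β : ℝ}
    (hβ : 0 < β) (h : ∀ x y : unitInterval, dist (f x) (f y) ≤ H * |(x : ℝ) - y| ^ β) :
    Continuous f := by
  refine continuous_iff_continuousAt.2 fun x => ?_
  rw [ContinuousAt, tendsto_iff_dist_tendsto_zero]
  refine squeeze_zero (fun _ => dist_nonneg) (fun y => h y x) ?_
  have h1 : Continuous fun y : unitInterval => H * |(y : ℝ) - x| ^ β :=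
    continuous_const.mul (Continuous.rpow_const (by fun_prop) fun _ => .inr hβ.le)
  have h2 := h1.tendsto x
  rw [sub_self, abs_zero, Real.zero_rpow hβ.ne', mul_zero] at h2
  exact h2

/-- If for each `k` there is a sequence of about `N ^ k` points of the compact set `K`, which comes
close to each point of `K` and needs about `N ^ (k - i)` steps to travel a distance of about
`r ^ (-i)`, then a limit of these sequences along an ultrafilter is a Hölder curve. -/
theorem isHolderCurve_of_slow_sequences {X : Type*} [MetricSpace X] {K : Set X} (hc : IsCompact K)
    {N : ℕ} (hN : 2 ≤ N) {r β C : ℝ} (hr : 1 < r) (hβ : 0 < β) (hrβ : r = (N : ℝ) ^ β)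
    (hC : ∀ x ∈ K, ∀ y ∈ K, dist x y ≤ C)
    (h : ∀ k, ∃ (L : ℕ) (g : ℕ → X), N ^ k ≤ L ∧ L ≤ 10 * N ^ k ∧ (∀ n, g n ∈ K) ∧
      (∀ x ∈ K, ∃ n < L, dist (g n) x ≤ C / r ^ k) ∧
      ∀ i h, i + (h + 1) = k → ∀ m n, m ≤ n → n < L → 2 * (n - m) < N ^ h →
        dist (g m) (g n) ≤ C / r ^ i) : IsHolderCurve β K := by
  choose L g hL1 hL2 hgK hgdense hgslow using h
  have hNR : (2 : ℝ) ≤ N := by exact_mod_cast hN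
  have hr0 : (0 : ℝ) < r := by linarith
  have hLpos : ∀ k, 0 < L k := fun k => (pow_pos (by omega) k).trans_le (hL1 k)
  have hC0 : 0 ≤ C := by
    have h1 := hC _ (hgK 0 0) _ (hgK 0 0)
    rwa [dist_self] at h1
  have slow : ∀ (τ : ℝ) (i : ℕ), 0 ≤ τ → 40 * τ * N ^ (i + 1) < 1 → ∀ᶠ k in atTop,
      ∀ m < L k, ∀ n < L k, |(m : ℝ) - n| ≤ τ * L k + 2 → dist (g k m) (g k n) ≤ C / r ^ i := by
    intro τ i hτ hlt
    filter_upwards [eventually_ge_atTop (i + 1 + 4)] with k hk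
    obtain ⟨h, rfl⟩ : ∃ h, k = i + (h + 1) := ⟨k - i - 1, by omega⟩
    have hN16 : (16 : ℝ) ≤ (N : ℝ) ^ h := by
      calc (16 : ℝ) = 2 ^ 4 := by norm_num
        _ ≤ 2 ^ h := pow_le_pow_right₀ (by norm_num) (by omega)
        _ ≤ (N : ℝ) ^ h := pow_le_pow_left₀ (by norm_num) hNR h
    have hL : (L (i + (h + 1)) : ℝ) ≤ 10 * (N ^ (i + 1) * N ^ h) := by
      have := hL2 (i + (h + 1))
      have e : (L (i + (h + 1)) : ℝ) ≤ 10 * (N : ℝ) ^ (i + (h + 1)) := by exact_mod_cast this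
      refine e.trans (le_of_eq ?_)
      rw [← pow_add]
      congr 2
      ring
    have key : ∀ m n : ℕ, m ≤ n → |(m : ℝ) - n| ≤ τ * L (i + (h + 1)) + 2 →
        2 * (n - m) < N ^ h := by
      intro m n hmn hd
      have e : ((2 * (n - m) : ℕ) : ℝ) < ((N ^ h : ℕ) : ℝ) := by
        push_cast [Nat.cast_sub hmn]
        rw [abs_sub_comm, abs_of_nonneg (sub_nonneg.2 (by exact_mod_cast hmn))] at hd
        have h1 : τ * L (i + (h + 1)) ≤ τ * (10 * (N ^ (i + 1) * N ^ h)) :=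
          mul_le_mul_of_nonneg_left hL hτ
        have h2 : 40 * τ * N ^ (i + 1) * N ^ h < 1 * (N : ℝ) ^ h :=
          mul_lt_mul_of_pos_right hlt (by positivity)
        nlinarith
      exact_mod_cast e
    intro m hm n hn hd
    rcases le_total m n with hmn | hmn
    · exact hgslow _ i h rfl m n hmn hn (key m n hmn hd)
    · rw [dist_comm]
      exact hgslow _ i h rfl n m hmn hm (key n m hmn (by rwa [abs_sub_comm]))
  -- the position in the `k`-th sequence at the time `t`
  let idx : ℕ → ℝ → ℕ := fun k t => min ⌊t * L k⌋₊ (L k - 1)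
  have idx_lt : ∀ k t, idx k t < L k := fun k t => by
    have h1 := hLpos k
    have h2 : idx k t ≤ L k - 1 := min_le_right _ _
    omega
  have idx_near : ∀ k t, t ∈ Set.Icc (0 : ℝ) 1 → |(idx k t : ℝ) - t * L k| ≤ 1 := by
    rintro k t ⟨h0, h1⟩
    have hLk : (1 : ℝ) ≤ L k := by exact_mod_cast hLpos k
    have h2 : 0 ≤ t * L k := by positivity
    have h3 : t * L k ≤ L k := by nlinarith
    have h4 := Nat.floor_le h2
    have h5 := Nat.lt_floor_add_one (t * L k)
    have h6 : ((L k - 1 : ℕ) : ℝ) = L k - 1 := by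
      rw [Nat.cast_sub (hLpos k), Nat.cast_one]
    have h7 : (idx k t : ℝ) = min (⌊t * L k⌋₊ : ℝ) (L k - 1) := by
      rw [← h6]
      exact Nat.cast_min _ _
    rw [h7, abs_le]
    rcases min_cases (⌊t * L k⌋₊ : ℝ) (L k - 1) with ⟨e, h8⟩ | ⟨e, h8⟩ <;> rw [e] <;>
      constructor <;> linarith
  set U : Ultrafilter ℕ := hyperfilter ℕ with hU
  have hUtop : (U : Filter ℕ) ≤ atTop := Nat.hyperfilter_le_atTop
  have lim : ∀ t : unitInterval, ∃ x ∈ K, Tendsto (fun k => g k (idx k t)) U (𝓝 x) := by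
    intro t
    obtain ⟨x, hx, hle⟩ := hc.ultrafilter_le_nhds (U.map fun k => g k (idx k t))
      (le_principal_iff.2 (Ultrafilter.mem_coe.2
        (Ultrafilter.mem_map.2 (univ_mem' fun k => hgK k _))))
    exact ⟨x, hx, hle⟩
  choose f hfK hf using lim
  have hfdist : ∀ (t u : unitInterval) (i : ℕ), 40 * |(t : ℝ) - u| * N ^ (i + 1) < 1 →
      dist (f t) (f u) ≤ C / r ^ i := by
    intro t u i hlt
    refine le_of_tendsto ((hf t).dist (hf u)) ?_
    filter_upwards [hUtop (slow _ i (abs_nonneg _) hlt)] with k hk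
    refine hk _ (idx_lt k t) _ (idx_lt k u) ?_
    have h1 := idx_near k t t.2
    have h2 := idx_near k u u.2
    have e : ((idx k t : ℝ) - idx k u) = ((idx k t : ℝ) - t * L k) + (t - u) * L k +
        -((idx k u : ℝ) - u * L k) := by ring
    rw [e]
    refine (abs_add_three _ _ _).trans ?_
    rw [abs_neg, abs_mul, Nat.abs_cast]
    linarith
  have hpow : ∀ i : ℕ, 1 / r ^ i = ((N : ℝ) ^ i)⁻¹ ^ β := by
    intro i
    rw [hrβ, one_div, ← Real.rpow_natCast, ← Real.rpow_mul (by positivity), mul_comm,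
      Real.rpow_mul (by positivity), Real.rpow_natCast, Real.inv_rpow (by positivity)]
  have hholder : ∀ t u : unitInterval,
      dist (f t) (f u) ≤ C * (40 * (N : ℝ) ^ 2) ^ β * |(t : ℝ) - u| ^ β := by
    intro t u
    rcases eq_or_ne t u with rfl | hne
    · rw [dist_self]; positivity
    have hτ : 0 < |(t : ℝ) - u| := abs_pos.2 (sub_ne_zero.2 fun h => hne (Subtype.ext h))
    set τ := |(t : ℝ) - u| with hτdef
    have hex : ∃ i : ℕ, 1 ≤ 40 * τ * (N : ℝ) ^ (i + 1) := by
      obtain ⟨n, hn⟩ := pow_unbounded_of_one_lt (1 / (40 * τ)) (show (1 : ℝ) < N by linarith)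
      refine ⟨n, ?_⟩
      rw [div_lt_iff₀ (by positivity)] at hn
      have : (N : ℝ) ^ n ≤ (N : ℝ) ^ (n + 1) := pow_le_pow_right₀ (by linarith) (by omega)
      nlinarith
    classical
    have hspec := Nat.find_spec hex
    have hmin := fun m => Nat.find_min hex (m := m)
    rw [mul_assoc, ← Real.mul_rpow (by positivity) hτ.le]
    rcases hi : Nat.find hex with _ | j
    · rw [hi] at hspec
      refine (hC _ (hfK t) _ (hfK u)).trans ?_
      refine le_mul_of_one_le_right hC0 (Real.one_le_rpow ?_ hβ.le)
      calc (1 : ℝ) ≤ 40 * τ * (N : ℝ) ^ (0 + 1) := hspec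
        _ ≤ 40 * τ * (N : ℝ) ^ 2 := mul_le_mul_of_nonneg_left
          (pow_le_pow_right₀ (by linarith) (by norm_num)) (by positivity)
        _ = _ := by ring
    · rw [hi] at hspec
      have h1 := hfdist t u j (not_le.1 (hmin j (by omega)))
      refine h1.trans ?_
      rw [div_eq_mul_one_div, hpow]
      refine mul_le_mul_of_nonneg_left ?_ hC0
      refine Real.rpow_le_rpow (by positivity) ?_ hβ.le
      rw [inv_le_iff_one_le_mul₀ (by positivity)]
      calc (1 : ℝ) ≤ 40 * τ * (N : ℝ) ^ (j + 1 + 1) := hspec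
        _ = _ := by ring
  refine ⟨f, continuous_of_holder hβ hholder, ?_, _, hholder⟩
  refine Set.Subset.antisymm (Set.range_subset_iff.2 hfK) fun x hx => ?_
  choose a ha hax using fun k => hgdense k x hx
  -- the times at which the sequences come close to `x`
  let s : ℕ → unitInterval := fun k => ⟨(a k : ℝ) / L k, by positivity, by
    rw [div_le_one (by exact_mod_cast hLpos k)]
    exact_mod_cast (ha k).le⟩
  obtain ⟨t, -, ht⟩ := isCompact_univ.ultrafilter_le_nhds (U.map s) (by simp)
  have ht' : Tendsto s U (𝓝 t) := ht
  refine ⟨t, ?_⟩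
  have hsmall : ∀ i : ℕ, dist (f t) x ≤ 2 * C / r ^ i := by
    intro i
    set δ : ℝ := 1 / (80 * N ^ (i + 1)) with hδ
    have hδ0 : 0 < δ := by positivity
    have hlt : 40 * δ * (N : ℝ) ^ (i + 1) < 1 := by
      have : 40 * δ * (N : ℝ) ^ (i + 1) = 1 / 2 := by
        rw [hδ]; field_simp; norm_num
      rw [this]; norm_num
    have hclose : ∀ᶠ k in (U : Filter ℕ), |(s k : ℝ) - t| < δ := by
      have h1 : Tendsto (fun k => (s k : ℝ)) U (𝓝 (t : ℝ)) :=
        (continuous_subtype_val.tendsto t).comp ht'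
      have := Metric.tendsto_nhds.1 h1 δ hδ0
      simpa [Real.dist_eq] using this
    refine le_of_tendsto ((hf t).dist tendsto_const_nhds) ?_
    filter_upwards [hUtop (slow δ i hδ0.le hlt), hclose, hUtop (eventually_ge_atTop i)]
      with k hk1 hk2 hk3
    have hLk : (0 : ℝ) < L k := by exact_mod_cast hLpos k
    have h1 := idx_near k t t.2
    have h2 : (a k : ℝ) = s k * L k := by
      change (a k : ℝ) = (a k : ℝ) / L k * L k
      field_simp
    have h3 : dist (g k (idx k t)) (g k (a k)) ≤ C / r ^ i := by
      refine hk1 _ (idx_lt k t) _ (ha k) ?_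
      have e : ((idx k t : ℝ) - a k) = ((idx k t : ℝ) - t * L k) + (t - s k) * L k := by
        rw [h2]; ring
      rw [e]
      refine (abs_add_le _ _).trans ?_
      rw [abs_mul, Nat.abs_cast, abs_sub_comm (t : ℝ)]
      have := mul_le_mul_of_nonneg_right hk2.le hLk.le
      linarith
    have h4 : C / r ^ k ≤ C / r ^ i :=
      div_le_div_of_nonneg_left hC0 (by positivity) (pow_le_pow_right₀ hr.le hk3)
    calc dist (g k (idx k t)) x ≤ dist (g k (idx k t)) (g k (a k)) + dist (g k (a k)) x :=
          dist_triangle _ _ _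
      _ ≤ C / r ^ i + C / r ^ i := add_le_add h3 ((hax k).trans h4)
      _ = 2 * C / r ^ i := by ring
  have hzero : Tendsto (fun i : ℕ => 2 * C / r ^ i) atTop (𝓝 0) := by
    have := (tendsto_pow_atTop_nhds_zero_of_lt_one (r := r⁻¹) (by positivity)
      (inv_lt_one_of_one_lt₀ hr)).const_mul (2 * C)
    simpa [div_eq_mul_inv] using this
  exact dist_le_zero.1 (ge_of_tendsto' hzero hsmall)

section Existence

variable {p q : ℕ} {D : Finset Cell} {K : Set Plane}

theorem isDigitSet_cells (hD : IsDigitSet p q D) (hp : 0 < p) (hq : 0 < q) (m : ℕ) :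
    IsDigitSet (p ^ m) (q ^ m) (cells p q D m) := by
  induction m with
  | zero =>
    intro d hd
    rw [cells, Finset.mem_singleton] at hd
    subst hd
    simp
  | succ m ih =>
    intro c hc
    obtain ⟨w, hw, d, hd, rfl⟩ := mem_cells_succ.1 hc
    obtain ⟨a1, a2, a3, a4⟩ := ih w hw
    obtain ⟨b1, b2, b3, b4⟩ := hD d hd
    have hp' : (0 : ℤ) < p := by exact_mod_cast hp
    have hq' : (0 : ℤ) < q := by exact_mod_cast hq
    push_cast at a2 a4 ⊢
    simp only [subcell, pow_succ]
    have a2' : w.1 + 1 ≤ (p : ℤ) ^ m := a2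
    have a4' : w.2 + 1 ≤ (q : ℤ) ^ m := a4
    refine ⟨by positivity, ?_, by positivity, ?_⟩ <;> nlinarith

theorem card_cells (hD : IsDigitSet p q D) (m : ℕ) : (cells p q D m).card = D.card ^ m := by
  induction m with
  | zero => simp [cells]
  | succ m ih =>
    rw [cells, Finset.card_biUnion, Finset.sum_congr rfl fun w _ =>
      Finset.card_image_of_injective D (subcell_injective p q w), Finset.sum_const, ih,
      smul_eq_mul, pow_succ]
    intro v _ w _ hvw
    rw [Function.onFun, Finset.disjoint_left]
    intro c hc hc'
    obtain ⟨d, hd, rfl⟩ := Finset.mem_image.1 hc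
    obtain ⟨d', hd', h⟩ := Finset.mem_image.1 hc'
    apply hvw
    rw [← hD.supercell_subcell v hd, ← h, hD.supercell_subcell w hd']

/-- A connected carpet made of `N ≥ 2` pieces of width `1 / p` is a `1 / s`-Hölder curve with
`s = log N / log p`. -/
theorem IsSelfAffine.isHolderCurve (hK : IsSelfAffine p q D K) (hD : IsDigitSet p q D)
    (hc : IsCompact K) (hconn : IsConnected K) (hp : 2 ≤ p) (hpq : p ≤ q) (hN : 2 ≤ D.card) :
    IsHolderCurve (1 / Real.logb p D.card) K := by
  have hp0 : 0 < p := by omega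
  have hq0 : 0 < q := by omega
  have hpR : (2 : ℝ) ≤ p := by exact_mod_cast hp
  have hNR : (2 : ℝ) ≤ D.card := by exact_mod_cast hN
  have hs : 0 < Real.logb p D.card := Real.logb_pos (by linarith) (by linarith)
  -- eight levels of the carpet are taken as one level, so that the cells become small enough
  have hp8 : 209 ≤ p ^ 8 := (by norm_num : 209 ≤ 2 ^ 8).trans (Nat.pow_le_pow_left hp 8)
  have hK' : IsSelfAffine (p ^ 8) (q ^ 8) (cells p q D 8) K := by
    have := hK.eq_iUnion_cells hp0 hq0 8
    unfold IsSelfAffine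
    push_cast
    exact this
  have hD' := isDigitSet_cells hD hp0 hq0 8
  have hsq := hK.subset_unitSquare hD hc hp (hp.trans hpq)
  refine isHolderCurve_of_slow_sequences hc (N := (cells p q D 8).card) (r := ((p ^ 8 : ℕ) : ℝ))
    (C := 46) ?_ ?_ (by positivity) ?_ ?_ fun k => ?_
  · rw [card_cells hD]
    exact (by norm_num : 2 ≤ 2 ^ 8).trans (Nat.pow_le_pow_left hN 8)
  · have : 1 < p ^ 8 := by omega
    exact_mod_cast this
  · rw [card_cells hD]
    push_cast
    rw [← Real.rpow_natCast, ← Real.rpow_natCast, ← Real.rpow_mul (by positivity), mul_comm,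
      Real.rpow_mul (by positivity), Real.logb, one_div_div, ← Real.logb,
      Real.rpow_logb (by linarith) (by linarith) (by linarith)]
  · intro x hx y hy
    obtain ⟨⟨a1, a2⟩, a3, a4⟩ := hsq hx
    obtain ⟨⟨b1, b2⟩, b3, b4⟩ := hsq hy
    have e1 : |x 0 - y 0| ≤ 1 := by rw [abs_le]; constructor <;> linarith
    have e2 : |x 1 - y 1| ≤ 1 := by rw [abs_le]; constructor <;> linarith
    linarith [Plane.dist_le x y]
  · obtain ⟨L, g, h1, h2, h3, h4, h5⟩ :=
      exists_slow_sequence hK' hD' hc hconn hp8 (Nat.pow_le_pow_left hpq 8) k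
    refine ⟨L, g, h1, h2, h3, fun x hx => ?_, h5⟩
    obtain ⟨n, hn, hle⟩ := h4 x hx
    exact ⟨n, hn, hle.trans (by gcongr; norm_num)⟩

end Existence

/-! ### Upper bounds for Hölder exponents -/

theorem card_le_of_separated {ι : Type*} {S : Finset ι} {t : ι → unitInterval} {η : ℝ}
    (hη : 0 < η) (h : ∀ a ∈ S, ∀ b ∈ S, a ≠ b → η ≤ |(t a : ℝ) - t b|) :
    (S.card : ℝ) ≤ 1 + 1 / η := by
  have hmaps : ∀ a ∈ S, ⌊(t a : ℝ) / η⌋₊ ∈ Finset.range (⌊1 / η⌋₊ + 1) := fun a _ => by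
    rw [Finset.mem_range, Nat.lt_succ_iff]
    exact Nat.floor_le_floor (div_le_div_of_nonneg_right (t a).2.2 hη.le)
  have hinj : Set.InjOn (fun a => ⌊(t a : ℝ) / η⌋₊) S := by
    intro a ha b hb hab
    by_contra hne
    have h1 := h a ha b hb hne
    have h2 : |(t a : ℝ) / η - t b / η| < 1 := Int.abs_sub_lt_one_of_floor_eq_floor <| by
      rw [← Int.natCast_floor_eq_floor (div_nonneg (t a).2.1 hη.le),
        ← Int.natCast_floor_eq_floor (div_nonneg (t b).2.1 hη.le)]
      exact congrArg _ hab
    rw [← sub_div, abs_div, abs_of_pos hη, div_lt_one hη] at h2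
    linarith
  have := Finset.card_le_card_of_injOn _ hmaps hinj
  rw [Finset.card_range] at this
  calc (S.card : ℝ) ≤ ((⌊1 / η⌋₊ + 1 : ℕ) : ℝ) := by exact_mod_cast this
    _ = ⌊1 / η⌋₊ + 1 := by push_cast; ring
    _ ≤ 1 / η + 1 := by gcongr; exact Nat.floor_le (by positivity)
    _ = _ := add_comm _ _

theorem le_of_pow_le {B c C : ℝ} (hc : 1 ≤ c) (h : ∀ k : ℕ, B ^ k ≤ 1 + C * c ^ k) : B ≤ c := by
  by_contra! hlt
  obtain ⟨k, hk⟩ := pow_unbounded_of_one_lt (1 + |C|) ((one_lt_div (by linarith)).2 hlt)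
  have hck : 1 ≤ c ^ k := one_le_pow₀ hc
  rw [div_pow, lt_div_iff₀ (by positivity)] at hk
  have := h k
  nlinarith [le_abs_self C, abs_nonneg C]

/-- If for each `k` one can find `B ^ k` parameters, so that the Hölder curve `f` travels at least
a distance comparable with `b ^ (-k)` between any two of them, then the exponent `γ` of `f`
satisfies `B ≤ b ^ (1 / γ)`. -/
theorem le_rpow_of_holder {X ι : Type*} [MetricSpace X] {f : unitInterval → X} {H γ : ℝ}
    (hγ : 0 < γ) (hf : ∀ x y : unitInterval, dist (f x) (f y) ≤ H * |(x : ℝ) - y| ^ γ)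
    {B b δ : ℝ} (hb : 1 ≤ b) (hδ : 0 < δ)
    (h : ∀ k : ℕ, ∃ (S : Finset ι) (t : ι → unitInterval), B ^ k ≤ S.card ∧
      ∀ c ∈ S, ∀ c' ∈ S, c ≠ c' → ∃ u v : unitInterval,
        |(u : ℝ) - v| ≤ |(t c : ℝ) - t c'| ∧ δ / b ^ k ≤ dist (f u) (f v)) :
    B ≤ b ^ (1 / γ) := by
  -- the given constant need not be positive
  set H' := max H 1
  have hH' : 0 < H' := lt_max_of_lt_right one_pos
  have hγ' : 0 < 1 / γ := by positivity
  refine le_of_pow_le (C := (H' / δ) ^ (1 / γ)) (Real.one_le_rpow hb hγ'.le) fun k => ?_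
  obtain ⟨S, t, hS, hsep⟩ := h k
  have hbk : 0 < b ^ k := by positivity
  set ρ := δ / (H' * b ^ k)
  have hρ : 0 < ρ := by positivity
  refine hS.trans ((card_le_of_separated (t := t) (η := ρ ^ (1 / γ)) (by positivity)
    fun c hc c' hc' hne => ?_).trans (le_of_eq ?_))
  · obtain ⟨u, v, huv, hd⟩ := hsep c hc c' hc' hne
    have h1 : δ / b ^ k ≤ H' * |(t c : ℝ) - t c'| ^ γ := calc
      δ / b ^ k ≤ H * |(u : ℝ) - v| ^ γ := hd.trans (hf u v)
      _ ≤ H' * |(u : ℝ) - v| ^ γ := by gcongr; exact le_max_left _ _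
      _ ≤ H' * |(t c : ℝ) - t c'| ^ γ := by gcongr
    have h2 : ρ ≤ |(t c : ℝ) - t c'| ^ γ := by
      rw [div_le_iff₀ (by positivity)] at h1 ⊢
      linarith
    calc ρ ^ (1 / γ) ≤ (|(t c : ℝ) - t c'| ^ γ) ^ (1 / γ) := by gcongr
      _ = _ := by rw [← Real.rpow_mul (abs_nonneg _), mul_one_div_cancel hγ.ne', Real.rpow_one]
  · have h3 : (b ^ (1 / γ)) ^ k = (b ^ k) ^ (1 / γ) := by
      rw [← Real.rpow_natCast, ← Real.rpow_natCast, ← Real.rpow_mul (by linarith),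
        ← Real.rpow_mul (by linarith), mul_comm]
    rw [h3, ← Real.mul_rpow (by positivity) hbk.le, one_div, ← Real.inv_rpow hρ.le]
    congr 2
    simp only [ρ]
    rw [inv_div]
    ring

/-- The intermediate value theorem on the unit interval. -/
theorem exists_eq_of_mem_uIcc {g : unitInterval → ℝ} (hg : Continuous g) {s t : unitInterval}
    {y : ℝ} (hy : y ∈ Set.uIcc (g s) (g t)) :
    ∃ v : unitInterval, g v = y ∧ |(v : ℝ) - s| ≤ |(s : ℝ) - t| ∧
      |(v : ℝ) - t| ≤ |(s : ℝ) - t| := by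
  have hcont : Continuous (Set.IccExtend (zero_le_one (α := ℝ)) g) := hg.Icc_extend'
  have e : ∀ r : unitInterval, Set.IccExtend (zero_le_one (α := ℝ)) g r = g r := fun r =>
    Set.IccExtend_val _ _ _
  rw [← e s, ← e t] at hy
  obtain ⟨r, hr, rfl⟩ := intermediate_value_uIcc hcont.continuousOn hy
  have hr01 : r ∈ Set.Icc (0 : ℝ) 1 := Set.uIcc_subset_Icc s.2 t.2 hr
  refine ⟨⟨r, hr01⟩, (e ⟨r, hr01⟩).symm, ?_, ?_⟩
  · rw [abs_sub_comm (s : ℝ)]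
    exact Set.abs_sub_left_of_mem_uIcc hr
  · rw [abs_sub_comm, abs_sub_comm (s : ℝ)]
    exact Set.abs_sub_right_of_mem_uIcc hr

/-- A curve with more than one point has no Hölder exponent above `1`. -/
theorem IsHolderCurve.le_one {X : Type*} [MetricSpace X] {K : Set X} {γ : ℝ} (hγ : 0 < γ)
    (h : IsHolderCurve γ K) {x y : X} (hx : x ∈ K) (hy : y ∈ K) (hxy : x ≠ y) : γ ≤ 1 := by
  obtain ⟨f, hcont, rfl, H, hf⟩ := h
  obtain ⟨s, rfl⟩ := hx
  obtain ⟨t, rfl⟩ := hy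
  have hd : 0 < dist (f t) (f s) := dist_pos.2 hxy.symm
  set d := dist (f t) (f s)
  have key : (2 : ℝ) ≤ 2 ^ (1 / γ) := by
    refine le_rpow_of_holder (ι := ℕ) hγ hf one_le_two hd fun k => ?_
    have hex : ∀ n : ℕ, ∃ v, n ∈ Finset.range (2 ^ k) → dist (f v) (f s) = n / 2 ^ k * d := by
      intro n
      by_cases hn : n ∈ Finset.range (2 ^ k)
      · have hn' : (n : ℝ) ≤ 2 ^ k := by exact_mod_cast (Finset.mem_range.1 hn).le
        obtain ⟨v, hv, -⟩ := exists_eq_of_mem_uIcc (g := fun v => dist (f v) (f s)) (s := s)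
          (t := t) (by fun_prop) (y := n / 2 ^ k * d) (by
            rw [dist_self, Set.uIcc_of_le hd.le]
            refine ⟨by positivity, mul_le_of_le_one_left hd.le ?_⟩
            exact div_le_one_of_le₀ hn' (by positivity))
        exact ⟨v, fun _ => hv⟩
      · exact ⟨s, fun h => absurd h hn⟩
    choose v hv using hex
    refine ⟨Finset.range (2 ^ k), v, by simp, fun n hn m hm hne => ⟨v n, v m, le_rfl, ?_⟩⟩
    have h1 : (1 : ℝ) ≤ |(n : ℝ) - m| := by
      have : (1 : ℤ) ≤ |(n : ℤ) - m| := Int.one_le_abs (sub_ne_zero.2 (by exact_mod_cast hne))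
      exact_mod_cast this
    calc d / 2 ^ k ≤ |(n : ℝ) - m| * (d / 2 ^ k) := le_mul_of_one_le_left (by positivity) h1
      _ = |dist (f (v n)) (f s) - dist (f (v m)) (f s)| := by
        rw [hv n hn, hv m hm, ← sub_mul, ← sub_div, abs_mul, abs_div, abs_of_pos hd,
          abs_of_pos (show (0 : ℝ) < 2 ^ k by positivity)]
        ring
      _ ≤ dist (f (v n)) (f (v m)) := abs_dist_sub_le _ _ _
  have h1 : (2 : ℝ) ^ (1 : ℝ) ≤ 2 ^ (1 / γ) := by rwa [Real.rpow_one]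
  rwa [Real.rpow_le_rpow_left_iff one_lt_two, one_le_div hγ] at h1

theorem one_le_abs_sub {a b : ℤ} (h : a ≠ b) : (1 : ℝ) ≤ |(a : ℝ) - b| := by
  have : (1 : ℤ) ≤ |a - b| := Int.one_le_abs (sub_ne_zero.2 h)
  exact_mod_cast this

/-- The points of a grid show that the square has no Hölder exponent above `1 / 2`. -/
theorem IsHolderCurve.le_half {γ : ℝ} (hγ : 0 < γ) (h : IsHolderCurve γ unitSquare) :
    γ ≤ 1 / 2 := by
  obtain ⟨f, -, hr, H, hf⟩ := h
  have key : (4 : ℝ) ≤ 2 ^ (1 / γ) := by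
    refine le_rpow_of_holder (ι := ℕ × ℕ) hγ hf one_le_two one_pos fun k => ?_
    have hex : ∀ w : ℕ × ℕ, ∃ v, w ∈ Finset.range (2 ^ k) ×ˢ Finset.range (2 ^ k) →
        f v = !₂[(w.1 : ℝ) / 2 ^ k, (w.2 : ℝ) / 2 ^ k] := by
      intro w
      by_cases hw : w ∈ Finset.range (2 ^ k) ×ˢ Finset.range (2 ^ k)
      · rw [Finset.mem_product, Finset.mem_range, Finset.mem_range] at hw
        have h1 : (w.1 : ℝ) ≤ 2 ^ k := by exact_mod_cast hw.1.le
        have h2 : (w.2 : ℝ) ≤ 2 ^ k := by exact_mod_cast hw.2.le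
        have hmem : (!₂[(w.1 : ℝ) / 2 ^ k, (w.2 : ℝ) / 2 ^ k] : Plane) ∈ unitSquare := by
          refine ⟨⟨?_, ?_⟩, ?_, ?_⟩
          · change (0 : ℝ) ≤ w.1 / 2 ^ k; positivity
          · exact div_le_one_of_le₀ h1 (by positivity)
          · change (0 : ℝ) ≤ w.2 / 2 ^ k; positivity
          · exact div_le_one_of_le₀ h2 (by positivity)
        rw [← hr] at hmem
        obtain ⟨v, hv⟩ := hmem
        exact ⟨v, fun _ => hv⟩
      · exact ⟨0, fun h => absurd h hw⟩
    choose v hv using hex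
    refine ⟨Finset.range (2 ^ k) ×ˢ Finset.range (2 ^ k), v, ?_, ?_⟩
    · rw [Finset.card_product, Finset.card_range, ← mul_pow]
      norm_num
    intro a ha b hb hne
    refine ⟨v a, v b, le_rfl, ?_⟩
    have aux : ∀ m n : ℕ, m ≠ n → (1 : ℝ) / 2 ^ k ≤ |(m : ℝ) / 2 ^ k - n / 2 ^ k| := by
      intro m n hmn
      rw [← sub_div, abs_div, abs_of_pos (show (0 : ℝ) < 2 ^ k by positivity)]
      refine div_le_div_of_nonneg_right ?_ (by positivity)
      exact_mod_cast one_le_abs_sub (show (m : ℤ) ≠ n by exact_mod_cast hmn)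
    by_cases h1 : a.1 = b.1
    · refine le_trans ?_ (Plane.abs_sub_le _ _ 1)
      rw [hv a ha, hv b hb]
      exact aux _ _ fun h2 => hne (Prod.ext h1 h2)
    · refine le_trans ?_ (Plane.abs_sub_le _ _ 0)
      rw [hv a ha, hv b hb]
      exact aux _ _ h1
  have h1 : (2 : ℝ) ^ (2 : ℝ) ≤ 2 ^ (1 / γ) := by norm_num at key ⊢; exact key
  rw [Real.rpow_le_rpow_left_iff one_lt_two, le_div_iff₀ hγ] at h1
  linarith

/-! ### The exponent of a carpet with a gap -/

/-- The cells of the grid do not overlap. -/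
theorem cellMap_eq_imp {P Q : ℝ} (hP : P ≠ 0) (hQ : Q ≠ 0) {w w' : Cell} {z z' : Plane}
    (h0 : z 0 ∈ Set.Ioo (0 : ℝ) 1) (h1 : z 1 ∈ Set.Ioo (0 : ℝ) 1) (hz' : z' ∈ unitSquare)
    (h : cellMap P Q w z = cellMap P Q w' z') : w = w' ∧ z = z' := by
  have aux : ∀ (n : ℝ) (a b : ℤ) (x y : ℝ), n ≠ 0 → x ∈ Set.Ioo (0 : ℝ) 1 →
      y ∈ Set.Icc (0 : ℝ) 1 → (a + x) / n = (b + y) / n → a = b ∧ x = y := by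
    intro n a b x y hn hx hy hxy
    have e : (a : ℝ) + x = b + y := (div_left_inj' hn).1 hxy
    have e1 : (a : ℝ) < b + 1 := by linarith [hx.1, hy.2]
    have e2 : (b : ℝ) < a + 1 := by linarith [hx.2, hy.1]
    have e3 : a = b := by
      have : a < b + 1 := by exact_mod_cast e1
      have : b < a + 1 := by exact_mod_cast e2
      omega
    subst e3
    exact ⟨rfl, by linarith⟩
  have g0 := aux P w.1 w'.1 _ _ hP h0 hz'.1 (congrArg (fun z : Plane => z 0) h)
  have g1 := aux Q w.2 w'.2 _ _ hQ h1 hz'.2 (congrArg (fun z : Plane => z 1) h)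
  exact ⟨Prod.ext g0.1 g1.1, Plane.ext g0.2 g1.2⟩

section Gap

variable {p q : ℕ} {D : Finset Cell} {K : Set Plane}

/-- Suppose that a vertical line meets `K` and leaves it. On the way between two cells of the same
column, a curve in `K` has to pass the height of a copy of the gap, and must then leave the
vertical line by a distance comparable with the width of the cells. -/
theorem IsSelfAffine.card_le_rpow_of_gap (hK : IsSelfAffine p q D K) (hD : IsDigitSet p q D)
    (hc : IsCompact K) (hp : 2 ≤ p) (hq : 2 ≤ q) {x y z : ℝ} (hx : x ∈ Set.Ioo (0 : ℝ) 1)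
    (hz : z ∈ Set.Ioo (0 : ℝ) 1) (hy : !₂[x, y] ∈ K) (hzK : !₂[x, z] ∉ K) {γ : ℝ} (hγ : 0 < γ)
    (h : IsHolderCurve γ K) : (D.card : ℝ) ≤ (p : ℝ) ^ (1 / γ) := by
  have hp0 : 0 < p := by omega
  have hq0 : 0 < q := by omega
  have hpR : (1 : ℝ) ≤ p := by exact_mod_cast hp0
  have hsq := hK.subset_unitSquare hD hc hp hq
  obtain ⟨f, hcont, hrange, H, hf⟩ := h
  have hfK : ∀ t, f t ∈ K := fun t => hrange ▸ Set.mem_range_self t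
  obtain ⟨-, hy0, hy1⟩ := hsq hy
  change 0 ≤ y at hy0
  change y ≤ 1 at hy1
  -- a horizontal segment in the complement of `K`
  obtain ⟨δ, hδ, hδ1, hδx, hδx', hgap⟩ : ∃ δ > 0, δ ≤ 1 ∧ δ ≤ x ∧ δ ≤ 1 - x ∧
      ∀ x', |x' - x| < δ → !₂[x', z] ∉ K := by
    obtain ⟨ε, hε, hball⟩ := Metric.isOpen_iff.1 hc.isClosed.isOpen_compl _ hzK
    refine ⟨min ε (min x (1 - x)), by simp [hε, hx.1, hx.2], ?_, ?_, ?_, ?_⟩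
    · exact (min_le_right _ _).trans ((min_le_left _ _).trans hx.2.le)
    · exact (min_le_right _ _).trans (min_le_left _ _)
    · exact (min_le_right _ _).trans (min_le_right _ _)
    · intro x' hx'
      refine hball ?_
      rw [Metric.mem_ball]
      refine (Plane.dist_le _ _).trans_lt ?_
      change |x' - x| + |z - z| < ε
      rw [sub_self, abs_zero, add_zero]
      exact hx'.trans_le (min_le_left _ _)
  refine le_rpow_of_holder (ι := Cell) hγ hf hpR hδ fun k => ?_
  have hpk : (0 : ℝ) < (p : ℝ) ^ k := by positivity
  have hqk : (0 : ℝ) < (q : ℝ) ^ k := by positivity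
  have hex : ∀ w : Cell, ∃ t, w ∈ cells p q D k → f t = cellMap (p ^ k) (q ^ k) w !₂[x, y] := by
    intro w
    by_cases hw : w ∈ cells p q D k
    · have := hK.cellMap_mem hp0 hq0 hw hy
      rw [← hrange] at this
      obtain ⟨t, ht⟩ := this
      exact ⟨t, fun _ => ht⟩
    · exact ⟨0, fun h => absurd h hw⟩
  choose t ht using hex
  refine ⟨cells p q D k, t, by rw [card_cells hD]; push_cast; exact le_rfl, ?_⟩
  intro a ha b hb hne
  by_cases hab : a.1 = b.1
  · have hab2 : a.2 ≠ b.2 := fun h2 => hne (Prod.ext hab h2)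
    have hyz : y ≠ z := fun h => hzK (h ▸ hy)
    -- the curve passes the height of the gap in one of the two cells
    obtain ⟨c, hcab, hmem⟩ : ∃ c, (c = a ∨ c = b) ∧
        ((c.2 : ℝ) + z) / (q : ℝ) ^ k ∈ Set.uIcc (f (t a) 1) (f (t b) 1) := by
      rw [ht a ha, ht b hb, cellMap_one, cellMap_one]
      change ∃ c, (c = a ∨ c = b) ∧ ((c.2 : ℝ) + z) / (q : ℝ) ^ k ∈
        Set.uIcc (((a.2 : ℝ) + y) / (q : ℝ) ^ k) (((b.2 : ℝ) + y) / (q : ℝ) ^ k)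
      have aux : ∀ r s u : ℝ, r ≤ s → s ≤ u → s / (q : ℝ) ^ k ∈
          Set.Icc (r / (q : ℝ) ^ k) (u / (q : ℝ) ^ k) := fun r s u h1 h2 =>
        ⟨div_le_div_of_nonneg_right h1 hqk.le, div_le_div_of_nonneg_right h2 hqk.le⟩
      obtain ⟨hz0, hz1⟩ := hz
      rcases lt_or_gt_of_ne hab2 with h2 | h2 <;> rcases lt_or_gt_of_ne hyz with h3 | h3
      · have h2' : (a.2 : ℝ) + 1 ≤ b.2 := by exact_mod_cast h2
        exact ⟨a, .inl rfl, Set.Icc_subset_uIcc (aux _ _ _ (by linarith) (by linarith))⟩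
      · have h2' : (a.2 : ℝ) + 1 ≤ b.2 := by exact_mod_cast h2
        exact ⟨b, .inr rfl, Set.Icc_subset_uIcc (aux _ _ _ (by linarith) (by linarith))⟩
      · have h2' : (b.2 : ℝ) + 1 ≤ a.2 := by exact_mod_cast h2
        exact ⟨b, .inr rfl, Set.Icc_subset_uIcc' (aux _ _ _ (by linarith) (by linarith))⟩
      · have h2' : (b.2 : ℝ) + 1 ≤ a.2 := by exact_mod_cast h2
        exact ⟨a, .inl rfl, Set.Icc_subset_uIcc' (aux _ _ _ (by linarith) (by linarith))⟩
    have hcc : c ∈ cells p q D k := by rcases hcab with rfl | rfl <;> assumption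
    obtain ⟨v, hv, hva, hvb⟩ := exists_eq_of_mem_uIcc (g := fun v => f v 1) (by fun_prop) hmem
    refine ⟨v, t c, by rcases hcab with rfl | rfl <;> assumption, ?_⟩
    refine le_trans ?_ (Plane.abs_sub_le _ _ 0)
    rw [ht c hcc, cellMap_zero]
    change δ / (p : ℝ) ^ k ≤ |f v 0 - (c.1 + x) / (p : ℝ) ^ k|
    by_contra! hlt
    -- otherwise `f v` lies on the copy of the segment in the cell `c`
    set x' := (p : ℝ) ^ k * f v 0 - c.1 with hx'
    have hfv : f v = cellMap (p ^ k) (q ^ k) c !₂[x', z] := by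
      refine Plane.ext ?_ hv
      change f v 0 = (c.1 + x') / (p : ℝ) ^ k
      rw [hx']
      field_simp
      ring
    have hxx : |x' - x| < δ := by
      rw [lt_div_iff₀ hpk, ← abs_of_pos hpk, ← abs_mul, abs_of_pos hpk] at hlt
      refine lt_of_eq_of_lt (congrArg _ ?_) hlt
      rw [hx']
      field_simp
      ring
    have hx'01 : x' ∈ Set.Ioo (0 : ℝ) 1 := by
      rw [abs_lt] at hxx
      constructor <;> linarith
    have hvK := hfK v
    rw [hK.eq_iUnion_cells hp0 hq0 k] at hvK
    simp only [Set.mem_iUnion, Set.mem_image, exists_prop] at hvK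
    obtain ⟨w, -, z', hz', hw⟩ := hvK
    obtain ⟨-, e⟩ := cellMap_eq_imp hpk.ne' hqk.ne' (z := !₂[x', z]) hx'01 hz (hsq hz')
      (hfv.symm.trans hw.symm)
    exact hgap x' hxx (e ▸ hz')
  · refine ⟨t a, t b, le_rfl, le_trans ?_ (Plane.abs_sub_le _ _ 0)⟩
    rw [ht a ha, ht b hb, cellMap_zero, cellMap_zero, ← sub_div, abs_div, abs_of_pos hpk]
    refine div_le_div_of_nonneg_right ?_ hpk.le
    rw [add_sub_add_right_eq_sub]
    exact hδ1.trans (one_le_abs_sub hab)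

end Gap

/-! ### Gaps of connected carpets -/

/-- A nondegenerate interval that is a union of images under the maps `x ↦ (i + x) / n`, where
`0 ≤ i < n`, needs all of them, since each is shorter by the factor `n`. -/
theorem eq_Icc_of_selfSimilar {n : ℕ} (hn : 2 ≤ n) {I : Finset ℤ} (hI : I ⊆ Finset.Ico 0 (n : ℤ))
    {P : Set ℝ} (hc : IsCompact P) (hconn : IsConnected P)
    (h : ∀ x, x ∈ P ↔ ∃ i ∈ I, ∃ y ∈ P, ((i : ℝ) + y) / n = x) :
    I.card ≤ 1 ∨ (I = Finset.Ico 0 (n : ℤ) ∧ P = Set.Icc 0 1) := by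
  have hn' : (2 : ℝ) ≤ n := by exact_mod_cast hn
  obtain ⟨α, β, hαβ, rfl⟩ : ∃ α β : ℝ, α ≤ β ∧ P = Set.Icc α β := by
    have := eq_Icc_of_connected_compact hconn hc
    refine ⟨sInf P, sSup P, ?_, this⟩
    exact Set.nonempty_Icc.1 (this ▸ hconn.nonempty)
  rcases hαβ.eq_or_lt with rfl | hlt
  · left
    refine Finset.card_le_one.2 fun i hi j hj => ?_
    have key : ∀ i ∈ I, (i : ℝ) = (n - 1) * α := fun i hi => by
      have h1 := (h _).2 ⟨i, hi, α, by simp, rfl⟩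
      rw [Set.Icc_self, Set.mem_singleton_iff, div_eq_iff (by positivity)] at h1
      linarith
    exact_mod_cast (key i hi).trans (key j hj).symm
  · right
    have hcard : n ≤ I.card := by
      have h1 : Set.Icc α β ⊆ ⋃ i ∈ I, Set.Icc (((i : ℝ) + α) / n) (((i : ℝ) + β) / n) := by
        intro x hx
        obtain ⟨i, hi, y, hy, rfl⟩ := (h x).1 hx
        refine Set.mem_biUnion hi ⟨?_, ?_⟩
        · exact div_le_div_of_nonneg_right (by linarith [hy.1]) (by positivity)
        · exact div_le_div_of_nonneg_right (by linarith [hy.2]) (by positivity)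
      have h2 := (MeasureTheory.measure_mono (μ := MeasureTheory.volume) h1).trans
        (MeasureTheory.measure_biUnion_finset_le I _)
      have h3 : ∀ i : ℤ, ((i : ℝ) + β) / n - ((i : ℝ) + α) / n = (β - α) / n := fun i => by ring
      simp only [Real.volume_Icc, h3, Finset.sum_const, nsmul_eq_mul] at h2
      rw [← ENNReal.ofReal_natCast, ← ENNReal.ofReal_mul (by positivity),
        ENNReal.ofReal_le_ofReal_iff (by have : 0 < β - α := sub_pos.2 hlt; positivity),
        mul_div_assoc', le_div_iff₀ (by positivity), mul_comm] at h2
      exact_mod_cast le_of_mul_le_mul_right h2 (sub_pos.2 hlt)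
    have hIeq : I = Finset.Ico 0 (n : ℤ) := Finset.eq_of_subset_of_card_le hI (by simpa using hcard)
    refine ⟨hIeq, ?_⟩
    have hmem : ∀ i : ℤ, 0 ≤ i → i < n → i ∈ I := fun i h0 h1 =>
      hIeq ▸ Finset.mem_Ico.2 ⟨h0, h1⟩
    have hbound : ∀ i ∈ I, (0 : ℝ) ≤ i ∧ (i : ℝ) + 1 ≤ n := fun i hi => by
      obtain ⟨h0, h1⟩ := Finset.mem_Ico.1 (hI hi)
      have h1' : i + 1 ≤ (n : ℤ) := h1
      exact ⟨by exact_mod_cast h0, by exact_mod_cast h1'⟩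
    have e1 : α = 0 := by
      obtain ⟨i, hi, y, hy, hα⟩ := (h α).1 ⟨le_rfl, hαβ⟩
      have hα' := ((h _).2 ⟨0, hmem 0 le_rfl (by omega), α, ⟨le_rfl, hαβ⟩, rfl⟩).1
      rw [div_eq_iff (by positivity)] at hα
      rw [le_div_iff₀ (by positivity)] at hα'
      push_cast at hα'
      have := (hbound i hi).1
      have := hy.1
      refine le_antisymm ?_ ?_ <;> nlinarith
    have e2 : β = 1 := by
      obtain ⟨i, hi, y, hy, hβ⟩ := (h β).1 ⟨hαβ, le_rfl⟩
      have hβ' := ((h _).2 ⟨n - 1, hmem _ (by omega) (by omega), β, ⟨hαβ, le_rfl⟩, rfl⟩).2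
      rw [div_eq_iff (by positivity)] at hβ
      rw [div_le_iff₀ (by positivity)] at hβ'
      push_cast at hβ'
      have := (hbound i hi).2
      have := hy.2
      refine le_antisymm ?_ ?_ <;> nlinarith
    rw [e1, e2]

namespace IsSelfAffine

variable {p q : ℕ} {D : Finset Cell} {K : Set Plane}

/-- The projection of a connected carpet to a coordinate axis is a point or the unit interval. -/
theorem card_image_le_one_or (hK : IsSelfAffine p q D K) (hc : IsCompact K)
    (hconn : IsConnected K) {n : ℕ} (hn : 2 ≤ n) (c : Fin 2) {e : Cell → ℤ}
    (he : ∀ d ∈ D, 0 ≤ e d ∧ e d < n) (hcoord : ∀ d z, cellMap p q d z c = (e d + z c) / n) :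
    (D.image e).card ≤ 1 ∨
      (D.image e = Finset.Ico 0 (n : ℤ) ∧ (fun z : Plane => z c) '' K = Set.Icc 0 1) := by
  have hcont : Continuous fun z : Plane => z c := by fun_prop
  refine eq_Icc_of_selfSimilar hn ?_ (hc.image hcont) (hconn.image _ hcont.continuousOn) ?_
  · intro i hi
    obtain ⟨d, hd, rfl⟩ := Finset.mem_image.1 hi
    exact Finset.mem_Ico.2 (he d hd)
  · intro x
    constructor
    · rintro ⟨z, hz, rfl⟩
      obtain ⟨d, hd, y, hy, rfl⟩ := hK.mem_iff.1 hz
      exact ⟨e d, Finset.mem_image_of_mem _ hd, y c, ⟨y, hy, rfl⟩, (hcoord d y).symm⟩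
    · rintro ⟨i, hi, y, ⟨z, hz, rfl⟩, rfl⟩
      obtain ⟨d, hd, rfl⟩ := Finset.mem_image.1 hi
      exact ⟨cellMap p q d z, hK.mem_iff.2 ⟨d, hd, z, hz, rfl⟩, hcoord d z⟩

/-- A connected carpet, which is not exceptional, meets and leaves a vertical line in the interior
of the square. -/
theorem exists_gap (hK : IsSelfAffine p q D K) (hD : IsDigitSet p q D) (hc : IsCompact K)
    (hconn : IsConnected K) (hp : 2 ≤ p) (hq : 2 ≤ q) (hone : D.card ≠ 1)
    (hcol : ∀ i, D ≠ {i} ×ˢ Finset.Ico 0 (q : ℤ))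
    (huniv : D ≠ Finset.Ico 0 (p : ℤ) ×ˢ Finset.Ico 0 (q : ℤ)) :
    ∃ x ∈ Set.Ioo (0 : ℝ) 1, ∃ z ∈ Set.Ioo (0 : ℝ) 1, ∃ y, !₂[x, y] ∈ K ∧ !₂[x, z] ∉ K := by
  have hpR : (2 : ℝ) ≤ p := by exact_mod_cast hp
  have hqR : (2 : ℝ) ≤ q := by exact_mod_cast hq
  have hsq := hK.subset_unitSquare hD hc hp hq
  have hDne : 0 < D.card := by
    obtain ⟨z, hz⟩ := hconn.nonempty
    obtain ⟨d, hd, -⟩ := hK.mem_iff.1 hz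
    exact Finset.card_pos.2 ⟨d, hd⟩
  -- the carpet projects onto the horizontal unit interval
  have hproj : (fun z : Plane => z 0) '' K = Set.Icc 0 1 := by
    rcases hK.card_image_le_one_or hc hconn hp 0 (e := Prod.fst)
      (fun d hd => ⟨(hD d hd).1, (hD d hd).2.1⟩) (fun _ _ => rfl) with h1 | h1
    swap
    · exact h1.2
    exfalso
    have hfst : ∀ d ∈ D, ∀ d' ∈ D, d.1 = d'.1 := fun d hd d' hd' =>
      Finset.card_le_one.1 h1 _ (Finset.mem_image_of_mem _ hd) _ (Finset.mem_image_of_mem _ hd')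
    obtain ⟨d₀, hd₀⟩ := Finset.card_pos.1 hDne
    rcases hK.card_image_le_one_or hc hconn hq 1 (e := Prod.snd)
      (fun d hd => ⟨(hD d hd).2.2.1, (hD d hd).2.2.2⟩) (fun _ _ => rfl) with h2 | h2
    · have : D.card ≤ 1 := Finset.card_le_one.2 fun d hd d' hd' => Prod.ext (hfst d hd d' hd')
        (Finset.card_le_one.1 h2 _ (Finset.mem_image_of_mem _ hd) _
          (Finset.mem_image_of_mem _ hd'))
      omega
    · refine hcol d₀.1 ?_
      ext ⟨i, j⟩
      rw [Finset.mem_product, Finset.mem_singleton, ← h2.1, Finset.mem_image]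
      constructor
      · exact fun h => ⟨hfst _ h _ hd₀, _, h, rfl⟩
      · rintro ⟨rfl, d, hd, rfl⟩
        rw [show ((d₀.1, d.2) : Cell) = d from Prod.ext (hfst _ hd₀ _ hd) rfl]
        exact hd
  -- the centre of a missing cell is not in the carpet
  obtain ⟨⟨i, j⟩, hij, hnot⟩ : ∃ d ∈ Finset.Ico 0 (p : ℤ) ×ˢ Finset.Ico 0 (q : ℤ), d ∉ D := by
    by_contra! h
    refine huniv (Finset.Subset.antisymm (fun d hd => ?_) h)
    obtain ⟨h1, h2, h3, h4⟩ := hD d hd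
    exact Finset.mem_product.2 ⟨Finset.mem_Ico.2 ⟨h1, h2⟩, Finset.mem_Ico.2 ⟨h3, h4⟩⟩
  obtain ⟨h1, h2⟩ := Finset.mem_product.1 hij
  obtain ⟨h1, h1'⟩ := Finset.mem_Ico.1 h1
  obtain ⟨h2, h2'⟩ := Finset.mem_Ico.1 h2
  have centre : ∀ (n : ℕ) (m : ℤ), (2 : ℝ) ≤ n → 0 ≤ m → m < n →
      ((m : ℝ) + 1 / 2) / n ∈ Set.Ioo (0 : ℝ) 1 := by
    intro n m hn h0 h1
    have e0 : (0 : ℝ) ≤ m := by exact_mod_cast h0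
    have e1 : (m : ℝ) + 1 ≤ n := by
      have : m + 1 ≤ (n : ℤ) := h1
      exact_mod_cast this
    exact ⟨by positivity, by rw [div_lt_one (by positivity)]; linarith⟩
  have hx := centre p i hpR h1 h1'
  refine ⟨_, hx, _, centre q j hqR h2 h2', ?_⟩
  obtain ⟨z, hz, hz0⟩ : ((i : ℝ) + 1 / 2) / p ∈ (fun z : Plane => z 0) '' K :=
    hproj ▸ Set.Ioo_subset_Icc_self hx
  refine ⟨z 1, ?_, fun hmem => ?_⟩
  · rwa [show !₂[((i : ℝ) + 1 / 2) / p, z 1] = z from Plane.ext hz0.symm rfl]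
  · obtain ⟨d, hd, z', hz', h⟩ := hK.mem_iff.1 hmem
    have hhalf : (1 / 2 : ℝ) ∈ Set.Ioo (0 : ℝ) 1 := by constructor <;> norm_num
    obtain ⟨e, -⟩ := cellMap_eq_imp (P := p) (Q := q) (by positivity) (by positivity) (w := (i, j))
      (z := !₂[1 / 2, 1 / 2]) hhalf hhalf (hsq hz') (Eq.trans (Plane.ext rfl rfl) h.symm)
    exact hnot (e ▸ hd)

theorem isSharpHolderExponent (hK : IsSelfAffine p q D K) (hD : IsDigitSet p q D)
    (hc : IsCompact K) (hconn : IsConnected K) (hp : 2 ≤ p) (hpq : p ≤ q) (hone : D.card ≠ 1)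
    (hcol : ∀ i, D ≠ {i} ×ˢ Finset.Ico 0 (q : ℤ))
    (huniv : D ≠ Finset.Ico 0 (p : ℤ) ×ˢ Finset.Ico 0 (q : ℤ)) :
    IsSharpHolderExponent (1 / Real.logb p D.card) K := by
  have hN : 2 ≤ D.card := by
    obtain ⟨z, hz⟩ := hconn.nonempty
    obtain ⟨d, hd, -⟩ := hK.mem_iff.1 hz
    have := Finset.card_pos.2 ⟨d, hd⟩
    omega
  have hNR : (1 : ℝ) < D.card := by exact_mod_cast hN
  have hpR : (1 : ℝ) < p := by exact_mod_cast hp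
  have hs : 0 < Real.logb p D.card := Real.logb_pos hpR hNR
  refine ⟨⟨by positivity, hK.isHolderCurve hD hc hconn hp hpq hN⟩, ?_⟩
  rintro γ ⟨hγ, hcurve⟩
  obtain ⟨x, hx, z, hz, y, hy, hzK⟩ := hK.exists_gap hD hc hconn hp (hp.trans hpq) hone hcol huniv
  have h1 := hK.card_le_rpow_of_gap hD hc hp (hp.trans hpq) hx hz hy hzK hγ hcurve
  rw [← Real.logb_le_iff_le_rpow hpR (by linarith)] at h1
  rwa [le_one_div hγ hs]

end IsSelfAffine

/-! ### Index sets and digits -/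

section Digits

variable {n₁ n₂ : ℕ}

/-- The digits of a carpet with index set `A`, as cells of the integral grid. -/
def digits (A : Finset (Fin n₁ × Fin n₂)) : Finset Cell :=
  A.image fun a => (((a.1 : ℕ) : ℤ), ((a.2 : ℕ) : ℤ))

theorem mem_digits {A : Finset (Fin n₁ × Fin n₂)} {d : Cell} :
    d ∈ digits A ↔ ∃ a ∈ A, (((a.1 : ℕ) : ℤ), ((a.2 : ℕ) : ℤ)) = d :=
  Finset.mem_image

theorem coe_mem_digits {A : Finset (Fin n₁ × Fin n₂)} {a : Fin n₁ × Fin n₂} :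
    ((((a.1 : ℕ) : ℤ), ((a.2 : ℕ) : ℤ)) : Cell) ∈ digits A ↔ a ∈ A := by
  rw [mem_digits]
  constructor
  · rintro ⟨b, hb, h⟩
    rw [Prod.mk.injEq] at h
    have : b = a := Prod.ext (Fin.ext (by exact_mod_cast h.1)) (Fin.ext (by exact_mod_cast h.2))
    exact this ▸ hb
  · exact fun h => ⟨a, h, rfl⟩

theorem card_digits (A : Finset (Fin n₁ × Fin n₂)) : (digits A).card = A.card := by
  refine Finset.card_image_of_injective _ fun a b h => ?_
  rw [Prod.mk.injEq] at h
  exact Prod.ext (Fin.ext (by exact_mod_cast h.1)) (Fin.ext (by exact_mod_cast h.2))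

theorem isDigitSet_digits (A : Finset (Fin n₁ × Fin n₂)) : IsDigitSet n₁ n₂ (digits A) := by
  intro d hd
  obtain ⟨a, -, rfl⟩ := mem_digits.1 hd
  have := a.1.2
  have := a.2.2
  refine ⟨?_, ?_, ?_, ?_⟩ <;> dsimp only <;> omega

theorem digits_ne_column {A : Finset (Fin n₁ × Fin n₂)} (hA : A.Nonempty)
    (h : ∀ i : Fin n₁, A ≠ column n₂ i) (i : ℤ) : digits A ≠ {i} ×ˢ Finset.Ico 0 (n₂ : ℤ) := by
  intro hd
  obtain ⟨a, ha⟩ := hA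
  have hmem : ∀ b, b ∈ A ↔ ((b.1 : ℕ) : ℤ) = i := fun b => by
    rw [← coe_mem_digits, hd, Finset.mem_product, Finset.mem_singleton, Finset.mem_Ico]
    have := b.2.2
    refine ⟨fun h => h.1, fun h => ⟨h, ?_, ?_⟩⟩ <;> dsimp only <;> omega
  refine h a.1 ?_
  ext b
  rw [hmem, column, Finset.mem_product, Finset.mem_singleton, ← (hmem a).1 ha, Fin.ext_iff]
  simp

theorem digits_ne_univ {A : Finset (Fin n₁ × Fin n₂)} (h : A ≠ Finset.univ) :
    digits A ≠ Finset.Ico 0 (n₁ : ℤ) ×ˢ Finset.Ico 0 (n₂ : ℤ) := by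
  intro hd
  refine h (Finset.eq_univ_iff_forall.2 fun b => ?_)
  rw [← coe_mem_digits, hd, Finset.mem_product, Finset.mem_Ico, Finset.mem_Ico]
  have := b.1.2
  have := b.2.2
  refine ⟨⟨?_, ?_⟩, ?_, ?_⟩ <;> dsimp only <;> omega

theorem carpetMap_eq_cellMap (a : Fin n₁ × Fin n₂) :
    carpetMap a = cellMap n₁ n₂ (((a.1 : ℕ) : ℤ), ((a.2 : ℕ) : ℤ)) := by
  funext z
  simp [carpetMap, cellMap]

theorem iUnion_carpetIFS (A : Finset (Fin n₁ × Fin n₂)) (K : Set Plane) :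
    ⋃ a, carpetIFS A a '' K = ⋃ d ∈ digits A, cellMap n₁ n₂ d '' K := by
  ext x
  simp only [Set.mem_iUnion, exists_prop, mem_digits]
  constructor
  · rintro ⟨a, hx⟩
    exact ⟨_, ⟨a.1, a.2, rfl⟩, carpetMap_eq_cellMap a.1 ▸ hx⟩
  · rintro ⟨_, ⟨a, ha, rfl⟩, hx⟩
    refine ⟨⟨a, ha⟩, ?_⟩
    rw [carpetIFS, carpetMap_eq_cellMap]
    exact hx

variable (h₁ : 2 ≤ n₁) (h₁₂ : n₁ ≤ n₂) {A : Finset (Fin n₁ × Fin n₂)} (hA : A.Nonempty)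

theorem isCompact_carpet : IsCompact (carpet h₁ h₁₂ A hA) :=
  (isAttractor_carpet h₁ h₁₂ A hA).1

theorem isSelfAffine_carpet : IsSelfAffine n₁ n₂ (digits A) (carpet h₁ h₁₂ A hA) :=
  (isAttractor_carpet h₁ h₁₂ A hA).2.2.trans (iUnion_carpetIFS A _)

theorem carpet_eq {K : Set Plane} (hc : IsCompact K) (hne : K.Nonempty)
    (hK : IsSelfAffine n₁ n₂ (digits A) K) : carpet h₁ h₁₂ A hA = K := by
  have : Nonempty A := hA.to_subtype
  exact (existsUnique_isAttractor (carpetIFS A)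
    fun a => isContraction_carpetMap h₁ h₁₂ a.1).unique (isAttractor_carpet h₁ h₁₂ A hA)
    ⟨hc, hne, hK.trans (iUnion_carpetIFS A K).symm⟩

end Digits

/-! ### The similarity dimension -/

theorem dist_cellMap_cellMap_le {P Q : ℝ} (hP : 0 < P) (hPQ : P ≤ Q) (w : Cell) (x y : Plane) :
    dist (cellMap P Q w x) (cellMap P Q w y) ≤ P⁻¹ * dist x y := by
  have hP' : 0 ≤ P⁻¹ := by positivity
  have e : P⁻¹ = √(P⁻¹ ^ 2) := by rw [Real.sqrt_sq hP']
  rw [EuclideanSpace.dist_eq, EuclideanSpace.dist_eq, e, ← Real.sqrt_mul (by positivity)]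
  refine Real.sqrt_le_sqrt ?_
  simp only [Fin.sum_univ_two, Real.dist_eq, sq_abs, cellMap_zero, cellMap_one]
  rw [mul_add]
  refine add_le_add (le_of_eq ?_) ?_
  · ring
  · have : Q⁻¹ ≤ P⁻¹ := inv_anti₀ hP hPQ
    have hQ' : 0 ≤ Q⁻¹ := inv_nonneg.2 (hP.le.trans hPQ)
    calc _ = Q⁻¹ ^ 2 * (x 1 - y 1) ^ 2 := by ring
      _ ≤ _ := by gcongr

theorem lipConst_carpetMap {n₁ n₂ : ℕ} (h₁ : 2 ≤ n₁) (h₁₂ : n₁ ≤ n₂) (a : Fin n₁ × Fin n₂) :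
    lipConst (carpetMap a) = ENNReal.ofReal (n₁ : ℝ)⁻¹ := by
  have hn : (0 : ℝ) < n₁ := by positivity
  rw [carpetMap_eq_cellMap]
  refine le_antisymm (lipConst_le fun x y => ?_) ?_
  · rw [edist_dist, edist_dist, ← ENNReal.ofReal_mul (by positivity)]
    exact ENNReal.ofReal_le_ofReal
      (dist_cellMap_cellMap_le hn (by exact_mod_cast h₁₂) _ x y)
  · set w : Cell := (((a.1 : ℕ) : ℤ), ((a.2 : ℕ) : ℤ))
    have h := edist_le_lipConst_mul (cellMap n₁ n₂ w) !₂[1, 0] !₂[0, 0]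
    have e1 : dist (!₂[1, 0] : Plane) !₂[0, 0] = 1 := by
      simp [EuclideanSpace.dist_eq]
    have e2 : (n₁ : ℝ)⁻¹ ≤ dist (cellMap n₁ n₂ w !₂[1, 0]) (cellMap n₁ n₂ w !₂[0, 0]) := by
      refine le_trans (le_of_eq ?_) (Plane.abs_sub_le _ _ 0)
      change (n₁ : ℝ)⁻¹ = |(w.1 + 1) / (n₁ : ℝ) - (w.1 + 0) / n₁|
      rw [← sub_div, add_sub_add_left_eq_sub, sub_zero, abs_of_pos (by positivity), one_div]
    rw [edist_dist, edist_dist, e1, ENNReal.ofReal_one, mul_one] at h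
    exact (ENNReal.ofReal_le_ofReal e2).trans h

theorem isSimilarityDim_carpetIFS {n₁ n₂ : ℕ} (h₁ : 2 ≤ n₁) (h₁₂ : n₁ ≤ n₂)
    {A : Finset (Fin n₁ × Fin n₂)} (hA : A.Nonempty) (s : ℝ) :
    IsSimilarityDim (carpetIFS A) s ↔ s = Real.logb n₁ A.card := by
  have hn : (1 : ℝ) < n₁ := by exact_mod_cast h₁
  have hlip : ∀ a, lipConst (carpetIFS A a) = ENNReal.ofReal (n₁ : ℝ)⁻¹ := fun a =>
    lipConst_carpetMap h₁ h₁₂ a.1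
  have hne : ENNReal.ofReal (n₁ : ℝ)⁻¹ ≠ 0 := by
    rw [Ne, ENNReal.ofReal_eq_zero, not_le]
    positivity
  obtain ⟨a, ha⟩ := hA
  have hcard : (0 : ℝ) < A.card := by exact_mod_cast Finset.card_pos.2 ⟨a, ha⟩
  simp only [IsSimilarityDim, hlip]
  rw [ENNReal.toReal_ofReal (by positivity), Finset.sum_const, Finset.card_univ, Fintype.card_coe,
    nsmul_eq_mul, Real.inv_rpow (by positivity), mul_inv_eq_one₀ (by positivity),
    eq_comm (a := s) (b := Real.logb _ _), Real.logb_eq_iff_rpow_eq (by linarith) hn.ne' hcard]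
  constructor
  · rintro (⟨h, -⟩ | ⟨-, h⟩)
    · exact absurd (h ⟨a, ha⟩) hne
    · exact h.symm
  · exact fun h => .inr ⟨⟨⟨a, ha⟩, hne⟩, h.symm⟩

/-! ### Exceptional index sets -/

theorem exists_digit {n : ℕ} (hn : 0 < n) {x : ℝ} (hx : x ∈ Set.Icc (0 : ℝ) 1) :
    ∃ i : ℕ, i < n ∧ ∃ y ∈ Set.Icc (0 : ℝ) 1, (i + y) / n = x := by
  have hnR : (0 : ℝ) < n := by exact_mod_cast hn
  have h0 : 0 ≤ n * x := mul_nonneg hnR.le hx.1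
  rcases hx.2.eq_or_lt with rfl | hlt
  · refine ⟨n - 1, by omega, 1, by simp, ?_⟩
    rw [Nat.cast_sub hn]
    field_simp
    simp
  · refine ⟨⌊n * x⌋₊, ?_, n * x - ⌊n * x⌋₊, ⟨?_, ?_⟩, ?_⟩
    · rw [Nat.floor_lt h0]
      exact mul_lt_of_lt_one_right hnR hlt
    · exact sub_nonneg.2 (Nat.floor_le h0)
    · linarith [Nat.lt_floor_add_one (n * x)]
    · field_simp
      ring

theorem add_div_mem_Icc {n : ℕ} {i : ℤ} (h0 : 0 ≤ i) (h1 : i < n) {y : ℝ}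
    (hy : y ∈ Set.Icc (0 : ℝ) 1) : ((i : ℝ) + y) / n ∈ Set.Icc (0 : ℝ) 1 := by
  have e0 : (0 : ℝ) ≤ i := by exact_mod_cast h0
  have e1 : (i : ℝ) + 1 ≤ n := by
    have : i + 1 ≤ (n : ℤ) := h1
    exact_mod_cast this
  refine ⟨div_nonneg (by linarith [hy.1]) (by linarith), div_le_one_of_le₀ ?_ (by linarith)⟩
  linarith [hy.2]

theorem isSelfAffine_of {p q : ℕ} {D : Finset Cell} {K : Set Plane}
    (h1 : ∀ d ∈ D, ∀ z ∈ K, cellMap p q d z ∈ K)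
    (h2 : ∀ x ∈ K, ∃ d ∈ D, ∃ z ∈ K, cellMap p q d z = x) : IsSelfAffine p q D K := by
  ext x
  simp only [Set.mem_iUnion, Set.mem_image, exists_prop]
  refine ⟨h2 x, ?_⟩
  rintro ⟨d, hd, z, hz, rfl⟩
  exact h1 d hd z hz

theorem unitSquare_eq_image : unitSquare =
    (fun z : ℝ × ℝ => (!₂[z.1, z.2] : Plane)) '' (Set.Icc 0 1 ×ˢ Set.Icc 0 1) := by
  ext x
  constructor
  · exact fun h => ⟨(x 0, x 1), ⟨h.1, h.2⟩, Plane.ext rfl rfl⟩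
  · rintro ⟨z, ⟨h0, h1⟩, rfl⟩
    exact ⟨h0, h1⟩

theorem isCompact_unitSquare : IsCompact unitSquare := by
  rw [unitSquare_eq_image]
  exact (isCompact_Icc.prod isCompact_Icc).image (by fun_prop)

theorem isConnected_unitSquare : IsConnected unitSquare := by
  rw [unitSquare_eq_image]
  have : IsConnected (Set.Icc (0 : ℝ) 1) := isConnected_Icc zero_le_one
  exact (this.prod this).image _ (by fun_prop)

theorem isSelfAffine_unitSquare {p q : ℕ} (hp : 0 < p) (hq : 0 < q) {D : Finset Cell}
    (hD : ∀ d : Cell, d ∈ D ↔ (0 ≤ d.1 ∧ d.1 < p) ∧ 0 ≤ d.2 ∧ d.2 < q) :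
    IsSelfAffine p q D unitSquare := by
  refine isSelfAffine_of (fun d hd z hz => ?_) fun x hx => ?_
  · obtain ⟨⟨h1, h2⟩, h3, h4⟩ := (hD d).1 hd
    exact ⟨add_div_mem_Icc h1 h2 hz.1, add_div_mem_Icc h3 h4 hz.2⟩
  · obtain ⟨i, hi, y, hy, e0⟩ := exists_digit hp hx.1
    obtain ⟨j, hj, z, hz, e1⟩ := exists_digit hq hx.2
    refine ⟨((i : ℤ), (j : ℤ)), (hD _).2 ?_, !₂[y, z], ⟨hy, hz⟩, Plane.ext ?_ ?_⟩
    · refine ⟨⟨?_, ?_⟩, ?_, ?_⟩ <;> dsimp only <;> omega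
    · rw [← e0]
      simp
    · rw [← e1]
      simp

section Exceptional

variable {n₁ n₂ : ℕ} (h₁ : 2 ≤ n₁) (h₁₂ : n₁ ≤ n₂) {A : Finset (Fin n₁ × Fin n₂)}
  (hA : A.Nonempty)

theorem carpet_of_card_eq_one (h : A.card = 1) : ∃ p, carpet h₁ h₁₂ A hA = {p} := by
  obtain ⟨a, rfl⟩ := Finset.card_eq_one.1 h
  have hn1 : (2 : ℝ) ≤ n₁ := by exact_mod_cast h₁
  have hn2 : (2 : ℝ) ≤ n₂ := by exact_mod_cast h₁.trans h₁₂
  have e1 : (n₁ : ℝ) - 1 ≠ 0 := by linarith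
  have e2 : (n₂ : ℝ) - 1 ≠ 0 := by linarith
  -- the fixed point of the only map
  set p : Plane := !₂[((a.1 : ℕ) : ℝ) / (n₁ - 1), ((a.2 : ℕ) : ℝ) / (n₂ - 1)] with hp
  have hfix : cellMap n₁ n₂ (((a.1 : ℕ) : ℤ), ((a.2 : ℕ) : ℤ)) p = p := by
    refine Plane.ext ?_ ?_
    · change ((((a.1 : ℕ) : ℤ) : ℝ) + (a.1 : ℕ) / ((n₁ : ℝ) - 1)) / n₁ = (a.1 : ℕ) / ((n₁ : ℝ) - 1)
      rw [Int.cast_natCast, div_eq_iff (by linarith)]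
      field_simp
      ring
    · change ((((a.2 : ℕ) : ℤ) : ℝ) + (a.2 : ℕ) / ((n₂ : ℝ) - 1)) / n₂ = (a.2 : ℕ) / ((n₂ : ℝ) - 1)
      rw [Int.cast_natCast, div_eq_iff (by linarith)]
      field_simp
      ring
  refine ⟨p, carpet_eq h₁ h₁₂ hA isCompact_singleton (Set.singleton_nonempty p)
    (isSelfAffine_of ?_ ?_)⟩
  · rintro d hd z rfl
    obtain ⟨b, hb, rfl⟩ := mem_digits.1 hd
    rw [Finset.mem_singleton.1 hb]
    exact hfix
  · rintro x rfl
    exact ⟨_, mem_digits.2 ⟨a, Finset.mem_singleton_self a, rfl⟩, _, rfl, hfix⟩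

theorem carpet_column {i : Fin n₁} (h : A = column n₂ i) :
    carpet h₁ h₁₂ A hA = verticalSegment (((i : ℕ) : ℝ) / ((n₁ : ℝ) - 1)) := by
  subst h
  have hn1 : (2 : ℝ) ≤ n₁ := by exact_mod_cast h₁
  have e1 : (n₁ : ℝ) - 1 ≠ 0 := by linarith
  set c : ℝ := ((i : ℕ) : ℝ) / ((n₁ : ℝ) - 1) with hcdef
  have hfix : ((((i : ℕ) : ℤ) : ℝ) + c) / n₁ = c := by
    rw [Int.cast_natCast, div_eq_iff (by linarith), hcdef]
    field_simp
    ring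
  have himage : verticalSegment c = (fun y : ℝ => (!₂[c, y] : Plane)) '' Set.Icc 0 1 := by
    ext x
    constructor
    · rintro ⟨hx0, hx⟩
      exact ⟨x 1, hx, Plane.ext hx0.symm rfl⟩
    · rintro ⟨y, hy, rfl⟩
      exact ⟨rfl, hy⟩
  have hdig : ∀ d : Cell, d ∈ digits (column n₂ i) ↔ d.1 = (i : ℕ) ∧ 0 ≤ d.2 ∧ d.2 < n₂ := by
    intro d
    rw [mem_digits]
    constructor
    · rintro ⟨a, ha, rfl⟩
      rw [column, Finset.mem_product, Finset.mem_singleton] at ha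
      have := a.2.2
      rw [ha.1]
      refine ⟨rfl, ?_, ?_⟩ <;> dsimp only <;> omega
    · rintro ⟨h1, h2, h3⟩
      refine ⟨(i, ⟨d.2.toNat, by omega⟩), by simp [column], Prod.ext h1.symm ?_⟩
      exact Int.toNat_of_nonneg h2
  refine carpet_eq h₁ h₁₂ hA ?_ ?_ (isSelfAffine_of ?_ ?_)
  · rw [himage]
    exact isCompact_Icc.image (by fun_prop)
  · rw [himage]
    exact (Set.nonempty_Icc.2 zero_le_one).image _
  · rintro d hd z ⟨hz0, hz1⟩
    obtain ⟨h1, h2, h3⟩ := (hdig d).1 hd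
    refine ⟨?_, add_div_mem_Icc h2 h3 hz1⟩
    rw [cellMap_zero, hz0, h1]
    exact hfix
  · rintro x ⟨hx0, hx1⟩
    obtain ⟨j, hj, y, hy, e⟩ := exists_digit (show 0 < n₂ by omega) hx1
    refine ⟨(((i : ℕ) : ℤ), (j : ℤ)), (hdig _).2 ⟨rfl, ?_, ?_⟩, !₂[c, y], ⟨rfl, hy⟩,
      Plane.ext ?_ ?_⟩
    · dsimp only; omega
    · dsimp only; omega
    · rw [hx0]
      exact hfix
    · rw [← e]
      simp

theorem carpet_univ (h : A = Finset.univ) : carpet h₁ h₁₂ A hA = unitSquare := by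
  subst h
  refine carpet_eq h₁ h₁₂ hA isCompact_unitSquare isConnected_unitSquare.nonempty
    (isSelfAffine_unitSquare (by omega) (by omega) fun d => ?_)
  rw [mem_digits]
  constructor
  · rintro ⟨a, -, rfl⟩
    have := a.1.2
    have := a.2.2
    refine ⟨⟨?_, ?_⟩, ?_, ?_⟩ <;> dsimp only <;> omega
  · rintro ⟨⟨h1, h2⟩, h3, h4⟩
    exact ⟨(⟨d.1.toNat, by omega⟩, ⟨d.2.toNat, by omega⟩), Finset.mem_univ _,
      Prod.ext (Int.toNat_of_nonneg h1) (Int.toNat_of_nonneg h3)⟩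

end Exceptional

/-! ### Points, segments and the square -/

theorem isHolderCurve_singleton {X : Type*} [MetricSpace X] (x : X) (β : ℝ) :
    IsHolderCurve β ({x} : Set X) :=
  ⟨fun _ => x, continuous_const, Set.range_const, 0, fun _ _ => by simp⟩

theorem isSharpHolderExponent_segment {a b : Plane} (h : a ≠ b) :
    IsSharpHolderExponent 1 (segment ℝ a b) := by
  refine ⟨⟨one_pos, fun t => AffineMap.lineMap a b (t : ℝ), ?_, ?_, dist a b, ?_⟩, ?_⟩
  · exact AffineMap.lineMap_continuous.comp continuous_subtype_val
  · rw [segment_eq_image_lineMap]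
    ext x
    simp [unitInterval]
  · intro x y
    rw [dist_lineMap_lineMap, Real.rpow_one, Real.dist_eq, mul_comm]
  · rintro γ ⟨hγ, hcurve⟩
    exact hcurve.le_one hγ (left_mem_segment ℝ a b) (right_mem_segment ℝ a b) h

theorem isSharpHolderExponent_unitSquare : IsSharpHolderExponent (1 / 2) unitSquare := by
  refine ⟨⟨by norm_num, ?_⟩, fun γ hγ => hγ.2.le_half hγ.1⟩
  set D : Finset Cell := Finset.Ico 0 2 ×ˢ Finset.Ico 0 2
  have hmem : ∀ d : Cell, d ∈ D ↔ (0 ≤ d.1 ∧ d.1 < (2 : ℕ)) ∧ 0 ≤ d.2 ∧ d.2 < (2 : ℕ) := by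
    intro d
    simp [D]
  have hD : D.card = 4 := rfl
  have h := (isSelfAffine_unitSquare two_pos two_pos hmem).isHolderCurve
    (fun d hd => let h := (hmem d).1 hd; ⟨h.1.1, h.1.2, h.2.1, h.2.2⟩) isCompact_unitSquare
    isConnected_unitSquare le_rfl le_rfl (by omega)
  have e : Real.logb (2 : ℕ) D.card = 2 := by
    rw [hD, Real.logb_eq_iff_rpow_eq (by norm_num) (by norm_num) (by norm_num)]
    norm_num
  rwa [e] at h

/-! ### A carpet of similarity dimension above two -/

/-- A compact set that is covered by its own images is contained in each closed set that is mapped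
into itself. -/
theorem subset_of_subset_iUnion {p q : ℕ} (hp : 2 ≤ p) (hpq : p ≤ q) {D : Finset Cell}
    {B K : Set Plane} (hB : IsCompact B) (hcl : IsClosed K) (hne : K.Nonempty)
    (hBD : ∀ x ∈ B, ∃ d ∈ D, ∃ z ∈ B, cellMap p q d z = x)
    (hKD : ∀ d ∈ D, ∀ z ∈ K, cellMap p q d z ∈ K) : B ⊆ K := by
  intro x hx
  have hpR : (2 : ℝ) ≤ p := by exact_mod_cast hp
  -- the maps halve the distance of `B` from `K`
  obtain ⟨y, hy, hmax⟩ := hB.exists_isMaxOn ⟨x, hx⟩ (Metric.continuous_infDist_pt K).continuousOn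
  obtain ⟨d, hd, z, hz, rfl⟩ := hBD y hy
  obtain ⟨v, hv, hzv⟩ := hcl.exists_infDist_eq_dist hne z
  have h1 : Metric.infDist (cellMap p q d z) K ≤ (p : ℝ)⁻¹ * dist z v :=
    (Metric.infDist_le_dist_of_mem (hKD d hd v hv)).trans
      (dist_cellMap_cellMap_le (by linarith) (by exact_mod_cast hpq) d z v)
  have h2 : Metric.infDist z K ≤ Metric.infDist (cellMap p q d z) K := hmax hz
  have h3 : Metric.infDist x K ≤ Metric.infDist (cellMap p q d z) K := hmax hx
  have h4 : (p : ℝ)⁻¹ ≤ 2⁻¹ := inv_anti₀ two_pos hpR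
  have h5 : (p : ℝ)⁻¹ * dist z v ≤ 2⁻¹ * dist z v := by gcongr
  have h6 := Metric.infDist_nonneg (x := x) (s := K)
  rw [hcl.mem_iff_infDist_zero hne]
  linarith

/-- The left column of a `2 × 4` grid and the lower right cell. -/
def lShape : Finset (Fin 2 × Fin 4) := insert (1, 0) (column 4 0)

theorem lShape_nonempty : lShape.Nonempty := ⟨(1, 0), Finset.mem_insert_self _ _⟩

theorem isOrdinary_lShape : IsOrdinary lShape := by
  refine ⟨by decide, by decide, by decide⟩

theorem mem_digits_lShape {d : Cell} :
    d ∈ digits lShape ↔ d = (1, 0) ∨ (d.1 = 0 ∧ 0 ≤ d.2 ∧ d.2 < 4) := by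
  have : digits lShape = insert (1, 0) ({0} ×ˢ Finset.Ico 0 4) := by decide
  rw [this, Finset.mem_insert, Finset.mem_product, Finset.mem_singleton, Finset.mem_Ico]

/-- The component of the origin contains the lower and the left side of the square. Each image of
this component meets one of these sides. -/
theorem isConnected_carpet_lShape :
    IsConnected (carpet (n₁ := 2) (n₂ := 4) le_rfl (by norm_num) lShape lShape_nonempty) := by
  set K := carpet (n₁ := 2) (n₂ := 4) le_rfl (by norm_num) lShape lShape_nonempty
  have hK : IsSelfAffine 2 4 (digits lShape) K := isSelfAffine_carpet _ _ _
  have hc : IsCompact K := isCompact_carpet _ _ _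
  have hKne : K.Nonempty := (isAttractor_carpet _ _ _ lShape_nonempty).2.1
  have hsq : K ⊆ unitSquare :=
    hK.subset_unitSquare (isDigitSet_digits lShape) hc le_rfl (by norm_num)
  have hmaps : ∀ d ∈ digits lShape, ∀ z ∈ K, cellMap (2 : ℕ) (4 : ℕ) d z ∈ K := fun d hd z hz =>
    hK.mem_iff.2 ⟨d, hd, z, hz, rfl⟩
  have hIcc : IsConnected (Set.Icc (0 : ℝ) 1) := isConnected_Icc zero_le_one
  set lower : Set Plane := (fun x : ℝ => (!₂[x, 0] : Plane)) '' Set.Icc 0 1 with hlower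
  set left : Set Plane := (fun y : ℝ => (!₂[0, y] : Plane)) '' Set.Icc 0 1 with hleft
  have hlowerK : lower ⊆ K := by
    refine subset_of_subset_iUnion (D := digits lShape) le_rfl (by norm_num : 2 ≤ 4)
      (isCompact_Icc.image (by fun_prop)) hc.isClosed hKne ?_ hmaps
    rintro _ ⟨x, hx, rfl⟩
    obtain ⟨i, hi, y, hy, rfl⟩ := exists_digit two_pos hx
    refine ⟨((i : ℤ), 0), mem_digits_lShape.2 ?_, !₂[y, 0], ⟨y, hy, rfl⟩, ?_⟩
    · interval_cases i <;> simp
    · exact Plane.ext (by simp) (by simp)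
  have hleftK : left ⊆ K := by
    refine subset_of_subset_iUnion (D := digits lShape) le_rfl (by norm_num : 2 ≤ 4)
      (isCompact_Icc.image (by fun_prop)) hc.isClosed hKne ?_ hmaps
    rintro _ ⟨x, hx, rfl⟩
    obtain ⟨j, hj, y, hy, rfl⟩ := exists_digit four_pos hx
    refine ⟨(0, (j : ℤ)), mem_digits_lShape.2 (.inr ⟨rfl, ?_, ?_⟩), !₂[0, y], ⟨y, hy, rfl⟩, ?_⟩
    · dsimp only; omega
    · dsimp only; omega
    · exact Plane.ext (by simp) (by simp)
  have h0lower : (!₂[0, 0] : Plane) ∈ lower := ⟨0, by simp, rfl⟩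
  have h0left : (!₂[0, 0] : Plane) ∈ left := ⟨0, by simp, rfl⟩
  have h0 : (!₂[0, 0] : Plane) ∈ K := hlowerK h0lower
  set C := connectedComponentIn K !₂[0, 0]
  have hCK : C ⊆ K := connectedComponentIn_subset _ _
  have hC0 : (!₂[0, 0] : Plane) ∈ C := mem_connectedComponentIn h0
  have hC : IsPreconnected C := isPreconnected_connectedComponentIn
  have hClosed : IsClosed C := by
    refine isClosed_of_closure_subset ?_
    exact hC.closure.subset_connectedComponentIn (subset_closure hC0)
      (closure_minimal hCK hc.isClosed)
  have hlowerC : lower ⊆ C :=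
    (hIcc.image _ (by fun_prop)).isPreconnected.subset_connectedComponentIn h0lower hlowerK
  have hleftC : left ⊆ C :=
    (hIcc.image _ (by fun_prop)).isPreconnected.subset_connectedComponentIn h0left hleftK
  have hCD : ∀ d ∈ digits lShape, ∀ z ∈ C, cellMap (2 : ℕ) (4 : ℕ) d z ∈ C := by
    intro d hd z hz
    have hmem : cellMap (2 : ℕ) (4 : ℕ) d !₂[0, 0] ∈ C := by
      rcases mem_digits_lShape.1 hd with rfl | ⟨h1, h2, h3⟩
      · exact hlowerC ⟨1 / 2, by norm_num, Plane.ext (by simp) (by simp)⟩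
      · refine hleftC ⟨(d.2 + 0) / (4 : ℕ), ?_, Plane.ext (by simp [h1]) (by simp)⟩
        exact add_div_mem_Icc h2 (by exact_mod_cast h3) (by simp)
    have himage : IsPreconnected (cellMap (2 : ℕ) (4 : ℕ) d '' C) :=
      hC.image _ (continuous_cellMap _ _ _).continuousOn
    have := himage.subset_connectedComponentIn (Set.mem_image_of_mem _ hC0) (F := K) (by
      rintro _ ⟨y, hy, rfl⟩
      exact hmaps d hd y (hCK hy))
    rw [← connectedComponentIn_eq hmem] at this
    exact this (Set.mem_image_of_mem _ hz)
  have hKC : K ⊆ C := subset_of_subset_iUnion le_rfl (by norm_num : 2 ≤ 4) hc hClosed ⟨_, hC0⟩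
    (fun x hx => hK.mem_iff.1 hx) hCD
  exact ⟨hKne, hKC.antisymm hCK ▸ hC⟩

theorem two_lt_logb_card_lShape : 2 < Real.logb (2 : ℕ) lShape.card := by
  have h : lShape.card = 5 := by decide
  rw [h, Real.lt_logb_iff_rpow_lt (by norm_num) (by norm_num)]
  norm_num

end HolderCarpet

theorem theorem1p4 :
    (∀ (n₁ n₂ : ℕ) (h₁ : 2 ≤ n₁) (h₁₂ : n₁ ≤ n₂) (A : Finset (Fin n₁ × Fin n₂))
        (hA : A.Nonempty),
      -- the similarity dimension of the iterated function system
      (∀ s : ℝ, HolderCarpet.IsSimilarityDim (HolderCarpet.carpetIFS A) s ↔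
        s = Real.logb n₁ A.card) ∧
      -- the carpets of the exceptional index sets
      (A.card = 1 → ∃ p, HolderCarpet.carpet h₁ h₁₂ A hA = {p}) ∧
      (∀ i : Fin n₁, A = HolderCarpet.column n₂ i →
        HolderCarpet.carpet h₁ h₁₂ A hA =
          HolderCarpet.verticalSegment (((i : ℕ) : ℝ) / ((n₁ : ℝ) - 1))) ∧
      (A = Finset.univ → HolderCarpet.carpet h₁ h₁₂ A hA = HolderCarpet.unitSquare) ∧
      -- the Hölder exponents
      (IsConnected (HolderCarpet.carpet h₁ h₁₂ A hA) →
        ((∃ p, HolderCarpet.carpet h₁ h₁₂ A hA = {p}) →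
          ∀ β : ℝ, 0 < β →
            HolderCarpet.IsHolderCurve β (HolderCarpet.carpet h₁ h₁₂ A hA)) ∧
        ((∃ a b : HolderCarpet.Plane, a ≠ b ∧
            HolderCarpet.carpet h₁ h₁₂ A hA = segment ℝ a b) →
          HolderCarpet.IsSharpHolderExponent 1 (HolderCarpet.carpet h₁ h₁₂ A hA)) ∧
        (HolderCarpet.carpet h₁ h₁₂ A hA = HolderCarpet.unitSquare →
          HolderCarpet.IsSharpHolderExponent (1 / 2) (HolderCarpet.carpet h₁ h₁₂ A hA)) ∧
        (HolderCarpet.IsOrdinary A →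
          HolderCarpet.IsSharpHolderExponent (1 / Real.logb n₁ A.card)
            (HolderCarpet.carpet h₁ h₁₂ A hA)))) ∧
    -- the similarity dimension can exceed two in the last case
    (∃ (n₁ n₂ : ℕ) (h₁ : 2 ≤ n₁) (h₁₂ : n₁ ≤ n₂) (A : Finset (Fin n₁ × Fin n₂))
        (hA : A.Nonempty),
      IsConnected (HolderCarpet.carpet h₁ h₁₂ A hA) ∧ HolderCarpet.IsOrdinary A ∧
        2 < Real.logb n₁ A.card) := by
  refine ⟨fun n₁ n₂ h₁ h₁₂ A hA => ⟨HolderCarpet.isSimilarityDim_carpetIFS h₁ h₁₂ hA,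
    HolderCarpet.carpet_of_card_eq_one h₁ h₁₂ hA, fun i => HolderCarpet.carpet_column h₁ h₁₂ hA,
    HolderCarpet.carpet_univ h₁ h₁₂ hA, fun hconn => ⟨?_, ?_, ?_, ?_⟩⟩,
    2, 4, le_rfl, by norm_num, HolderCarpet.lShape, HolderCarpet.lShape_nonempty,
    HolderCarpet.isConnected_carpet_lShape, HolderCarpet.isOrdinary_lShape,
    HolderCarpet.two_lt_logb_card_lShape⟩
  · rintro ⟨p, hp⟩ β -
    rw [hp]
    exact HolderCarpet.isHolderCurve_singleton p β
  · rintro ⟨a, b, hab, hseg⟩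
    rw [hseg]
    exact HolderCarpet.isSharpHolderExponent_segment hab
  · intro hsq
    rw [hsq]
    exact HolderCarpet.isSharpHolderExponent_unitSquare
  · rintro ⟨hone, hcol, huniv⟩
    rw [← HolderCarpet.card_digits A]
    exact (HolderCarpet.isSelfAffine_carpet h₁ h₁₂ hA).isSharpHolderExponent
      (HolderCarpet.isDigitSet_digits A) (HolderCarpet.isCompact_carpet h₁ h₁₂ hA) hconn h₁ h₁₂
      (by rwa [HolderCarpet.card_digits]) (HolderCarpet.digits_ne_column hA hcol)
      (HolderCarpet.digits_ne_univ huniv)
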